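/- Let $k\ge 3$, let $M$ be a smooth manifold of dimension $n=d+k$ (without boundary), and let $f\colon M\to\mathbb R^N$ be a smooth immersion that is scalar positive, i.e. the Riemannian metric induced on $M$ by $f$ has positive scalar curvature. Let $S\subset M$ be a closed (compact, without boundary) embedded submanifold of dimension $d$. For $q\in S$ let $\nu_q\subset df(T_qM)\subset\mathbb R^N$ be the orthogonal complement of $df(T_qS)$ in $df(T_qM)$, and let $S_1(\nu)=\{(q,\omega): q\in S,\ \omega\in\nu_q,\ |\omega|=1\}$ be the unit normal bundle of $S$ in $M$. Let $\alpha_f$ be the second fundamental form of $f$ and $\xi=\operatorname{tr}\alpha_f/|\operatorname{tr}\alpha_f|$, a unit normal field of $f$. For a smooth curve $\gamma=(a,b)\colon I\to\mathbb R^2$ on a compact interval $I$ define $$F_\gamma\colon S_1(\nu)\times I\to\mathbb R^N,\qquad F_\gamma(q,\omega,s)=f(q)+a(s)\,\omega+b(s)\,\xi(q).$$ If $\gamma$ has unit speed and $a\neq 0$ on $I$, put $\kappa=a'b''-a''b'$ and $\sigma=b'/a$. Call $\gamma$ *controlled* if it has unit speed, $a(s)\ne0$ for all $s\in I$, and $\frac{2-k}{4}\sigma\le\kappa\le\sigma$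 on $I$; call $\gamma$ *of extent* $\rho$ if $|\gamma(s)|<\rho$ for all $s\in I$. Then for every $\rho_0>0$ there exist constants $C\ge0$ and $0<\rho\le\rho_0$, depending only on $f$, $S$ and $\rho_0$, such that for every compact interval $I$ and every controlled curve $\gamma\colon I\to\mathbb R^2$ of extent $\rho$, the map $F_\gamma$ is an immersion, and the scalar curvature of the metric it induces satisfies $$\operatorname{scal}_{F_\gamma}(q,\omega,s)\ \ge\ \frac{(k-1)(k-2)}{16}\,\sigma(s)^2-C\,\sigma(s)-C\qquad\text{for all }(q,\omega,s)\in S_1(\nu)\times I.$$ In particular, there is a constant $\sigma_0>0$ such that $F_\gamma$ is a scalar positive immersion for every controlled curve $\gamma$ of extent $\rho$ with $\sigma\ge\sigma_0$ on $I$. -/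

import Mathlib

open scoped Manifold ContDiff RealInnerProductSpace Topology

set_option linter.unusedSectionVars false

noncomputable section

namespace Bending

/-! ### Scalar curvature of a Riemannian metric in coordinates -/

section Coordinates

variable {V : Type*} [NormedAddCommGroup V] [NormedSpace ℝ V]
  {κ : Type*} [Fintype κ] [DecidableEq κ]

/-- The partial derivative of `u` in the direction of the `i`-th basis vector. -/
def partialDeriv (b : Module.Basis κ ℝ V) (i : κ) (u : V → ℝ) (x : V) : ℝ :=
  fderiv ℝ u x (b i)

/-- Christoffel symbols `Γ^l_{ij}` of the metric with components `g_{ij}`. -/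
def christoffel (b : Module.Basis κ ℝ V) (g : V → Matrix κ κ ℝ) (l i j : κ) (x : V) : ℝ :=
  (1 / 2 : ℝ) * ∑ m, (g x)⁻¹ l m *
    (partialDeriv b i (fun y => g y j m) x + partialDeriv b j (fun y => g y i m) x
      - partialDeriv b m (fun y => g y i j) x)

/-- Ricci curvature
`R_{ij} = ∂_l Γ^l_{ij} - ∂_j Γ^l_{il} + Γ^l_{lm} Γ^m_{ij} - Γ^l_{jm} Γ^m_{il}`. -/
def ricci (b : Module.Basis κ ℝ V) (g : V → Matrix κ κ ℝ) (i j : κ) (x : V) : ℝ :=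
  ∑ l, (partialDeriv b l (christoffel b g l i j) x - partialDeriv b j (christoffel b g l i l) x)
    + ∑ l, ∑ m, (christoffel b g l l m x * christoffel b g m i j x
      - christoffel b g l j m x * christoffel b g m i l x)

/-- (Unnormalized) scalar curvature `g^{ij} R_{ij}`. -/
def metricScal (b : Module.Basis κ ℝ V) (g : V → Matrix κ κ ℝ) (x : V) : ℝ :=
  ∑ i, ∑ j, (g x)⁻¹ i j * ricci b g i j x

end Coordinates

/-! ### Immersions into a Euclidean space and their curvature quantities -/

section Immersions

variable {V : Type*} [NormedAddCommGroup V] [NormedSpace ℝ V] [FiniteDimensional ℝ V]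
  {H : Type*} [TopologicalSpace H] (I : ModelWithCorners ℝ V H)
  {X : Type*} [TopologicalSpace X] [ChartedSpace H X]
  {V' : Type*} [NormedAddCommGroup V'] [NormedSpace ℝ V']
  {H' : Type*} [TopologicalSpace H'] (I' : ModelWithCorners ℝ V' H')
  {Y : Type*} [TopologicalSpace Y] [ChartedSpace H' Y]
  {E : Type*} [NormedAddCommGroup E] [InnerProductSpace ℝ E] [FiniteDimensional ℝ E]

/-- `F` is smooth near `p` with injective differential at `p`. -/
def IsImmersionAt (F : X → Y) (p : X) : Prop :=
  ContMDiffAt I I' ∞ F p ∧ Function.Injective (mfderiv I I' F p)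

/-- A smooth immersion. -/
structure Immersion (X : Type*) [TopologicalSpace X] [ChartedSpace H X]
    (Y : Type*) [TopologicalSpace Y] [ChartedSpace H' Y] where
  toFun : X → Y
  contMDiff : ContMDiff I I' ∞ toFun
  mfderiv_injective : ∀ p, Function.Injective (mfderiv I I' toFun p)

/-- A smooth embedding. -/
structure Embedding (X : Type*) [TopologicalSpace X] [ChartedSpace H X]
    (Y : Type*) [TopologicalSpace Y] [ChartedSpace H' Y] extends Immersion I I' X Y where
  isEmbedding : Topology.IsEmbedding toFun

/-- The map `F` read in the preferred chart at `p`. (Only used for manifolds without boundary.) -/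
def localRep (F : X → E) (p : X) : V → E := F ∘ (extChartAt I p).symm

/-- The components `g_{ij} = ⟨∂_i F, ∂_j F⟩` of the Riemannian metric induced by `F`, in the
preferred chart at `p`. -/
def inducedMetric (F : X → E) (p : X) (x : V) :
    Matrix (Fin (Module.finrank ℝ V)) (Fin (Module.finrank ℝ V)) ℝ :=
  Matrix.of fun i j =>
    ⟪fderiv ℝ (localRep I F p) x (Module.finBasis ℝ V i),
      fderiv ℝ (localRep I F p) x (Module.finBasis ℝ V j)⟫

/-- The scalar curvature at `p` of the Riemannian metric induced by `F`. -/
def scalarCurvature (F : X → E) (p : X) : ℝ :=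
  metricScal (Module.finBasis ℝ V) (inducedMetric I F p) (extChartAt I p p)

/-- `F` is, at the points of `A`, an immersion whose induced metric has positive scalar
curvature. -/
def IsScalarPositiveOn (F : X → E) (A : Set X) : Prop :=
  ∀ p ∈ A, IsImmersionAt I 𝓘(ℝ, E) F p ∧ 0 < scalarCurvature I F p

/-- The differential of `F` at `p`, as a linear map into `E`. -/
def differential (F : X → E) (p : X) : V →L[ℝ] E := mfderiv I 𝓘(ℝ, E) F p

/-- The image `dF(T_p X)`, a subspace of the Euclidean space `E`. -/
def tangentImage (F : X → E) (p : X) : Submodule ℝ E :=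
  LinearMap.range (differential I F p).toLinearMap

/-- The second fundamental form `α_F(v, w)`: the part of the second derivative
of `F` that is normal to `dF(T_p X)`.
Tangent vectors at `p` are given by their components in the preferred chart at `p`. -/
def secondFundamentalForm (F : X → E) (p : X) (v w : V) : E :=
  (tangentImage I F p)ᗮ.starProjection
    (fderiv ℝ (fderiv ℝ (localRep I F p)) (extChartAt I p p) v w)

/-- The (unnormalized) mean curvature field `tr α_F = g^{ij} α_F(∂_i, ∂_j)`. -/
def meanCurvature (F : X → E) (p : X) : E :=
  ∑ i, ∑ j, (inducedMetric I F p (extChartAt I p p))⁻¹ i j •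
    secondFundamentalForm I F p (Module.finBasis ℝ V i) (Module.finBasis ℝ V j)

/-- The unit normal field `ξ = tr α_F / |tr α_F|`. -/
def xi (F : X → E) (p : X) : E :=
  ‖meanCurvature I F p‖⁻¹ • meanCurvature I F p

end Immersions

/-! ### Smoothness of orthogonal projections onto tangent images -/

section Projections

variable {V : Type*} [NormedAddCommGroup V] [NormedSpace ℝ V]
  {W : Type*} [NormedAddCommGroup W] [InnerProductSpace ℝ W] [FiniteDimensional ℝ W]
  {E : Type*} [NormedAddCommGroup E] [InnerProductSpace ℝ E] [FiniteDimensional ℝ E]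

theorem clm_mul_apply (A B : E →L[ℝ] E) (v : E) : (A * B) v = A (B v) := rfl

theorem contDiff_adjoint :
    ContDiff ℝ ∞ (fun A : W →L[ℝ] E => ContinuousLinearMap.adjoint A) := by
  let L : (W →L[ℝ] E) →ₗ[ℝ] (E →L[ℝ] W) :=
    { toFun := fun A => ContinuousLinearMap.adjoint A
      map_add' := fun A B => map_add _ A B
      map_smul' := fun c A => by simp }
  exact (LinearMap.toContinuousLinearMap L).contDiff

theorem gram_isInvertible {A : W →L[ℝ] E} (hA : Function.Injective A) :
    ((ContinuousLinearMap.adjoint A).comp A).IsInvertible := by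
  have hinj : Function.Injective ((ContinuousLinearMap.adjoint A).comp A) := by
    rw [injective_iff_map_eq_zero]
    intro x hx
    have h1 : ⟪A x, A x⟫ = 0 := by
      rw [← ContinuousLinearMap.adjoint_inner_left]
      rw [ContinuousLinearMap.comp_apply] at hx
      rw [hx, inner_zero_left]
    exact (injective_iff_map_eq_zero A).1 hA x (inner_self_eq_zero.1 h1)
  exact ⟨(LinearEquiv.ofInjectiveEndo _ hinj).toContinuousLinearEquiv, by ext x; rfl⟩

theorem starProjection_range {A : W →L[ℝ] E} (hA : Function.Injective A) :
    (LinearMap.range A.toLinearMap).starProjection =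
      A.comp (((ContinuousLinearMap.adjoint A).comp A).inverse.comp
        (ContinuousLinearMap.adjoint A)) := by
  ext v
  have hG := gram_isInvertible hA
  apply Submodule.eq_starProjection_of_mem_of_inner_eq_zero
  · exact ⟨_, rfl⟩
  · rintro _ ⟨x, rfl⟩
    set y := ((ContinuousLinearMap.adjoint A).comp A).inverse (ContinuousLinearMap.adjoint A v)
      with hy
    have h2 : ((ContinuousLinearMap.adjoint A).comp A) y = ContinuousLinearMap.adjoint A v := by
      rw [hy]; exact hG.self_apply_inverse _
    change ⟪v - A y, A x⟫ = 0
    rw [← ContinuousLinearMap.adjoint_inner_left, map_sub, ← h2]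
    simp

theorem contDiffAt_starProjection_range {D : V → (W →L[ℝ] E)} {x : V}
    (hD : ContDiffAt ℝ ∞ D x) (hinj : ∀ᶠ y in 𝓝 x, Function.Injective (D y)) :
    ContDiffAt ℝ ∞ (fun y => (LinearMap.range (D y).toLinearMap).starProjection) x := by
  have hadj : ContDiffAt ℝ ∞ (fun y => ContinuousLinearMap.adjoint (D y)) x :=
    contDiff_adjoint.contDiffAt.comp x hD
  have hG := hadj.clm_comp hD
  have hinv : ContDiffAt ℝ ∞
      (fun y => ((ContinuousLinearMap.adjoint (D y)).comp (D y)).inverse) x :=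
    ContDiffAt.comp (g := ContinuousLinearMap.inverse) x
      ((gram_isInvertible hinj.self_of_nhds).contDiffAt_map_inverse) hG
  refine (hD.clm_comp (hinv.clm_comp hadj)).congr_of_eventuallyEq ?_
  filter_upwards [hinj] with y hy using starProjection_range hy

end Projections

/-! ### The unit normal bundle of a submanifold, as a smooth manifold -/

section UnitNormal

variable {n d : ℕ}
  {M : Type*} [TopologicalSpace M] [ChartedSpace (EuclideanSpace ℝ (Fin n)) M]
  {S : Type*} [TopologicalSpace S] [ChartedSpace (EuclideanSpace ℝ (Fin d)) S]
  {E : Type*} [NormedAddCommGroup E] [InnerProductSpace ℝ E] [FiniteDimensional ℝ E]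

/-- The restriction `f ∘ ι` of an immersion to a submanifold. -/
def Immersion.restrict (f : Immersion (𝓡 n) 𝓘(ℝ, E) M E) (ι : Embedding (𝓡 d) (𝓡 n) S M) :
    Immersion (𝓡 d) 𝓘(ℝ, E) S E where
  toFun := f.toFun ∘ ι.toFun
  contMDiff := f.contMDiff.comp ι.contMDiff
  mfderiv_injective q := by
    rw [mfderiv_comp q (f.contMDiff.mdifferentiableAt (by simp))
      (ι.contMDiff.mdifferentiableAt (by simp))]
    exact (f.mfderiv_injective _).comp (ι.mfderiv_injective q)

theorem tangentImage_eq [IsManifold (𝓡 n) ∞ M] (f : Immersion (𝓡 n) 𝓘(ℝ, E) M E) (p₀ : M)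
    {y : EuclideanSpace ℝ (Fin n)} (hy : y ∈ (extChartAt (𝓡 n) p₀).target) :
    tangentImage (𝓡 n) f.toFun ((extChartAt (𝓡 n) p₀).symm y) = LinearMap.range
      (fderiv ℝ (localRep (𝓡 n) f.toFun p₀) y).toLinearMap ∧
    Function.Injective (fderiv ℝ (localRep (𝓡 n) f.toFun p₀) y) := by
  have hinv := isInvertible_mfderivWithin_extChartAt_symm (I := 𝓡 n) hy
  have hd := mdifferentiableWithinAt_extChartAt_symm (I := 𝓡 n) hy
  have hr : Set.range (𝓡 n) = Set.univ := by simp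
  rw [hr, mfderivWithin_univ] at hinv
  rw [hr, mdifferentiableWithinAt_univ] at hd
  obtain ⟨e, he⟩ := hinv
  have key : ∀ v, fderiv ℝ (localRep (𝓡 n) f.toFun p₀) y v =
      differential (𝓡 n) f.toFun ((extChartAt (𝓡 n) p₀).symm y) (e v) := by
    intro v
    rw [← mfderiv_eq_fderiv]
    have h := mfderiv_comp y (f.contMDiff.mdifferentiableAt (by simp)) hd
    rw [← he] at h
    exact congrArg (fun A => A v) h
  constructor
  · ext v
    constructor
    · rintro ⟨w, rfl⟩
      refine ⟨e.symm w, (key _).trans ?_⟩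
      exact congrArg (differential (𝓡 n) f.toFun _) (e.apply_symm_apply w)
    · rintro ⟨w, rfl⟩
      exact ⟨e w, (key w).symm⟩
  · intro v w hvw
    rw [key, key] at hvw
    exact e.injective (f.mfderiv_injective _ hvw)

theorem finrank_tangentImage (f : Immersion (𝓡 n) 𝓘(ℝ, E) M E) (p : M) :
    Module.finrank ℝ (tangentImage (𝓡 n) f.toFun p) = n := by
  have hinj : Function.Injective (differential (𝓡 n) f.toFun p).toLinearMap :=
    f.mfderiv_injective p
  rw [tangentImage, LinearMap.finrank_range_of_inj hinj]
  simp

theorem contMDiff_starProjection_tangentImage [IsManifold (𝓡 n) ∞ M]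
    (f : Immersion (𝓡 n) 𝓘(ℝ, E) M E) :
    ContMDiff (𝓡 n) 𝓘(ℝ, E →L[ℝ] E) ∞
      (fun p => (tangentImage (𝓡 n) f.toFun p).starProjection) := by
  intro p₀
  have hsrc : (extChartAt (𝓡 n) p₀).source ∈ 𝓝 p₀ := extChartAt_source_mem_nhds p₀
  have htgt : (extChartAt (𝓡 n) p₀).target ∈ 𝓝 (extChartAt (𝓡 n) p₀ p₀) :=
    extChartAt_target_mem_nhds p₀
  have hsm : ContDiffAt ℝ ∞ (localRep (𝓡 n) f.toFun p₀) (extChartAt (𝓡 n) p₀ p₀) := by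
    have h1 := f.contMDiff.comp_contMDiffOn (contMDiffOn_extChartAt_symm (I := 𝓡 n) (n := ∞) p₀)
    exact (contMDiffAt_iff_contDiffAt.1 (h1.contMDiffAt htgt))
  have hD : ContDiffAt ℝ ∞ (fderiv ℝ (localRep (𝓡 n) f.toFun p₀)) (extChartAt (𝓡 n) p₀ p₀) :=
    hsm.fderiv_right (by simp)
  have hinj : ∀ᶠ y in 𝓝 (extChartAt (𝓡 n) p₀ p₀),
      Function.Injective (fderiv ℝ (localRep (𝓡 n) f.toFun p₀) y) := by
    filter_upwards [htgt] with y hy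
    exact (tangentImage_eq f p₀ hy).2
  have h := contDiffAt_starProjection_range hD hinj
  refine (h.contMDiffAt.comp p₀ (contMDiffAt_extChartAt (I := 𝓡 n) (n := ∞))).congr_of_eventuallyEq
    ?_
  filter_upwards [hsrc] with p hp
  simp only [Function.comp_apply]
  congr 1
  have h := (tangentImage_eq f p₀ ((extChartAt (𝓡 n) p₀).map_source hp)).1
  rwa [(extChartAt (𝓡 n) p₀).left_inv hp] at h

/-- The fibre of the normal bundle of `S` in `M` at `q`, seen as a subspace of `E` by means of the
differential of `f`. -/
def normalSpace (f : Immersion (𝓡 n) 𝓘(ℝ, E) M E) (ι : Embedding (𝓡 d) (𝓡 n) S M) (q : S) :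
    Submodule ℝ E :=
  tangentImage (𝓡 n) f.toFun (ι.toFun q) ⊓ (tangentImage (𝓡 d) (f.toFun ∘ ι.toFun) q)ᗮ

/-- The unit sphere bundle of the normal bundle of `S` in `M`. -/
def UnitNormal (f : Immersion (𝓡 n) 𝓘(ℝ, E) M E) (ι : Embedding (𝓡 d) (𝓡 n) S M) : Type _ :=
  {p : S × E // p.2 ∈ normalSpace f ι p.1 ∧ ‖p.2‖ = 1}

instance (f : Immersion (𝓡 n) 𝓘(ℝ, E) M E) (ι : Embedding (𝓡 d) (𝓡 n) S M) :
    TopologicalSpace (UnitNormal f ι) :=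
  inferInstanceAs (TopologicalSpace {p : S × E // p.2 ∈ normalSpace f ι p.1 ∧ ‖p.2‖ = 1})

variable (f : Immersion (𝓡 n) 𝓘(ℝ, E) M E) (ι : Embedding (𝓡 d) (𝓡 n) S M)

theorem tangentImage_restrict_le (q : S) :
    tangentImage (𝓡 d) (f.toFun ∘ ι.toFun) q ≤ tangentImage (𝓡 n) f.toFun (ι.toFun q) := by
  rintro _ ⟨w, rfl⟩
  refine ⟨mfderiv (𝓡 d) (𝓡 n) ι.toFun q w, ?_⟩
  have := mfderiv_comp q (f.contMDiff.mdifferentiableAt (x := ι.toFun q) (by simp))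
      (ι.contMDiff.mdifferentiableAt (x := q) (by simp))
  exact (congrArg (fun A => A w) this).symm

theorem starProjection_normalSpace (q : S) :
    (normalSpace f ι q).starProjection =
      (tangentImage (𝓡 n) f.toFun (ι.toFun q)).starProjection
        - (tangentImage (𝓡 d) (f.toFun ∘ ι.toFun) q).starProjection := by
  ext v
  have hle := tangentImage_restrict_le f ι q
  set A := tangentImage (𝓡 n) f.toFun (ι.toFun q)
  set B := tangentImage (𝓡 d) (f.toFun ∘ ι.toFun) q
  change (A ⊓ Bᗮ).starProjection v = A.starProjection v - B.starProjection v
  apply Submodule.eq_starProjection_of_mem_of_inner_eq_zero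
  · refine ⟨A.sub_mem (A.starProjection_apply_mem v) (hle (B.starProjection_apply_mem v)), ?_⟩
    have h1 : v - B.starProjection v ∈ Bᗮ := B.sub_starProjection_mem_orthogonal v
    have h2 : v - A.starProjection v ∈ Bᗮ :=
      Submodule.orthogonal_le hle (A.sub_starProjection_mem_orthogonal v)
    have := Bᗮ.sub_mem h1 h2
    simpa using this
  · rintro w ⟨hwA, hwB⟩
    have h1 : ⟪v - A.starProjection v, w⟫ = 0 := A.starProjection_inner_eq_zero v w hwA
    have h2 : ⟪B.starProjection v, w⟫ = 0 := hwB _ (B.starProjection_apply_mem v)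
    rw [← sub_add, inner_add_left, h1, h2, add_zero]

theorem contMDiff_starProjection_normalSpace [IsManifold (𝓡 n) ∞ M] [IsManifold (𝓡 d) ∞ S] :
    ContMDiff (𝓡 d) 𝓘(ℝ, E →L[ℝ] E) ∞ (fun q => (normalSpace f ι q).starProjection) := by
  simp only [starProjection_normalSpace]
  exact ((contMDiff_starProjection_tangentImage f).comp ι.contMDiff).sub
    (contMDiff_starProjection_tangentImage (f.restrict ι))

theorem finrank_normalSpace (q : S) : d + Module.finrank ℝ (normalSpace f ι q) = n := by
  have h := Submodule.finrank_add_inf_finrank_orthogonal (tangentImage_restrict_le f ι q)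
  rw [finrank_tangentImage f] at h
  have h2 : Module.finrank ℝ (tangentImage (𝓡 d) (f.toFun ∘ ι.toFun) q) = d :=
    finrank_tangentImage (f.restrict ι) q
  rw [h2, inf_comm] at h
  exact h

variable {f ι}

/-- The foot point of a unit normal vector. -/
def UnitNormal.base (p : UnitNormal f ι) : S := p.1.1

/-- The unit vector `ω ∈ E`. -/
def UnitNormal.vec (p : UnitNormal f ι) : E := p.1.2

theorem UnitNormal.vec_mem (p : UnitNormal f ι) : p.vec ∈ normalSpace f ι p.base := p.2.1

theorem UnitNormal.norm_vec (p : UnitNormal f ι) : ‖p.vec‖ = 1 := p.2.2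

theorem UnitNormal.continuous_base : Continuous (UnitNormal.base : UnitNormal f ι → S) :=
  continuous_fst.comp continuous_subtype_val

theorem UnitNormal.continuous_vec : Continuous (UnitNormal.vec : UnitNormal f ι → E) :=
  continuous_snd.comp continuous_subtype_val

theorem UnitNormal.ext {p p' : UnitNormal f ι} (h1 : p.base = p'.base) (h2 : p.vec = p'.vec) :
    p = p' :=
  Subtype.ext (Prod.ext h1 h2)

/-- The orthogonal complement of `ω` in its normal space. -/
def UnitNormal.perp (p : UnitNormal f ι) : Submodule ℝ E :=
  (ℝ ∙ p.vec)ᗮ ⊓ normalSpace f ι p.base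

theorem UnitNormal.finrank_perp (p : UnitNormal f ι) :
    Module.finrank ℝ p.perp = n - d - 1 := by
  have hle : (ℝ ∙ p.vec) ≤ normalSpace f ι p.base := by
    rw [Submodule.span_singleton_le_iff_mem]; exact p.vec_mem
  have h := Submodule.finrank_add_inf_finrank_orthogonal hle
  have h0 : p.vec ≠ 0 := by
    intro h0
    have := p.norm_vec
    simp [h0] at this
  rw [finrank_span_singleton h0] at h
  have h2 := finrank_normalSpace f ι p.base
  change 1 + Module.finrank ℝ p.perp = _ at h
  omega

/-- An orthonormal frame of the orthogonal complement of `ω` in its normal space. -/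
def UnitNormal.frame (p : UnitNormal f ι) : EuclideanSpace ℝ (Fin (n - d - 1)) →ₗᵢ[ℝ] E :=
  p.perp.subtypeₗᵢ.comp
    ((stdOrthonormalBasis ℝ p.perp).reindex (finCongr p.finrank_perp)).repr.symm.toLinearIsometry

theorem UnitNormal.frame_mem (p : UnitNormal f ι) (y : EuclideanSpace ℝ (Fin (n - d - 1))) :
    p.frame y ∈ p.perp :=
  Subtype.property _

/-- The coordinates of the projection of a vector onto the orthogonal complement of `ω`. -/
def UnitNormal.coframe (p : UnitNormal f ι) : E →L[ℝ] EuclideanSpace ℝ (Fin (n - d - 1)) :=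
  ContinuousLinearMap.adjoint p.frame.toContinuousLinearMap

theorem UnitNormal.coframe_frame (p : UnitNormal f ι)
    (y : EuclideanSpace ℝ (Fin (n - d - 1))) : p.coframe (p.frame y) = y := by
  refine ext_inner_right ℝ fun z => ?_
  rw [coframe, ContinuousLinearMap.adjoint_inner_left]
  exact p.frame.inner_map_map y z

theorem UnitNormal.coframe_eq_zero (p : UnitNormal f ι) {v : E} (hv : v ∈ p.perpᗮ) :
    p.coframe v = 0 := by
  refine ext_inner_right ℝ fun z => ?_
  rw [coframe, ContinuousLinearMap.adjoint_inner_left, inner_zero_left, real_inner_comm]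
  exact hv _ (p.frame_mem z)

theorem UnitNormal.frame_coframe (p : UnitNormal f ι) {v : E} (hv : v ∈ p.perp) :
    p.frame (p.coframe v) = v := by
  obtain ⟨y, rfl⟩ : ∃ y, p.frame y = v := by
    refine ⟨((stdOrthonormalBasis ℝ p.perp).reindex (finCongr p.finrank_perp)).repr ⟨v, hv⟩, ?_⟩
    simp [frame]
  rw [p.coframe_frame]

theorem UnitNormal.inner_vec_frame (p : UnitNormal f ι)
    (y : EuclideanSpace ℝ (Fin (n - d - 1))) : ⟪p.vec, p.frame y⟫ = 0 :=
  (p.frame_mem y).1 _ (Submodule.mem_span_singleton_self _)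

theorem UnitNormal.coframe_vec (p : UnitNormal f ι) : p.coframe p.vec = 0 := by
  refine p.coframe_eq_zero ?_
  intro w hw
  rw [real_inner_comm]
  exact hw.1 _ (Submodule.mem_span_singleton_self _)

/-- A vector of the normal space is determined by its components. -/
theorem UnitNormal.decomp (p : UnitNormal f ι) {v : E} (hv : v ∈ normalSpace f ι p.base) :
    ⟪p.vec, v⟫ • p.vec + p.frame (p.coframe v) = v := by
  have hmem : v - ⟪p.vec, v⟫ • p.vec ∈ p.perp := by
    refine ⟨?_, Submodule.sub_mem _ hv (Submodule.smul_mem _ _ p.vec_mem)⟩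
    refine Submodule.mem_orthogonal_singleton_iff_inner_right.2 ?_
    rw [ inner_sub_right, inner_smul_right,
      real_inner_self_eq_norm_sq, p.norm_vec]
    simp
  have h := p.frame_coframe hmem
  rw [map_sub, map_smul, p.coframe_vec, smul_zero, sub_zero] at h
  rw [h]; abel

/-- Transports the normal space at `q` to the normal space at the foot point of `p`; invertible
for `q` close to that point. -/
def UnitNormal.transport (p : UnitNormal f ι) (q : S) : E →L[ℝ] E :=
  (normalSpace f ι p.base).starProjection * (normalSpace f ι q).starProjection
    + (1 - (normalSpace f ι p.base).starProjection) * (1 - (normalSpace f ι q).starProjection)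

theorem UnitNormal.transport_self (p : UnitNormal f ι) : p.transport p.base = 1 := by
  have h := (normalSpace f ι p.base).isIdempotentElem_starProjection
  have h' : (normalSpace f ι p.base).starProjection * (normalSpace f ι p.base).starProjection
    = (normalSpace f ι p.base).starProjection := h
  rw [transport, mul_sub, sub_mul, sub_mul, h']
  simp

theorem UnitNormal.transport_apply (p : UnitNormal f ι) {q : S} {v : E}
    (hv : v ∈ normalSpace f ι q) :
    p.transport q v = (normalSpace f ι p.base).starProjection v := by
  have h := Submodule.starProjection_eq_self_iff.2 hv
  simp [transport, h]

theorem UnitNormal.inner_transport (p : UnitNormal f ι) {q : S} {v w : E}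
    (hv : v ∈ normalSpace f ι q) (hw : w ∈ normalSpace f ι p.base) :
    ⟪w, p.transport q v⟫ = ⟪w, v⟫ := by
  rw [p.transport_apply hv, ← Submodule.inner_starProjection_left_eq_right,
    Submodule.starProjection_eq_self_iff.2 hw]

theorem UnitNormal.coframe_transport (p : UnitNormal f ι) {q : S} {v : E}
    (hv : v ∈ normalSpace f ι q) : p.coframe (p.transport q v) = p.coframe v := by
  refine ext_inner_right ℝ fun z => ?_
  rw [coframe, ContinuousLinearMap.adjoint_inner_left, ContinuousLinearMap.adjoint_inner_left,
    real_inner_comm, real_inner_comm _ v]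
  exact p.inner_transport hv (p.frame_mem z).2

theorem UnitNormal.mem_of_transport_mem (p : UnitNormal f ι) {q : S} {v : E}
    (hq : IsUnit (p.transport q)) (hv : p.transport q v ∈ normalSpace f ι p.base) :
    v ∈ normalSpace f ι q := by
  have h1 := Submodule.starProjection_eq_self_iff.2 hv
  have h2 : p.transport q ((normalSpace f ι q).starProjection v) = p.transport q v := by
    rw [p.transport_apply (Submodule.starProjection_apply_mem _ v), ← h1]
    have h3 := congrArg (fun A : E →L[ℝ] E => A v)
      (normalSpace f ι p.base).isIdempotentElem_starProjection.eq
    simp only [clm_mul_apply] at h3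
    have h4 : ∀ u, (normalSpace f ι p.base).starProjection
        ((normalSpace f ι p.base).starProjection u) = (normalSpace f ι p.base).starProjection u :=
      fun u => Submodule.starProjection_eq_self_iff.2 (Submodule.starProjection_apply_mem _ u)
    simp [transport, h4]
  obtain ⟨u, hu⟩ := hq
  have h5 : ∀ x, (↑u⁻¹ : E →L[ℝ] E) (p.transport q x) = x := fun x => by
    rw [← hu, ← clm_mul_apply, Units.inv_mul]; rfl
  have h6 := congrArg (↑u⁻¹ : E →L[ℝ] E) h2
  rw [h5, h5] at h6
  exact Submodule.starProjection_eq_self_iff.1 h6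

/-- The vector of the normal space at `q` whose transport is `ω + y`. -/
def UnitNormal.lift (p : UnitNormal f ι) (q : S) (y : EuclideanSpace ℝ (Fin (n - d - 1))) : E :=
  Ring.inverse (p.transport q) (p.vec + p.frame y)

theorem UnitNormal.transport_lift (p : UnitNormal f ι) {q : S} (hq : IsUnit (p.transport q))
    (y : EuclideanSpace ℝ (Fin (n - d - 1))) :
    p.transport q (p.lift q y) = p.vec + p.frame y := by
  rw [lift, ← clm_mul_apply, Ring.mul_inverse_cancel _ hq]; rfl

theorem UnitNormal.lift_mem (p : UnitNormal f ι) {q : S} (hq : IsUnit (p.transport q))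
    (y : EuclideanSpace ℝ (Fin (n - d - 1))) : p.lift q y ∈ normalSpace f ι q := by
  refine p.mem_of_transport_mem hq ?_
  rw [p.transport_lift hq]
  exact Submodule.add_mem _ p.vec_mem (p.frame_mem y).2

theorem UnitNormal.inner_vec_lift (p : UnitNormal f ι) {q : S} (hq : IsUnit (p.transport q))
    (y : EuclideanSpace ℝ (Fin (n - d - 1))) : ⟪p.vec, p.lift q y⟫ = 1 := by
  rw [← p.inner_transport (p.lift_mem hq y) p.vec_mem, p.transport_lift hq, inner_add_right,
    p.inner_vec_frame, real_inner_self_eq_norm_sq, p.norm_vec]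
  simp

theorem UnitNormal.coframe_lift (p : UnitNormal f ι) {q : S} (hq : IsUnit (p.transport q))
    (y : EuclideanSpace ℝ (Fin (n - d - 1))) : p.coframe (p.lift q y) = y := by
  rw [← p.coframe_transport (p.lift_mem hq y), p.transport_lift hq, map_add, p.coframe_vec,
    p.coframe_frame, zero_add]

theorem UnitNormal.norm_lift_pos (p : UnitNormal f ι) {q : S} (hq : IsUnit (p.transport q))
    (y : EuclideanSpace ℝ (Fin (n - d - 1))) : 0 < ‖p.lift q y‖ := by
  rw [norm_pos_iff]
  intro h
  have := p.inner_vec_lift hq y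
  simp [h] at this

theorem UnitNormal.lift_coframe (p : UnitNormal f ι) {q : S} (hq : IsUnit (p.transport q))
    {v : E} (hv : v ∈ normalSpace f ι q) (h0 : ⟪p.vec, v⟫ ≠ 0) :
    p.lift q (⟪p.vec, v⟫⁻¹ • p.coframe v) = ⟪p.vec, v⟫⁻¹ • v := by
  have hT : p.transport q v ∈ normalSpace f ι p.base := by
    rw [p.transport_apply hv]; exact Submodule.starProjection_apply_mem _ v
  have h := p.decomp hT
  rw [p.inner_transport hv p.vec_mem, p.coframe_transport hv] at h
  have h2 : p.vec + p.frame (⟪p.vec, v⟫⁻¹ • p.coframe v)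
      = p.transport q (⟪p.vec, v⟫⁻¹ • v) := by
    rw [map_smul, map_smul, ← h, smul_add, smul_smul, inv_mul_cancel₀ h0, one_smul]
  rw [lift, h2, ← clm_mul_apply, Ring.inverse_mul_cancel _ hq]; rfl

variable [IsManifold (𝓡 n) ∞ M] [IsManifold (𝓡 d) ∞ S]

theorem UnitNormal.contMDiff_transport (p : UnitNormal f ι) :
    ContMDiff (𝓡 d) 𝓘(ℝ, E →L[ℝ] E) ∞ p.transport := by
  have h := contMDiff_starProjection_normalSpace f ι
  have hc : ContDiff ℝ ∞ (fun A : E →L[ℝ] E => (normalSpace f ι p.base).starProjection * A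
      + (1 - (normalSpace f ι p.base).starProjection) * (1 - A)) := by
    fun_prop
  exact hc.contMDiff.comp h

/-- The inverse of the chart of the unit normal bundle centred at `p`. -/
def UnitNormal.chartInv (p : UnitNormal f ι)
    (z : EuclideanSpace ℝ (Fin d) × EuclideanSpace ℝ (Fin (n - d - 1))) : UnitNormal f ι :=
  haveI := Classical.propDecidable
  if h : IsUnit (p.transport ((extChartAt (𝓡 d) p.base).symm z.1)) then
    (show UnitNormal f ι from ⟨((extChartAt (𝓡 d) p.base).symm z.1,
      ‖p.lift ((extChartAt (𝓡 d) p.base).symm z.1) z.2‖⁻¹ •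
        p.lift ((extChartAt (𝓡 d) p.base).symm z.1) z.2),
      Submodule.smul_mem _ _ (p.lift_mem h z.2), by
        rw [norm_smul, norm_inv, norm_norm]
        exact inv_mul_cancel₀ (p.norm_lift_pos h z.2).ne'⟩)
  else p

theorem UnitNormal.base_chartInv (p : UnitNormal f ι)
    {z : EuclideanSpace ℝ (Fin d) × EuclideanSpace ℝ (Fin (n - d - 1))}
    (h : IsUnit (p.transport ((extChartAt (𝓡 d) p.base).symm z.1))) :
    (p.chartInv z).base = (extChartAt (𝓡 d) p.base).symm z.1 := by
  unfold chartInv; rw [dif_pos h]; rfl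

theorem UnitNormal.vec_chartInv (p : UnitNormal f ι)
    {z : EuclideanSpace ℝ (Fin d) × EuclideanSpace ℝ (Fin (n - d - 1))}
    (h : IsUnit (p.transport ((extChartAt (𝓡 d) p.base).symm z.1))) :
    (p.chartInv z).vec = ‖p.lift ((extChartAt (𝓡 d) p.base).symm z.1) z.2‖⁻¹ •
        p.lift ((extChartAt (𝓡 d) p.base).symm z.1) z.2 := by
  unfold chartInv; rw [dif_pos h]; rfl

/-- The points at which the inverse chart is a genuine inverse. -/
def UnitNormal.chartTarget (p : UnitNormal f ι) :
    Set (EuclideanSpace ℝ (Fin d) × EuclideanSpace ℝ (Fin (n - d - 1))) :=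
  {z | z.1 ∈ (extChartAt (𝓡 d) p.base).target ∧
    IsUnit (p.transport ((extChartAt (𝓡 d) p.base).symm z.1))}

theorem UnitNormal.contDiffOn_vec_chartInv (p : UnitNormal f ι) :
    ContDiffOn ℝ ∞ (fun z => (p.chartInv z).vec) p.chartTarget := by
  have : CompleteSpace E := FiniteDimensional.complete ℝ E
  have hT : ContDiffOn ℝ ∞ (fun x => p.transport ((extChartAt (𝓡 d) p.base).symm x))
      (extChartAt (𝓡 d) p.base).target :=
    contMDiffOn_iff_contDiffOn.1 (p.contMDiff_transport.comp_contMDiffOn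
      (contMDiffOn_extChartAt_symm (I := 𝓡 d) (n := ∞) p.base))
  have hT1 : ContDiffOn ℝ ∞ (fun z : EuclideanSpace ℝ (Fin d) × EuclideanSpace ℝ (Fin (n - d - 1))
      => p.transport ((extChartAt (𝓡 d) p.base).symm z.1)) p.chartTarget :=
    hT.comp contDiff_fst.contDiffOn fun z hz => hz.1
  have hT2 : ContDiffOn ℝ ∞ (fun z : EuclideanSpace ℝ (Fin d) × EuclideanSpace ℝ (Fin (n - d - 1))
      => Ring.inverse (p.transport ((extChartAt (𝓡 d) p.base).symm z.1))) p.chartTarget := by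
    intro z hz
    obtain ⟨u, hu⟩ := hz.2
    have h := contDiffAt_ringInverse (n := ∞) ℝ u
    rw [hu] at h
    exact ContDiffAt.comp_contDiffWithinAt (g := Ring.inverse) z h (hT1 z hz)
  have hL : ContDiffOn ℝ ∞ (fun z : EuclideanSpace ℝ (Fin d) × EuclideanSpace ℝ (Fin (n - d - 1))
      => p.lift ((extChartAt (𝓡 d) p.base).symm z.1) z.2) p.chartTarget := by
    refine hT2.clm_apply (ContDiff.contDiffOn ?_)
    exact contDiff_const.add (p.frame.toContinuousLinearMap.contDiff.comp contDiff_snd)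
  have h0 : ∀ z ∈ p.chartTarget, p.lift ((extChartAt (𝓡 d) p.base).symm z.1) z.2 ≠ 0 :=
    fun z hz => norm_pos_iff.1 (p.norm_lift_pos hz.2 z.2)
  exact (((hL.norm ℝ h0).inv fun z hz => norm_ne_zero_iff.2 (h0 z hz)).smul hL).congr
    fun z hz => p.vec_chartInv hz.2

/-- The domain of the chart of the unit normal bundle centred at `p`. -/
def UnitNormal.chartSource (p : UnitNormal f ι) : Set (UnitNormal f ι) :=
  {p' | p'.base ∈ (extChartAt (𝓡 d) p.base).source ∧ IsUnit (p.transport p'.base) ∧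
    0 < ⟪p.vec, p'.vec⟫}

/-- The chart of the unit normal bundle centred at `p`, as a map: a chart of `S` together with the
central projection of the unit sphere of the normal space to its tangent hyperplane at `ω`. -/
def UnitNormal.chartFun (p p' : UnitNormal f ι) :
    EuclideanSpace ℝ (Fin d) × EuclideanSpace ℝ (Fin (n - d - 1)) :=
  (extChartAt (𝓡 d) p.base p'.base, ⟪p.vec, p'.vec⟫⁻¹ • p.coframe p'.vec)

theorem UnitNormal.continuous_inner_vec (v : E) :
    Continuous (fun p : UnitNormal f ι => ⟪v, p.vec⟫) :=
  Continuous.inner (𝕜 := ℝ) continuous_const UnitNormal.continuous_vec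

theorem UnitNormal.continuousOn_chartFun (p : UnitNormal f ι) :
    ContinuousOn p.chartFun p.chartSource := by
  refine ContinuousOn.prodMk ?_ ?_
  · exact (continuousOn_extChartAt p.base).comp UnitNormal.continuous_base.continuousOn
      fun p' hp' => hp'.1
  · have h1 : ContinuousOn (fun p' : UnitNormal f ι => ⟪p.vec, p'.vec⟫) p.chartSource :=
      (UnitNormal.continuous_inner_vec p.vec).continuousOn
    exact (h1.inv₀ fun p' hp' => hp'.2.2.ne').smul
      (p.coframe.continuous.comp UnitNormal.continuous_vec).continuousOn

theorem UnitNormal.continuousOn_chartInv (p : UnitNormal f ι) :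
    ContinuousOn p.chartInv p.chartTarget := by
  refine (Topology.IsInducing.subtypeVal.continuousOn_iff).2 (ContinuousOn.prodMk ?_ ?_)
  · refine ContinuousOn.congr ?_ fun z hz => p.base_chartInv hz.2
    exact (continuousOn_extChartAt_symm p.base).comp continuousOn_fst fun z hz => hz.1
  · exact p.contDiffOn_vec_chartInv.continuousOn

theorem UnitNormal.isOpen_chartSource (p : UnitNormal f ι) : IsOpen p.chartSource := by
  have : CompleteSpace E := FiniteDimensional.complete ℝ E
  have h1 : IsOpen {p' : UnitNormal f ι | p'.base ∈ (extChartAt (𝓡 d) p.base).source} :=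
    (isOpen_extChartAt_source p.base).preimage UnitNormal.continuous_base
  have h2 : IsOpen {p' : UnitNormal f ι | IsUnit (p.transport p'.base)} :=
    Units.isOpen.preimage (p.contMDiff_transport.continuous.comp UnitNormal.continuous_base)
  have h3 : IsOpen {p' : UnitNormal f ι | 0 < ⟪p.vec, p'.vec⟫} :=
    isOpen_lt continuous_const (UnitNormal.continuous_inner_vec p.vec)
  exact h1.inter (h2.inter h3)

theorem UnitNormal.isOpen_chartTarget (p : UnitNormal f ι) : IsOpen p.chartTarget := by
  have : CompleteSpace E := FiniteDimensional.complete ℝ E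
  have h := ((continuousOn_extChartAt_symm p.base).isOpen_inter_preimage
    (isOpen_extChartAt_target (I := 𝓡 d) p.base)
    (Units.isOpen.preimage p.contMDiff_transport.continuous))
  exact h.preimage continuous_fst

theorem UnitNormal.chartFun_mem (p : UnitNormal f ι) {p' : UnitNormal f ι}
    (h : p' ∈ p.chartSource) : p.chartFun p' ∈ p.chartTarget := by
  refine ⟨(extChartAt (𝓡 d) p.base).map_source h.1, ?_⟩
  have h4 := (extChartAt (𝓡 d) p.base).left_inv h.1
  change IsUnit (p.transport ((extChartAt (𝓡 d) p.base).symm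
    (extChartAt (𝓡 d) p.base p'.base)))
  rw [h4]
  exact h.2.1

theorem UnitNormal.chartInv_mem (p : UnitNormal f ι)
    {z : EuclideanSpace ℝ (Fin d) × EuclideanSpace ℝ (Fin (n - d - 1))}
    (h : z ∈ p.chartTarget) : p.chartInv z ∈ p.chartSource := by
  refine ⟨?_, ?_, ?_⟩
  · rw [p.base_chartInv h.2]
    exact (extChartAt (𝓡 d) p.base).map_target h.1
  · rw [p.base_chartInv h.2]
    exact h.2
  · rw [p.vec_chartInv h.2, inner_smul_right, p.inner_vec_lift h.2, mul_one]
    exact inv_pos.2 (p.norm_lift_pos h.2 _)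

theorem UnitNormal.chartInv_chartFun (p : UnitNormal f ι) {p' : UnitNormal f ι}
    (h : p' ∈ p.chartSource) : p.chartInv (p.chartFun p') = p' := by
  have h3 : 0 < ⟪p.vec, p'.vec⟫ := h.2.2
  have h4 : (extChartAt (𝓡 d) p.base).symm (p.chartFun p').1 = p'.base :=
    (extChartAt (𝓡 d) p.base).left_inv h.1
  have h5 : IsUnit (p.transport ((extChartAt (𝓡 d) p.base).symm (p.chartFun p').1)) :=
    (p.chartFun_mem h).2
  refine UnitNormal.ext ((p.base_chartInv h5).trans h4) ((p.vec_chartInv h5).trans ?_)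
  have h6 : p.lift p'.base (p.chartFun p').2 = ⟪p.vec, p'.vec⟫⁻¹ • p'.vec :=
    p.lift_coframe h.2.1 p'.vec_mem h3.ne'
  rw [h4, h6, norm_smul, p'.norm_vec, mul_one, norm_inv,
    inv_inv, Real.norm_of_nonneg h3.le, smul_smul, mul_inv_cancel₀ h3.ne', one_smul]

theorem UnitNormal.chartFun_chartInv (p : UnitNormal f ι)
    {z : EuclideanSpace ℝ (Fin d) × EuclideanSpace ℝ (Fin (n - d - 1))}
    (h : z ∈ p.chartTarget) : p.chartFun (p.chartInv z) = z := by
  refine Prod.ext ?_ ?_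
  · change extChartAt (𝓡 d) p.base (p.chartInv z).base = z.1
    rw [p.base_chartInv h.2, (extChartAt (𝓡 d) p.base).right_inv h.1]
  · change ⟪p.vec, (p.chartInv z).vec⟫⁻¹ • p.coframe (p.chartInv z).vec = z.2
    rw [p.vec_chartInv h.2, inner_smul_right, p.inner_vec_lift h.2, map_smul,
      p.coframe_lift h.2, mul_one, inv_inv, smul_smul,
      mul_inv_cancel₀ (p.norm_lift_pos h.2 _).ne', one_smul]

/-- The chart of the unit normal bundle centred at `p`. -/
def UnitNormal.chart (p : UnitNormal f ι) : OpenPartialHomeomorph (UnitNormal f ι)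
    (EuclideanSpace ℝ (Fin d) × EuclideanSpace ℝ (Fin (n - d - 1))) where
  toFun := p.chartFun
  invFun := p.chartInv
  source := p.chartSource
  target := p.chartTarget
  map_source' _ h := p.chartFun_mem h
  map_target' _ h := p.chartInv_mem h
  left_inv' _ h := p.chartInv_chartFun h
  right_inv' _ h := p.chartFun_chartInv h
  open_source := p.isOpen_chartSource
  open_target := p.isOpen_chartTarget
  continuousOn_toFun := p.continuousOn_chartFun
  continuousOn_invFun := p.continuousOn_chartInv

instance : ChartedSpace (EuclideanSpace ℝ (Fin d) × EuclideanSpace ℝ (Fin (n - d - 1)))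
    (UnitNormal f ι) where
  atlas := Set.range UnitNormal.chart
  chartAt := UnitNormal.chart
  mem_chart_source p := by
    refine ⟨mem_extChartAt_source p.base, ?_, ?_⟩
    · rw [p.transport_self]; exact isUnit_one
    · rw [real_inner_self_eq_norm_sq, p.norm_vec]; norm_num
  chart_mem_atlas p := ⟨p, rfl⟩

instance : IsManifold
    𝓘(ℝ, EuclideanSpace ℝ (Fin d) × EuclideanSpace ℝ (Fin (n - d - 1))) ∞ (UnitNormal f ι) := by
  refine isManifold_of_contDiffOn _ _ _ ?_
  rintro _ _ ⟨p, rfl⟩ ⟨p', rfl⟩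
  have hsub : ∀ z ∈ (p.chart.symm.trans p'.chart).source, z ∈ p.chartTarget ∧
      (extChartAt (𝓡 d) p.base).symm z.1 ∈ (extChartAt (𝓡 d) p'.base).source ∧
      0 < ⟪p'.vec, (p.chartInv z).vec⟫ := by
    rintro z ⟨h1, h2⟩
    have h3 : (p.chartInv z).base ∈ (extChartAt (𝓡 d) p'.base).source := h2.1
    rw [p.base_chartInv h1.2] at h3
    exact ⟨h1, h3, h2.2.2⟩
  have hv : ContDiffOn ℝ ∞ (fun z => (p.chartInv z).vec) (p.chart.symm.trans p'.chart).source :=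
    p.contDiffOn_vec_chartInv.mono fun z hz => (hsub z hz).1
  have hx : ContDiffOn ℝ ∞
      (fun z : EuclideanSpace ℝ (Fin d) × EuclideanSpace ℝ (Fin (n - d - 1)) =>
        extChartAt (𝓡 d) p'.base ((extChartAt (𝓡 d) p.base).symm z.1))
      (p.chart.symm.trans p'.chart).source := by
    rw [← contMDiffOn_iff_contDiffOn]
    refine (contMDiffOn_extChartAt (I := 𝓡 d) (n := ∞) (x := p'.base)).comp
      ((contMDiffOn_extChartAt_symm (I := 𝓡 d) (n := ∞) p.base).comp
        contDiff_fst.contMDiff.contMDiffOn fun z hz => (hsub z hz).1.1) fun z hz => ?_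
    simpa using (hsub z hz).2.1
  have hx' : ContDiffOn ℝ ∞
      (fun z => extChartAt (𝓡 d) p'.base (p.chartInv z).base)
      (p.chart.symm.trans p'.chart).source :=
    hx.congr fun z hz => by rw [p.base_chartInv (hsub z hz).1.2]
  have hin : ContDiffOn ℝ ∞ (fun z => ⟪p'.vec, (p.chartInv z).vec⟫)
      (p.chart.symm.trans p'.chart).source := contDiffOn_const.inner ℝ hv
  have hy : ContDiffOn ℝ ∞ (fun z => ⟪p'.vec, (p.chartInv z).vec⟫⁻¹ •
      p'.coframe (p.chartInv z).vec) (p.chart.symm.trans p'.chart).source :=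
    (hin.inv fun z hz => (hsub z hz).2.2.ne').smul
      (p'.coframe.contDiff.comp_contDiffOn hv)
  have h := hx'.prodMk hy
  refine h.mono ?_
  rintro z ⟨hz, -⟩
  exact hz

end UnitNormal

/-! ### Bending profiles -/

section Profiles

/-- `a` for a curve `γ = (a, b)`. -/
def curveA (γ : ℝ → EuclideanSpace ℝ (Fin 2)) (s : ℝ) : ℝ := γ s 0

/-- `b` for a curve `γ = (a, b)`. -/
def curveB (γ : ℝ → EuclideanSpace ℝ (Fin 2)) (s : ℝ) : ℝ := γ s 1

/-- `κ = a' b'' - a'' b'`. -/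
def curveKappa (γ : ℝ → EuclideanSpace ℝ (Fin 2)) (s : ℝ) : ℝ :=
  deriv (curveA γ) s * deriv (deriv (curveB γ)) s - deriv (deriv (curveA γ)) s * deriv (curveB γ) s

/-- `σ = b' / a`. -/
def curveSigma (γ : ℝ → EuclideanSpace ℝ (Fin 2)) (s : ℝ) : ℝ :=
  deriv (curveB γ) s / curveA γ s

/-- `γ` restricts to a controlled curve on `[s₀, s₁]`: it is smooth (in a neighbourhood of the
interval), of unit speed, with `a ≠ 0` and `(2 - k) / 4 * σ ≤ κ ≤ σ`. -/
structure Controlled (k : ℕ) (γ : ℝ → EuclideanSpace ℝ (Fin 2)) (s₀ s₁ : ℝ) : Prop where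
  smooth : ∀ s ∈ Set.Icc s₀ s₁, ContDiffAt ℝ ∞ γ s
  unit_speed : ∀ s ∈ Set.Icc s₀ s₁, ‖deriv γ s‖ = 1
  a_ne_zero : ∀ s ∈ Set.Icc s₀ s₁, curveA γ s ≠ 0
  le_kappa : ∀ s ∈ Set.Icc s₀ s₁, (2 - (k : ℝ)) / 4 * curveSigma γ s ≤ curveKappa γ s
  kappa_le : ∀ s ∈ Set.Icc s₀ s₁, curveKappa γ s ≤ curveSigma γ s

/-- `γ` is of extent `ρ` on `[s₀, s₁]`. -/
def HasExtent (ρ : ℝ) (γ : ℝ → EuclideanSpace ℝ (Fin 2)) (s₀ s₁ : ℝ) : Prop :=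
  ∀ s ∈ Set.Icc s₀ s₁, ‖γ s‖ < ρ

variable {n d : ℕ}
  {M : Type*} [TopologicalSpace M] [ChartedSpace (EuclideanSpace ℝ (Fin n)) M]
  {S : Type*} [TopologicalSpace S] [ChartedSpace (EuclideanSpace ℝ (Fin d)) S]
  {E : Type*} [NormedAddCommGroup E] [InnerProductSpace ℝ E] [FiniteDimensional ℝ E]

/-- The map `F_γ (q, ω, s) = f(q) + a(s) ω + b(s) ξ(q)`. -/
def bending (f : Immersion (𝓡 n) 𝓘(ℝ, E) M E) (ι : Embedding (𝓡 d) (𝓡 n) S M)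
    (γ : ℝ → EuclideanSpace ℝ (Fin 2)) (p : UnitNormal f ι × ℝ) : E :=
  f.toFun (ι.toFun p.1.base) + curveA γ p.2 • p.1.vec
    + curveB γ p.2 • xi (𝓡 n) f.toFun (ι.toFun p.1.base)

end Profiles

/-- The model of the manifold `UnitNormal f ι × ℝ`. -/
abbrev sigmaModel (n d : ℕ) :=
  𝓘(ℝ, EuclideanSpace ℝ (Fin d) × EuclideanSpace ℝ (Fin (n - d - 1))).prod 𝓘(ℝ, ℝ)

end Bending

end

/-!
By the Gauss equation the scalar curvature of the metric induced by an immersion is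
`∑ ⟨h (e i) (e i), h (e j) (e j)⟩ - ∑ |h (e i) (e j)|²` for an orthonormal basis `e` of the tangent
space and the second fundamental form `h`. So it is a function `gaussScal` of the first two
derivatives `L`, `B` of the immersion (`metricScal_gram`), and this function does not depend on the
parametrization (`scalarCurvature_eq_gaussScal`). The bending can therefore be studied pointwise, in
the coordinates `(x, y, s)` given by a chart `(x, y)` of the unit normal bundle, where it has the
form `φ(x) + a(s) ν(x, y) + b(s) ξ(x)`.

The directions `(0, y, s)` form the block, which has dimension `k`. On the block the induced metric
is `ds² + a² |dν|²`, and the second fundamental form is `diag(κ, σ, …, σ) ζ` in an orthonormal basis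
(`normalForm_ver`), where `ζ` is the part of the unit normal vector `-b' ν + a' ξ` of the profile
curve that is normal to the bending. For a small extent `ρ` the vector `ζ` has almost unit length,
and the orthogonal complement of the block is `O(ρ)`-close to the horizontal directions `(x, 0, 0)`.
This gives injectivity of `L`, and the second fundamental form is `O(1) + O(ρ σ)` whenever one
argument is orthogonal to the block (`norm_normalForm_orth_ver_le`, `norm_normalForm_orth_orth_le`).
The block contributes `(2 (k - 1) κ σ + (k - 1) (k - 2) σ²) |ζ|²`, which is at least
`(k - 1) (k - 2) / 2 * σ² |ζ|²` by the lower bound for `κ` (`trace_estimate`); the remaining terms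
are `O(ρ σ²) + O(σ) + O(1)`, and the first of these is absorbed by taking `ρ` small
(`exists_const_le_gaussScal`).

All constants depend only on bounds for the derivatives of `φ`, `ν`, `ξ` up to second order and on
lower bounds for `|dφ|` and `|∂ν/∂y|`. Such bounds hold near every point of the unit normal bundle,
and this bundle is compact (`exists_curvatureBound`). Positivity of the scalar curvature of `f` is
needed only to make the mean curvature nonzero and hence `ξ` a smooth field.
-/

/-! ### Linear algebra of the induced metric and of the second fundamental form -/

namespace Bending

section Gram

variable {V : Type*} [NormedAddCommGroup V] [NormedSpace ℝ V] [FiniteDimensional ℝ V]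
  {E : Type*} [NormedAddCommGroup E] [InnerProductSpace ℝ E] [FiniteDimensional ℝ E]
  {κ : Type*} [Fintype κ] [DecidableEq κ]

/-- The Gram matrix `⟨L b_i, L b_j⟩` of the metric pulled back by `L`. -/
noncomputable def gram (b : Module.Basis κ ℝ V) (L : V →L[ℝ] E) : Matrix κ κ ℝ :=
  Matrix.of fun i j => ⟪L (b i), L (b j)⟫

/-- The part of `B` that is normal to the range of `L`; for the first and second derivatives
`L` and `B` of an immersion this is the second fundamental form. -/
noncomputable def normalForm (L : V →L[ℝ] E) (B : V →L[ℝ] V →L[ℝ] E) (v w : V) : E :=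
  (LinearMap.range L.toLinearMap)ᗮ.starProjection (B v w)

/-- The trace of the normal form with respect to the metric pulled back by `L`. -/
noncomputable def meanVec (b : Module.Basis κ ℝ V) (L : V →L[ℝ] E) (B : V →L[ℝ] V →L[ℝ] E) : E :=
  ∑ i, ∑ j, (gram b L)⁻¹ i j • normalForm L B (b i) (b j)

/-- The right-hand side `g^{ij} g^{lm} (⟨α_{ij}, α_{lm}⟩ - ⟨α_{il}, α_{jm}⟩)` of the twice
contracted Gauss equation, as a function of the first and second derivatives of an immersion. -/
noncomputable def gaussScal (b : Module.Basis κ ℝ V) (L : V →L[ℝ] E) (B : V →L[ℝ] V →L[ℝ] E) : ℝ :=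
  ∑ i, ∑ j, (gram b L)⁻¹ i j * ∑ l, ∑ m, (gram b L)⁻¹ l m *
    (⟪normalForm L B (b i) (b j), normalForm L B (b l) (b m)⟫
      - ⟪normalForm L B (b i) (b l), normalForm L B (b j) (b m)⟫)

variable {ι : Type*} [Fintype ι]

/-- The matrix of an orthonormal family is a square root of the inverse Gram matrix. -/
theorem gram_mul_repr [DecidableEq ι] (b : Module.Basis κ ℝ V) {L : V →L[ℝ] E} {e : ι → V}
    (he : Orthonormal ℝ fun a => L (e a)) (hι : Fintype.card ι = Module.finrank ℝ V) :
    gram b L * (Matrix.of fun i a => b.repr (e a) i) * (Matrix.of fun a i => b.repr (e a) i) =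
      1 := by
  have hcard : Fintype.card κ = Fintype.card ι := by
    rw [hι, Module.finrank_eq_card_basis b]
  rw [Matrix.mul_eq_one_comm_of_card_eq κ ι ℝ hcard]
  ext a c
  have h1 : ∀ c, L (e c) = ∑ j, b.repr (e c) j • L (b j) := fun c => by
    conv_lhs => rw [← b.sum_repr (e c)]
    simp only [map_sum, map_smul]
  have h2 := orthonormal_iff_ite.1 he a c
  rw [Matrix.one_apply, ← h2, h1 a, h1 c, sum_inner]
  simp only [Matrix.mul_apply, Matrix.of_apply, gram, inner_sum, inner_smul_left,
    inner_smul_right, Finset.mul_sum]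
  simp
  refine Finset.sum_congr rfl fun i _ => Finset.sum_congr rfl fun j _ => by ring

theorem gram_inv [DecidableEq ι] (b : Module.Basis κ ℝ V) {L : V →L[ℝ] E} {e : ι → V}
    (he : Orthonormal ℝ fun a => L (e a)) (hι : Fintype.card ι = Module.finrank ℝ V) (i j : κ) :
    (gram b L)⁻¹ i j = ∑ a, b.repr (e a) i * b.repr (e a) j := by
  have h := gram_mul_repr b he hι
  rw [Matrix.mul_assoc] at h
  rw [Matrix.inv_eq_right_inv h]
  simp [Matrix.mul_apply]

/-- A trace with respect to the pulled back metric is computed in any orthonormal family. -/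
theorem sum_gram_inv_smul {F : Type*} [AddCommGroup F] [Module ℝ F] (b : Module.Basis κ ℝ V)
    {L : V →L[ℝ] E} {e : ι → V} (he : Orthonormal ℝ fun a => L (e a))
    (hι : Fintype.card ι = Module.finrank ℝ V) (Q : V →ₗ[ℝ] V →ₗ[ℝ] F) :
    ∑ i, ∑ j, (gram b L)⁻¹ i j • Q (b i) (b j) = ∑ a, Q (e a) (e a) := by
  classical
  have h1 : ∀ a, Q (e a) (e a) =
      ∑ i, ∑ j, (b.repr (e a) i * b.repr (e a) j) • Q (b i) (b j) := fun a => by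
    conv_lhs => rw [← b.sum_repr (e a)]
    simp only [map_sum, LinearMap.sum_apply, map_smul, LinearMap.smul_apply, smul_smul,
      Finset.smul_sum]
    rw [Finset.sum_comm]
    refine Finset.sum_congr rfl fun i _ => Finset.sum_congr rfl fun j _ => ?_
    rw [mul_comm]
  simp only [h1, gram_inv b he hι, Finset.sum_smul]
  rw [Finset.sum_comm]
  conv_rhs => rw [Finset.sum_comm]
  rw [Finset.sum_comm]
  refine Finset.sum_congr rfl fun i _ => ?_
  rw [Finset.sum_comm]

/-- The normal form as a bilinear map. -/
noncomputable def normalFormLin (L : V →L[ℝ] E) (B : V →L[ℝ] V →L[ℝ] E) : V →ₗ[ℝ] V →ₗ[ℝ] E :=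
  LinearMap.mk₂ ℝ (normalForm L B)
    (fun _ _ _ => by simp only [normalForm, map_add, add_apply])
    (fun _ _ _ => by simp only [normalForm, map_smul, smul_apply])
    (fun _ _ _ => by simp only [normalForm, map_add])
    (fun _ _ _ => by simp only [normalForm, map_smul])

theorem meanVec_eq_sum (b : Module.Basis κ ℝ V) {L : V →L[ℝ] E} (B : V →L[ℝ] V →L[ℝ] E)
    {e : ι → V} (he : Orthonormal ℝ fun a => L (e a))
    (hι : Fintype.card ι = Module.finrank ℝ V) :
    meanVec b L B = ∑ a, normalForm L B (e a) (e a) :=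
  sum_gram_inv_smul b he hι (normalFormLin L B)

theorem gaussScal_eq_sum (b : Module.Basis κ ℝ V) {L : V →L[ℝ] E} (B : V →L[ℝ] V →L[ℝ] E)
    {e : ι → V} (he : Orthonormal ℝ fun a => L (e a))
    (hι : Fintype.card ι = Module.finrank ℝ V) :
    gaussScal b L B = ‖∑ a, normalForm L B (e a) (e a)‖ ^ 2
      - ∑ a, ∑ c, ‖normalForm L B (e a) (e c)‖ ^ 2 := by
  let N := normalFormLin L B
  have h1 : ∀ v w, ∑ l, ∑ m, (gram b L)⁻¹ l m *
      (⟪N v w, N (b l) (b m)⟫ - ⟪N v (b l), N w (b m)⟫) =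
      ∑ c, (⟪N v w, N (e c) (e c)⟫ - ⟪N v (e c), N w (e c)⟫) := fun v w => by
    have := sum_gram_inv_smul (F := ℝ) b he hι (LinearMap.mk₂ ℝ
      (fun x y => ⟪N v w, N x y⟫ - ⟪N v x, N w y⟫)
      (by intros; simp [inner_add_left, inner_add_right]; ring)
      (by intros; simp [inner_smul_left, inner_smul_right]; ring)
      (by intros; simp [inner_add_right]; ring)
      (by intros; simp [inner_smul_right]; ring))
    simpa only [smul_eq_mul, LinearMap.mk₂_apply] using this
  have h2 := sum_gram_inv_smul (F := ℝ) b he hι (LinearMap.mk₂ ℝ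
      (fun v w => ∑ c, (⟪N v w, N (e c) (e c)⟫ - ⟪N v (e c), N w (e c)⟫))
      (by intros; rw [← Finset.sum_add_distrib]; refine Finset.sum_congr rfl fun c _ => ?_
          simp [inner_add_left]; ring)
      (by intros; rw [Finset.smul_sum]; refine Finset.sum_congr rfl fun c _ => ?_
          simp [inner_smul_left]; ring)
      (by intros; rw [← Finset.sum_add_distrib]; refine Finset.sum_congr rfl fun c _ => ?_
          simp [inner_add_left, inner_add_right]; ring)
      (by intros; rw [Finset.smul_sum]; refine Finset.sum_congr rfl fun c _ => ?_
          simp [inner_smul_left, inner_smul_right]; ring))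
  simp only [smul_eq_mul, LinearMap.mk₂_apply] at h2
  have h3 : gaussScal b L B = ∑ a, ∑ c, (⟪N (e a) (e a), N (e c) (e c)⟫
      - ⟪N (e a) (e c), N (e a) (e c)⟫) := by
    rw [← h2]
    simp only [← h1]
    rfl
  rw [h3, ← real_inner_self_eq_norm_sq, sum_inner]
  simp only [inner_sum, Finset.sum_sub_distrib, real_inner_self_eq_norm_sq]
  rfl

/-- An orthonormal family for the metric pulled back by `L` extends to an orthonormal basis. -/
theorem exists_orthonormal_extension {L : V →L[ℝ] E} (hL : Function.Injective L) {u : ι → V}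
    (hu : Orthonormal ℝ fun a => L (u a)) :
    ∃ (m : ℕ) (x : Fin m → V), Fintype.card ι + m = Module.finrank ℝ V ∧
      Orthonormal ℝ fun a : ι ⊕ Fin m => L (Sum.elim u x a) := by
  classical
  set U : Submodule ℝ E := Submodule.span ℝ (Set.range fun a => L (u a)) with hU
  have hle : U ≤ LinearMap.range L.toLinearMap := by
    rw [hU, Submodule.span_le]
    rintro _ ⟨a, rfl⟩
    exact ⟨u a, rfl⟩
  have hcard := Submodule.finrank_add_inf_finrank_orthogonal hle
  rw [finrank_span_eq_card hu.linearIndependent, LinearMap.finrank_range_of_inj hL] at hcard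
  set D := Uᗮ ⊓ LinearMap.range L.toLinearMap
  have hpre : ∀ i, ∃ v, L v = (stdOrthonormalBasis ℝ D i : E) := fun i =>
    (stdOrthonormalBasis ℝ D i).2.2
  choose x hx using hpre
  have hx1 : ∀ i j, ⟪L (x i), L (x j)⟫ = if i = j then (1 : ℝ) else 0 := fun i j => by
    rw [hx, hx, ← Submodule.coe_inner]
    exact orthonormal_iff_ite.1 (stdOrthonormalBasis ℝ D).orthonormal i j
  have hx2 : ∀ a i, ⟪L (u a), L (x i)⟫ = 0 := fun a i => by
    rw [hx]
    exact (stdOrthonormalBasis ℝ D i).2.1 _ (Submodule.subset_span ⟨a, rfl⟩)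
  refine ⟨_, x, hcard, orthonormal_iff_ite.2 ?_⟩
  rintro (a | i) (c | j)
  · simpa using orthonormal_iff_ite.1 hu a c
  · simpa using hx2 a j
  · simpa [real_inner_comm] using hx2 c i
  · simpa using hx1 i j

theorem exists_orthonormal {L : V →L[ℝ] E} (hL : Function.Injective L) :
    ∃ e : Fin (Module.finrank ℝ V) → V, Orthonormal ℝ fun a => L (e a) := by
  obtain ⟨m, x, hm, hx⟩ := exists_orthonormal_extension (u := (Empty.elim : Empty → V)) hL
    ⟨fun a => a.elim, fun a => a.elim⟩
  have hm' : m = Module.finrank ℝ V := by simpa using hm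
  subst hm'
  exact ⟨x, hx.comp Sum.inr Sum.inr_injective⟩

/-- The determinant of the Gram matrix of an injective map does not vanish. -/
theorem isUnit_det_gram (b : Module.Basis κ ℝ V) {L : V →L[ℝ] E} (hL : Function.Injective L) :
    IsUnit (gram b L).det := by
  obtain ⟨e, he⟩ := exists_orthonormal hL
  have h := gram_mul_repr b he (by simp)
  rw [Matrix.mul_assoc] at h
  exact (Matrix.isUnit_iff_isUnit_det _).1 (IsUnit.of_mul_eq_one _ h)

end Gram

end Bending

/-! ### The Gauss equation in coordinates -/

namespace Bending

section Gauss

variable {V : Type*} [NormedAddCommGroup V] [NormedSpace ℝ V] [FiniteDimensional ℝ V]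
  {E : Type*} [NormedAddCommGroup E] [InnerProductSpace ℝ E] [FiniteDimensional ℝ E]
  {κ : Type*} [Fintype κ] [DecidableEq κ]

theorem contDiffAt_matrix_det {n : WithTop ℕ∞} {g : V → Matrix κ κ ℝ} {x : V}
    (hg : ∀ i j, ContDiffAt ℝ n (fun y => g y i j) x) :
    ContDiffAt ℝ n (fun y => (g y).det) x := by
  simp only [Matrix.det_apply]
  refine ContDiffAt.sum fun σ _ => ContDiffAt.const_smul _ ?_
  exact contDiffAt_prod fun i _ => hg _ _

theorem contDiffAt_matrix_inv {n : WithTop ℕ∞} {g : V → Matrix κ κ ℝ} {x : V}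
    (hg : ∀ i j, ContDiffAt ℝ n (fun y => g y i j) x) (hdet : IsUnit (g x).det) (i j : κ) :
    ContDiffAt ℝ n (fun y => (g y)⁻¹ i j) x := by
  simp only [Matrix.inv_def, Ring.inverse_eq_inv', Matrix.smul_apply, smul_eq_mul,
    Matrix.adjugate_apply]
  refine ((contDiffAt_matrix_det hg).inv hdet.ne_zero).mul (contDiffAt_matrix_det fun k l => ?_)
  simp only [Matrix.updateRow_apply]
  split_ifs
  · exact contDiffAt_const
  · exact hg k l

theorem contDiffAt_gram {n : WithTop ℕ∞} (b : Module.Basis κ ℝ V) {D : V → V →L[ℝ] E} {x : V}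
    (hD : ContDiffAt ℝ n D x) (i j : κ) : ContDiffAt ℝ n (fun y => gram b (D y) i j) x :=
  ContDiffAt.inner ℝ (hD.clm_apply contDiffAt_const) (hD.clm_apply contDiffAt_const)

theorem eventually_injective {D : V → V →L[ℝ] E} {x : V} (hD : ContinuousAt D x)
    (hx : Function.Injective (D x)) : ∀ᶠ y in 𝓝 x, Function.Injective (D y) :=
  hD.eventually (ContinuousLinearMap.isOpen_injective.mem_nhds hx)

theorem inner_normalForm (L : V →L[ℝ] E) (B : V →L[ℝ] V →L[ℝ] E) (v w v' w' : V) :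
    ⟪normalForm L B v w, normalForm L B v' w'⟫ = ⟪normalForm L B v w, B v' w'⟫ := by
  rw [normalForm, normalForm, ← Submodule.inner_starProjection_left_eq_right,
    Submodule.starProjection_eq_self_iff.2 (Submodule.starProjection_apply_mem _ _)]

/-- The tangential part of the second derivative has the Christoffel symbols as components. -/
theorem normalForm_eq_sub (b : Module.Basis κ ℝ V) {L : V →L[ℝ] E} (hL : Function.Injective L)
    (B : V →L[ℝ] V →L[ℝ] E) (v w : V) :
    normalForm L B v w =
      B v w - ∑ l, (∑ m, (gram b L)⁻¹ l m * ⟪B v w, L (b m)⟫) • L (b l) := by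
  refine Submodule.eq_starProjection_of_mem_of_inner_eq_zero ?_ ?_
  · rintro _ ⟨u, rfl⟩
    change ⟪L u, _⟫ = _
    induction b.mem_span u using Submodule.span_induction with
    | zero => simp
    | add u u' _ _ h h' => rw [map_add, inner_add_left, h, h', add_zero]
    | smul c u _ h => rw [map_smul, inner_smul_left, h, mul_zero]
    | mem u hu =>
      obtain ⟨p, rfl⟩ := hu
      have h1 : ∀ m, ∑ l, gram b L p l * (gram b L)⁻¹ l m = if p = m then 1 else 0 := fun m => by
        rw [← Matrix.mul_apply, Matrix.mul_nonsing_inv _ (isUnit_det_gram b hL),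
          Matrix.one_apply]
      have h2 : ∑ l, (∑ m, (gram b L)⁻¹ l m * ⟪B v w, L (b m)⟫) * gram b L p l
          = ⟪B v w, L (b p)⟫ := by
        simp only [Finset.sum_mul]
        rw [Finset.sum_comm]
        calc _ = ∑ m, (∑ l, gram b L p l * (gram b L)⁻¹ l m) * ⟪B v w, L (b m)⟫ := by
              refine Finset.sum_congr rfl fun m _ => ?_
              rw [Finset.sum_mul]
              exact Finset.sum_congr rfl fun l _ => by ring
          _ = _ := by simp [h1]
      rw [inner_sub_right, inner_sum, real_inner_comm, ← h2, sub_eq_zero]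
      refine Finset.sum_congr rfl fun l _ => ?_
      rw [inner_smul_right]
      rfl
  · intro u hu
    rw [sub_sub_cancel, sum_inner]
    refine Finset.sum_eq_zero fun l _ => ?_
    have h : ⟪L (b l), u⟫ = 0 := hu _ ⟨b l, rfl⟩
    simp only [inner_smul_left, h, mul_zero]

variable {G : V → E} {x : V} (b : Module.Basis κ ℝ V)

theorem hasFDerivAt_fderiv (hG : ContDiffAt ℝ 3 G x) :
    HasFDerivAt (fderiv ℝ G) (fderiv ℝ (fderiv ℝ G) x) x :=
  ((hG.fderiv_right (m := 2) (by norm_num)).differentiableAt (by norm_num)).hasFDerivAt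

theorem hasFDerivAt_fderiv_fderiv (hG : ContDiffAt ℝ 3 G x) :
    HasFDerivAt (fderiv ℝ (fderiv ℝ G)) (fderiv ℝ (fderiv ℝ (fderiv ℝ G)) x) x :=
  (((hG.fderiv_right (m := 2) (by norm_num)).fderiv_right (m := 1) (by norm_num)).differentiableAt
    (by norm_num)).hasFDerivAt

theorem partialDeriv_gram (hG : ContDiffAt ℝ 3 G x) (k i j : κ) :
    partialDeriv b k (fun y => gram b (fderiv ℝ G y) i j) x =
      ⟪fderiv ℝ G x (b i), fderiv ℝ (fderiv ℝ G) x (b k) (b j)⟫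
        + ⟪fderiv ℝ (fderiv ℝ G) x (b k) (b i), fderiv ℝ G x (b j)⟫ := by
  have hD := hasFDerivAt_fderiv hG
  have h := (hD.clm_apply (hasFDerivAt_const (b i) x)).inner ℝ
    (hD.clm_apply (hasFDerivAt_const (b j) x))
  change fderiv ℝ (fun y => ⟪fderiv ℝ G y (b i), fderiv ℝ G y (b j)⟫) x (b k) = _
  rw [h.fderiv]
  simp

theorem sndFDeriv_symm {F : Type*} [NormedAddCommGroup F] [NormedSpace ℝ F] {G : V → F} {x : V}
    (hG : ContDiffAt ℝ 2 G x) (v w : V) :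
    fderiv ℝ (fderiv ℝ G) x v w = fderiv ℝ (fderiv ℝ G) x w v :=
  (hG.isSymmSndFDerivAt (by simp)) v w

theorem thirdFDeriv_symm (hG : ContDiffAt ℝ 3 G x) (u v w : V) :
    fderiv ℝ (fderiv ℝ (fderiv ℝ G)) x u v w = fderiv ℝ (fderiv ℝ (fderiv ℝ G)) x w v u := by
  have h12 : ∀ u v w, fderiv ℝ (fderiv ℝ (fderiv ℝ G)) x u v w =
      fderiv ℝ (fderiv ℝ (fderiv ℝ G)) x v u w := fun u v w =>
    DFunLike.congr_fun
      (sndFDeriv_symm (G := fderiv ℝ G) (hG.fderiv_right (m := 2) (by norm_num)) u v) w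
  have h23 : ∀ u v w, fderiv ℝ (fderiv ℝ (fderiv ℝ G)) x u v w =
      fderiv ℝ (fderiv ℝ (fderiv ℝ G)) x u w v := fun u v w => by
    have h := hasFDerivAt_fderiv_fderiv hG
    have h1 := (h.clm_apply (hasFDerivAt_const v x)).clm_apply (hasFDerivAt_const w x)
    have h2 := (h.clm_apply (hasFDerivAt_const w x)).clm_apply (hasFDerivAt_const v x)
    have h3 : (fun y => fderiv ℝ (fderiv ℝ G) y v w) =ᶠ[𝓝 x]
        fun y => fderiv ℝ (fderiv ℝ G) y w v := by
      filter_upwards [hG.eventually (by simp)] with y hy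
      exact sndFDeriv_symm (hy.of_le (by norm_num)) v w
    have h4 := congrArg (fun A => A u) ((h2.congr_of_eventuallyEq h3).unique h1)
    simpa using h4.symm
  rw [h12, h23, h12]

theorem christoffel_gram (hG : ContDiffAt ℝ 3 G x) (l i j : κ) :
    christoffel b (fun y => gram b (fderiv ℝ G y)) l i j x =
      ∑ m, (gram b (fderiv ℝ G x))⁻¹ l m *
        ⟪fderiv ℝ (fderiv ℝ G) x (b i) (b j), fderiv ℝ G x (b m)⟫ := by
  have hs := sndFDeriv_symm (hG.of_le (m := 2) (by norm_num))
  rw [christoffel, Finset.mul_sum]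
  refine Finset.sum_congr rfl fun m _ => ?_
  rw [partialDeriv_gram b hG, partialDeriv_gram b hG, partialDeriv_gram b hG,
    hs (b m) (b i), hs (b m) (b j), hs (b j) (b i)]
  have h1 := real_inner_comm (fderiv ℝ G x (b j)) (fderiv ℝ (fderiv ℝ G) x (b i) (b m))
  linear_combination (-(1 / 2) * (gram b (fderiv ℝ G x))⁻¹ l m) * h1

/-- The Christoffel symbols with the first index lowered. -/
theorem sum_gram_mul_christoffel (hG : ContDiffAt ℝ 3 G x)
    (hinj : Function.Injective (fderiv ℝ G x)) (m i j : κ) :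
    ∑ l, gram b (fderiv ℝ G x) m l * christoffel b (fun y => gram b (fderiv ℝ G y)) l i j x =
      ⟪fderiv ℝ (fderiv ℝ G) x (b i) (b j), fderiv ℝ G x (b m)⟫ := by
  have h := congrFun (Matrix.mulVec_mulVec (fun p =>
      ⟪fderiv ℝ (fderiv ℝ G) x (b i) (b j), fderiv ℝ G x (b p)⟫) (gram b (fderiv ℝ G x))
      (gram b (fderiv ℝ G x))⁻¹) m
  rw [Matrix.mul_nonsing_inv _ (isUnit_det_gram b hinj), Matrix.one_mulVec] at h
  rw [← h]
  refine Finset.sum_congr rfl fun l _ => ?_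
  rw [christoffel_gram b hG]
  rfl

theorem differentiableAt_christoffel (hG : ContDiffAt ℝ 3 G x)
    (hinj : Function.Injective (fderiv ℝ G x)) (l i j : κ) :
    DifferentiableAt ℝ (christoffel b (fun y => gram b (fderiv ℝ G y)) l i j) x := by
  have h1 : ContDiffAt ℝ 2 (fderiv ℝ G) x := hG.fderiv_right (by norm_num)
  have h2 : ContDiffAt ℝ 1 (fderiv ℝ (fderiv ℝ G)) x := h1.fderiv_right (by norm_num)
  have h3 : ContDiffAt ℝ 1 (fun y => ∑ m, (gram b (fderiv ℝ G y))⁻¹ l m *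
        ⟪fderiv ℝ (fderiv ℝ G) y (b i) (b j), fderiv ℝ G y (b m)⟫) x := by
    refine ContDiffAt.sum fun m _ => ContDiffAt.mul ?_ (ContDiffAt.inner ℝ ?_ ?_)
    · exact contDiffAt_matrix_inv (fun i j => contDiffAt_gram b (h1.of_le (by norm_num)) i j)
        (isUnit_det_gram b hinj) l m
    · exact (h2.clm_apply contDiffAt_const).clm_apply contDiffAt_const
    · exact (h1.of_le (by norm_num)).clm_apply contDiffAt_const
  refine (h3.differentiableAt (by norm_num)).congr_of_eventuallyEq ?_
  filter_upwards [hG.eventually (by simp)] with y hy using christoffel_gram b hy l i j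

theorem normalForm_eq_sub_christoffel (hG : ContDiffAt ℝ 3 G x)
    (hinj : Function.Injective (fderiv ℝ G x)) (i j : κ) :
    normalForm (fderiv ℝ G x) (fderiv ℝ (fderiv ℝ G) x) (b i) (b j) =
      fderiv ℝ (fderiv ℝ G) x (b i) (b j)
        - ∑ l, christoffel b (fun y => gram b (fderiv ℝ G y)) l i j x • fderiv ℝ G x (b l) := by
  rw [normalForm_eq_sub b hinj]
  simp only [christoffel_gram b hG]

/-- The derivatives of the Christoffel symbols, obtained by differentiating their version with a
lowered index. -/
theorem sum_gram_mul_partialDeriv_christoffel (hG : ContDiffAt ℝ 3 G x)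
    (hinj : Function.Injective (fderiv ℝ G x)) (p m i j : κ) :
    ∑ l, gram b (fderiv ℝ G x) m l *
        partialDeriv b p (christoffel b (fun y => gram b (fderiv ℝ G y)) l i j) x =
      ⟪fderiv ℝ (fderiv ℝ (fderiv ℝ G)) x (b p) (b i) (b j), fderiv ℝ G x (b m)⟫
        + ⟪normalForm (fderiv ℝ G x) (fderiv ℝ (fderiv ℝ G) x) (b i) (b j),
            normalForm (fderiv ℝ G x) (fderiv ℝ (fderiv ℝ G) x) (b p) (b m)⟫
        - ∑ q, christoffel b (fun y => gram b (fderiv ℝ G y)) q i j x *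
            ⟪fderiv ℝ (fderiv ℝ G) x (b p) (b q), fderiv ℝ G x (b m)⟫ := by
  set Γ := christoffel b (fun y => gram b (fderiv ℝ G y)) with hΓ
  have hD := hasFDerivAt_fderiv hG
  have hD2 := hasFDerivAt_fderiv_fderiv hG
  have hg : ∀ l, DifferentiableAt ℝ (fun y => gram b (fderiv ℝ G y) m l) x := fun l =>
    (contDiffAt_gram b (hG.fderiv_right (m := 2) (by norm_num)) m l).differentiableAt
      (by norm_num)
  have h1 : HasFDerivAt (fun y => ∑ l, gram b (fderiv ℝ G y) m l * Γ l i j y) _ x :=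
    HasFDerivAt.fun_sum fun l (_ : l ∈ Finset.univ) =>
      (hg l).hasFDerivAt.mul (differentiableAt_christoffel b hG hinj l i j).hasFDerivAt
  have h2 := ((hD2.clm_apply (hasFDerivAt_const (b i) x)).clm_apply
    (hasFDerivAt_const (b j) x)).inner ℝ (hD.clm_apply (hasFDerivAt_const (b m) x))
  have h3 : (fun y => ∑ l, gram b (fderiv ℝ G y) m l * Γ l i j y) =ᶠ[𝓝 x]
      fun y => ⟪fderiv ℝ (fderiv ℝ G) y (b i) (b j), fderiv ℝ G y (b m)⟫ := by
    filter_upwards [hG.eventually (by simp), eventually_injective hD.continuousAt hinj]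
      with y hy hy'
    exact sum_gram_mul_christoffel b hy hy' m i j
  have h4 := congrArg (fun A => A (b p)) ((h2.congr_of_eventuallyEq h3).unique h1)
  have h5 : ∀ l, fderiv ℝ (fun y => gram b (fderiv ℝ G y) m l) x (b p) =
      ⟪fderiv ℝ G x (b m), fderiv ℝ (fderiv ℝ G) x (b p) (b l)⟫
        + ⟪fderiv ℝ (fderiv ℝ G) x (b p) (b m), fderiv ℝ G x (b l)⟫ := fun l =>
    partialDeriv_gram b hG p m l
  simp only [sum_apply, add_apply, smul_apply, h5, smul_eq_mul,
    Finset.sum_add_distrib] at h4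
  rw [inner_normalForm, normalForm_eq_sub_christoffel b hG hinj, inner_sub_left, sum_inner]
  simp only [inner_smul_left, partialDeriv]
  simp at h4 ⊢
  have h6 : ∑ l, Γ l i j x * (⟪fderiv ℝ G x (b m), fderiv ℝ (fderiv ℝ G) x (b p) (b l)⟫
        + ⟪fderiv ℝ (fderiv ℝ G) x (b p) (b m), fderiv ℝ G x (b l)⟫) =
      ∑ l, Γ l i j x * ⟪fderiv ℝ (fderiv ℝ G) x (b p) (b l), fderiv ℝ G x (b m)⟫
      + ∑ l, Γ l i j x * ⟪fderiv ℝ G x (b l), fderiv ℝ (fderiv ℝ G) x (b p) (b m)⟫ := by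
    rw [← Finset.sum_add_distrib]
    refine Finset.sum_congr rfl fun l _ => ?_
    rw [real_inner_comm, real_inner_comm (fderiv ℝ G x (b l)), mul_add]
  linarith

theorem partialDeriv_christoffel (hG : ContDiffAt ℝ 3 G x)
    (hinj : Function.Injective (fderiv ℝ G x)) (p l i j : κ) :
    partialDeriv b p (christoffel b (fun y => gram b (fderiv ℝ G y)) l i j) x =
      ∑ m, (gram b (fderiv ℝ G x))⁻¹ l m *
        (⟪fderiv ℝ (fderiv ℝ (fderiv ℝ G)) x (b p) (b i) (b j), fderiv ℝ G x (b m)⟫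
          + ⟪normalForm (fderiv ℝ G x) (fderiv ℝ (fderiv ℝ G) x) (b i) (b j),
            normalForm (fderiv ℝ G x) (fderiv ℝ (fderiv ℝ G) x) (b p) (b m)⟫)
        - ∑ q, christoffel b (fun y => gram b (fderiv ℝ G y)) q i j x *
            christoffel b (fun y => gram b (fderiv ℝ G y)) l p q x := by
  set g := gram b (fderiv ℝ G x) with hg
  have h := congrFun (Matrix.mulVec_mulVec (fun q =>
    partialDeriv b p (christoffel b (fun y => gram b (fderiv ℝ G y)) q i j) x) g⁻¹ g) l
  rw [Matrix.nonsing_inv_mul _ (isUnit_det_gram b hinj), Matrix.one_mulVec] at h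
  have h1 : ∀ m, Matrix.mulVec g (fun q =>
      partialDeriv b p (christoffel b (fun y => gram b (fderiv ℝ G y)) q i j) x) m = _ := fun m =>
    sum_gram_mul_partialDeriv_christoffel b hG hinj p m i j
  rw [← h, Matrix.mulVec, dotProduct]
  simp only [h1, christoffel_gram b hG l p, mul_sub, Finset.sum_sub_distrib, Finset.mul_sum]
  congr 1
  rw [Finset.sum_comm]
  exact Finset.sum_congr rfl fun q _ => Finset.sum_congr rfl fun m _ => by ring

/-- The Gauss equation for the Ricci curvature. The third derivatives of the immersion cancel by
their symmetry, the products of Christoffel symbols cancel identically. -/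
theorem ricci_gram (hG : ContDiffAt ℝ 3 G x) (hinj : Function.Injective (fderiv ℝ G x))
    (i j : κ) :
    ricci b (fun y => gram b (fderiv ℝ G y)) i j x =
      ∑ l, ∑ m, (gram b (fderiv ℝ G x))⁻¹ l m *
        (⟪normalForm (fderiv ℝ G x) (fderiv ℝ (fderiv ℝ G) x) (b i) (b j),
            normalForm (fderiv ℝ G x) (fderiv ℝ (fderiv ℝ G) x) (b l) (b m)⟫
          - ⟪normalForm (fderiv ℝ G x) (fderiv ℝ (fderiv ℝ G) x) (b i) (b l),
            normalForm (fderiv ℝ G x) (fderiv ℝ (fderiv ℝ G) x) (b j) (b m)⟫) := by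
  rw [ricci, ← Finset.sum_add_distrib]
  refine Finset.sum_congr rfl fun l _ => ?_
  rw [partialDeriv_christoffel b hG hinj, partialDeriv_christoffel b hG hinj,
    thirdFDeriv_symm hG (b l) (b i) (b j)]
  simp only [← Finset.sum_sub_distrib, ← Finset.sum_add_distrib]
  exact Finset.sum_congr rfl fun m _ => by ring

/-- The twice contracted Gauss equation: the scalar curvature of the metric induced by an immersion
depends only on the first two derivatives of the immersion. -/
theorem metricScal_gram (hG : ContDiffAt ℝ 3 G x) (hinj : Function.Injective (fderiv ℝ G x)) :
    metricScal b (fun y => gram b (fderiv ℝ G y)) x =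
      gaussScal b (fderiv ℝ G x) (fderiv ℝ (fderiv ℝ G) x) := by
  simp only [metricScal, ricci_gram b hG hinj, gaussScal]

end Gauss
end Bending

/-! ### Independence of charts and smoothness of the unit mean curvature field -/

namespace Bending

section Reparametrization

variable {V : Type*} [NormedAddCommGroup V] [NormedSpace ℝ V] [FiniteDimensional ℝ V]
  {E : Type*} [NormedAddCommGroup E] [InnerProductSpace ℝ E] [FiniteDimensional ℝ E]
  {κ : Type*} [Fintype κ] [DecidableEq κ] {κ' : Type*} [Fintype κ'] [DecidableEq κ']

theorem injective_of_comp {L : V →L[ℝ] E} {T : V →L[ℝ] V}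
    (hinj : Function.Injective (L.comp T)) : Function.Injective L := by
  have hT : Function.Injective T := Function.Injective.of_comp (f := L) hinj
  have hT' : Function.Surjective T := LinearMap.injective_iff_surjective (f := T.toLinearMap).1 hT
  intro v w hvw
  obtain ⟨v, rfl⟩ := hT' v
  obtain ⟨w, rfl⟩ := hT' w
  rw [hinj hvw]

/-- The normal form is a tensor: under a change of coordinates the second derivative changes by
a tangential term only. -/
theorem normalForm_comp {L : V →L[ℝ] E} {T : V →L[ℝ] V} {B B' : V →L[ℝ] V →L[ℝ] E}
    {r : V → V → V} (hinj : Function.Injective (L.comp T))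
    (hB : ∀ v w, B' v w = B (T v) (T w) + L (r v w)) (v w : V) :
    normalForm (L.comp T) B' v w = normalForm L B (T v) (T w) := by
  have hT : Function.Injective T := Function.Injective.of_comp (f := L) hinj
  have hT' : Function.Surjective T := LinearMap.injective_iff_surjective (f := T.toLinearMap).1 hT
  have hr : LinearMap.range (L.comp T).toLinearMap = LinearMap.range L.toLinearMap :=
    LinearMap.range_comp_of_range_eq_top _ (LinearMap.range_eq_top.2 hT')
  have h0 : (LinearMap.range L.toLinearMap)ᗮ.starProjection (L (r v w)) = 0 :=
    (Submodule.starProjection_apply_eq_zero_iff _).2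
      (Submodule.le_orthogonal_orthogonal _ ⟨_, rfl⟩)
  simp only [normalForm, hr, hB, map_add, h0, add_zero]

theorem meanVec_comp (b : Module.Basis κ ℝ V) (b' : Module.Basis κ' ℝ V) {L : V →L[ℝ] E}
    {T : V →L[ℝ] V} {B B' : V →L[ℝ] V →L[ℝ] E} {r : V → V → V}
    (hinj : Function.Injective (L.comp T))
    (hB : ∀ v w, B' v w = B (T v) (T w) + L (r v w)) :
    meanVec b' (L.comp T) B' = meanVec b L B := by
  obtain ⟨e, he⟩ := exists_orthonormal hinj
  rw [meanVec_eq_sum b' B' he (by simp), meanVec_eq_sum b B (e := fun i => T (e i)) he (by simp)]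
  simp only [normalForm_comp hinj hB]

theorem gaussScal_comp (b : Module.Basis κ ℝ V) (b' : Module.Basis κ' ℝ V) {L : V →L[ℝ] E}
    {T : V →L[ℝ] V} {B B' : V →L[ℝ] V →L[ℝ] E} {r : V → V → V}
    (hinj : Function.Injective (L.comp T))
    (hB : ∀ v w, B' v w = B (T v) (T w) + L (r v w)) :
    gaussScal b' (L.comp T) B' = gaussScal b L B := by
  obtain ⟨e, he⟩ := exists_orthonormal hinj
  rw [gaussScal_eq_sum b' B' he (by simp),
    gaussScal_eq_sum b B (e := fun i => T (e i)) he (by simp)]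
  simp only [normalForm_comp hinj hB]

theorem fderiv_fderiv_comp {Φ : V → E} {τ : V → V} {z : V} (hΦ : ContDiffAt ℝ ∞ Φ (τ z))
    (hτ : ContDiffAt ℝ ∞ τ z) (v w : V) :
    fderiv ℝ (fderiv ℝ (Φ ∘ τ)) z v w =
      fderiv ℝ (fderiv ℝ Φ) (τ z) (fderiv ℝ τ z v) (fderiv ℝ τ z w)
        + fderiv ℝ Φ (τ z) (fderiv ℝ (fderiv ℝ τ) z v w) := by
  have hΦ1 : DifferentiableAt ℝ (fderiv ℝ Φ) (τ z) :=
    (hΦ.fderiv_right (m := ∞) (by simp)).differentiableAt (by simp)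
  have hτ1 : DifferentiableAt ℝ (fderiv ℝ τ) z :=
    (hτ.fderiv_right (m := ∞) (by simp)).differentiableAt (by simp)
  have hτ0 : DifferentiableAt ℝ τ z := hτ.differentiableAt (by simp)
  have h1 : fderiv ℝ (Φ ∘ τ) =ᶠ[𝓝 z] fun y => (fderiv ℝ Φ (τ y)).comp (fderiv ℝ τ y) := by
    have hΦ2 : ∀ᶠ y in 𝓝 (τ z), DifferentiableAt ℝ Φ y := by
      filter_upwards [(hΦ.of_le (m := 1) ENat.LEInfty.out).eventually (by simp)] with y hy
      exact hy.differentiableAt (by simp)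
    filter_upwards [hτ.continuousAt.eventually hΦ2,
      (hτ.of_le (m := 1) ENat.LEInfty.out).eventually (by simp)] with y hy hy'
    exact fderiv_comp y hy (hy'.differentiableAt (by simp))
  have h2 := (hΦ1.hasFDerivAt.comp z hτ0.hasFDerivAt).clm_comp hτ1.hasFDerivAt
  rw [(h2.congr_of_eventuallyEq h1).fderiv]
  simp [add_comm]

variable {H : Type*} [TopologicalSpace H] {I : ModelWithCorners ℝ V H} [I.Boundaryless]
  {X : Type*} [TopologicalSpace X] [ChartedSpace H X] [IsManifold I ∞ X]
  {F : X → E} {p : X}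

theorem contDiffAt_localRep (hF : ContMDiffAt I 𝓘(ℝ, E) ∞ F p) :
    ContDiffAt ℝ ∞ (localRep I F p) (extChartAt I p p) := by
  have h := (contMDiffAt_iff.1 hF).2
  rw [I.range_eq_univ, contDiffWithinAt_univ] at h
  exact h

theorem differential_eq_fderiv_localRep (hF : ContMDiffAt I 𝓘(ℝ, E) ∞ F p) :
    differential I F p = fderiv ℝ (localRep I F p) (extChartAt I p p) := by
  rw [differential, (hF.mdifferentiableAt (by simp)).mfderiv, I.range_eq_univ,
    fderivWithin_univ]
  rfl

theorem meanCurvature_eq_meanVec_localRep (hF : ContMDiffAt I 𝓘(ℝ, E) ∞ F p) :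
    meanCurvature I F p = meanVec (Module.finBasis ℝ V)
      (fderiv ℝ (localRep I F p) (extChartAt I p p))
      (fderiv ℝ (fderiv ℝ (localRep I F p)) (extChartAt I p p)) := by
  simp only [meanCurvature, secondFundamentalForm, tangentImage,
    differential_eq_fderiv_localRep hF]
  rfl

/-- The Gauss equation for the preferred chart. -/
theorem scalarCurvature_eq_gaussScal_localRep (hF : ContMDiffAt I 𝓘(ℝ, E) ∞ F p)
    (hinj : Function.Injective (fderiv ℝ (localRep I F p) (extChartAt I p p))) :
    scalarCurvature I F p = gaussScal (Module.finBasis ℝ V)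
      (fderiv ℝ (localRep I F p) (extChartAt I p p))
      (fderiv ℝ (fderiv ℝ (localRep I F p)) (extChartAt I p p)) :=
  metricScal_gram _ ((contDiffAt_localRep hF).of_le ENat.LEInfty.out) hinj

variable {ψ : V → X} {z : V}

theorem localRep_comp_eventuallyEq (hψ : ContinuousAt ψ z) :
    localRep I F (ψ z) ∘ (extChartAt I (ψ z) ∘ ψ) =ᶠ[𝓝 z] F ∘ ψ := by
  filter_upwards [hψ.eventually (extChartAt_source_mem_nhds (I := I) (ψ z))] with y hy
  exact congrArg F ((extChartAt I (ψ z)).left_inv hy)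

theorem contDiffAt_extChartAt_comp (hψ : ContMDiffAt 𝓘(ℝ, V) I ∞ ψ z) :
    ContDiffAt ℝ ∞ (extChartAt I (ψ z) ∘ ψ) z :=
  contMDiffAt_iff_contDiffAt.1 ((contMDiffAt_extChartAt (I := I) (n := ∞)).comp z hψ)

theorem fderiv_comp_parametrization (hF : ContMDiffAt I 𝓘(ℝ, E) ∞ F (ψ z))
    (hψ : ContMDiffAt 𝓘(ℝ, V) I ∞ ψ z) :
    fderiv ℝ (F ∘ ψ) z = (fderiv ℝ (localRep I F (ψ z)) (extChartAt I (ψ z) (ψ z))).comp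
      (fderiv ℝ (extChartAt I (ψ z) ∘ ψ) z) := by
  rw [← (localRep_comp_eventuallyEq (I := I) hψ.continuousAt).fderiv_eq]
  exact fderiv_comp z ((contDiffAt_localRep hF).differentiableAt (by simp))
    ((contDiffAt_extChartAt_comp hψ).differentiableAt (by simp))

theorem fderiv_fderiv_comp_parametrization (hF : ContMDiffAt I 𝓘(ℝ, E) ∞ F (ψ z))
    (hψ : ContMDiffAt 𝓘(ℝ, V) I ∞ ψ z) (v w : V) :
    fderiv ℝ (fderiv ℝ (F ∘ ψ)) z v w =
      fderiv ℝ (fderiv ℝ (localRep I F (ψ z))) (extChartAt I (ψ z) (ψ z))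
        (fderiv ℝ (extChartAt I (ψ z) ∘ ψ) z v) (fderiv ℝ (extChartAt I (ψ z) ∘ ψ) z w)
      + fderiv ℝ (localRep I F (ψ z)) (extChartAt I (ψ z) (ψ z))
        (fderiv ℝ (fderiv ℝ (extChartAt I (ψ z) ∘ ψ)) z v w) := by
  rw [← (localRep_comp_eventuallyEq (I := I) hψ.continuousAt).fderiv.fderiv_eq]
  exact fderiv_fderiv_comp (Φ := localRep I F (ψ z)) (τ := extChartAt I (ψ z) ∘ ψ) (z := z)
    (contDiffAt_localRep hF) (contDiffAt_extChartAt_comp hψ) v w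

/-- A map whose composition with some smooth parametrization of full dimension is an immersion
is itself an immersion. -/
theorem isImmersionAt_of_comp (hF : ContMDiffAt I 𝓘(ℝ, E) ∞ F (ψ z))
    (hψ : ContMDiffAt 𝓘(ℝ, V) I ∞ ψ z) (hinj : Function.Injective (fderiv ℝ (F ∘ ψ) z)) :
    IsImmersionAt I 𝓘(ℝ, E) F (ψ z) := by
  refine ⟨hF, ?_⟩
  rw [fderiv_comp_parametrization hF hψ] at hinj
  have h := injective_of_comp hinj
  rw [← differential_eq_fderiv_localRep hF] at h
  exact h

/-- The scalar curvature may be computed in any parametrization and any basis, not only in the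
preferred chart. -/
theorem scalarCurvature_eq_gaussScal (b : Module.Basis κ ℝ V)
    (hF : ContMDiffAt I 𝓘(ℝ, E) ∞ F (ψ z)) (hψ : ContMDiffAt 𝓘(ℝ, V) I ∞ ψ z)
    (hinj : Function.Injective (fderiv ℝ (F ∘ ψ) z)) :
    scalarCurvature I F (ψ z) =
      gaussScal b (fderiv ℝ (F ∘ ψ) z) (fderiv ℝ (fderiv ℝ (F ∘ ψ)) z) := by
  have h := fderiv_comp_parametrization hF hψ
  rw [h] at hinj ⊢
  rw [scalarCurvature_eq_gaussScal_localRep hF (injective_of_comp hinj)]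
  exact (gaussScal_comp _ b hinj (fderiv_fderiv_comp_parametrization hF hψ)).symm

theorem meanCurvature_eq_meanVec (b : Module.Basis κ ℝ V)
    (hF : ContMDiffAt I 𝓘(ℝ, E) ∞ F (ψ z)) (hψ : ContMDiffAt 𝓘(ℝ, V) I ∞ ψ z)
    (hinj : Function.Injective (fderiv ℝ (F ∘ ψ) z)) :
    meanCurvature I F (ψ z) =
      meanVec b (fderiv ℝ (F ∘ ψ) z) (fderiv ℝ (fderiv ℝ (F ∘ ψ)) z) := by
  have h := fderiv_comp_parametrization hF hψ
  rw [h] at hinj ⊢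
  rw [meanCurvature_eq_meanVec_localRep hF]
  exact (meanVec_comp _ b hinj (fderiv_fderiv_comp_parametrization hF hψ)).symm

end Reparametrization

section MeanCurvature

variable {V : Type*} [NormedAddCommGroup V] [InnerProductSpace ℝ V] [FiniteDimensional ℝ V]
  {E : Type*} [NormedAddCommGroup E] [InnerProductSpace ℝ E] [FiniteDimensional ℝ E]
  {κ : Type*} [Fintype κ] [DecidableEq κ] {n : ℕ}
  {M : Type*} [TopologicalSpace M] [ChartedSpace (EuclideanSpace ℝ (Fin n)) M]

theorem contDiffAt_meanVec (b : Module.Basis κ ℝ V) {D : V → V →L[ℝ] E}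
    {D2 : V → V →L[ℝ] V →L[ℝ] E} {x : V} (hD : ContDiffAt ℝ ∞ D x) (hD2 : ContDiffAt ℝ ∞ D2 x)
    (hinj : Function.Injective (D x)) :
    ContDiffAt ℝ ∞ (fun y => meanVec b (D y) (D2 y)) x := by
  have hP := contDiffAt_starProjection_range hD (eventually_injective hD.continuousAt hinj)
  simp only [meanVec, normalForm, Submodule.starProjection_orthogonal_val]
  refine ContDiffAt.sum fun i _ => ContDiffAt.sum fun j _ => ContDiffAt.smul ?_ ?_
  · exact contDiffAt_matrix_inv (fun i j => contDiffAt_gram b hD i j)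
      (isUnit_det_gram b hinj) i j
  · have h : ContDiffAt ℝ ∞ (fun y => D2 y (b i) (b j)) x :=
      (hD2.clm_apply contDiffAt_const).clm_apply contDiffAt_const
    exact h.sub (hP.clm_apply h)

variable [IsManifold (𝓡 n) ∞ M] (f : Immersion (𝓡 n) 𝓘(ℝ, E) M E)

theorem contMDiff_meanCurvature :
    ContMDiff (𝓡 n) 𝓘(ℝ, E) ∞ (meanCurvature (𝓡 n) f.toFun) := by
  intro p₀
  have hloc : ContDiffAt ℝ ∞ (localRep (𝓡 n) f.toFun p₀) (extChartAt (𝓡 n) p₀ p₀) :=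
    contDiffAt_localRep (f.contMDiff p₀)
  have hD : ContDiffAt ℝ ∞ (fderiv ℝ (localRep (𝓡 n) f.toFun p₀)) (extChartAt (𝓡 n) p₀ p₀) :=
    hloc.fderiv_right (by simp)
  have hinj := (tangentImage_eq f p₀ (mem_extChartAt_target (I := 𝓡 n) p₀)).2
  have h := contDiffAt_meanVec (EuclideanSpace.basisFun (Fin n) ℝ).toBasis hD
    (hD.fderiv_right (m := ∞) (by simp)) hinj
  refine (h.contMDiffAt.comp p₀
    (contMDiffAt_extChartAt (I := 𝓡 n) (n := ∞))).congr_of_eventuallyEq ?_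
  filter_upwards [extChartAt_source_mem_nhds (I := 𝓡 n) p₀] with p hp
  have hp' := (extChartAt (𝓡 n) p₀).map_source hp
  have hψ : ContMDiffAt 𝓘(ℝ, EuclideanSpace ℝ (Fin n)) (𝓡 n) ∞ (extChartAt (𝓡 n) p₀).symm
      (extChartAt (𝓡 n) p₀ p) :=
    (contMDiffOn_extChartAt_symm (I := 𝓡 n) (n := ∞) p₀).contMDiffAt
      ((isOpen_extChartAt_target (I := 𝓡 n) p₀).mem_nhds hp')
  have h2 := meanCurvature_eq_meanVec (EuclideanSpace.basisFun (Fin n) ℝ).toBasis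
    (f.contMDiff _) hψ (tangentImage_eq f p₀ hp').2
  rwa [(extChartAt (𝓡 n) p₀).left_inv hp] at h2

theorem tangentImage_inner_meanCurvature (p : M) {v : E}
    (hv : v ∈ tangentImage (𝓡 n) f.toFun p) : ⟪v, meanCurvature (𝓡 n) f.toFun p⟫ = 0 := by
  refine (Submodule.mem_orthogonal _ _).1 ?_ v hv
  refine Submodule.sum_mem _ fun i _ => Submodule.sum_mem _ fun j _ => Submodule.smul_mem _ _ ?_
  exact Submodule.starProjection_apply_mem _ _

/-- By the Gauss equation, the scalar curvature is at most the square of the mean curvature. -/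
theorem meanCurvature_ne_zero {p : M} (hpos : 0 < scalarCurvature (𝓡 n) f.toFun p) :
    meanCurvature (𝓡 n) f.toFun p ≠ 0 := by
  have hinj := (tangentImage_eq f p (mem_extChartAt_target (I := 𝓡 n) p)).2
  obtain ⟨e, he⟩ := exists_orthonormal hinj
  rw [scalarCurvature_eq_gaussScal_localRep (f.contMDiff p) hinj,
    gaussScal_eq_sum _ _ he (by simp)] at hpos
  rw [meanCurvature_eq_meanVec_localRep (f.contMDiff p), meanVec_eq_sum _ _ he (by simp)]
  intro h0
  rw [h0, norm_zero] at hpos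
  have : 0 ≤ ∑ a, ∑ c, ‖normalForm (fderiv ℝ (localRep (𝓡 n) f.toFun p) (extChartAt (𝓡 n) p p))
      (fderiv ℝ (fderiv ℝ (localRep (𝓡 n) f.toFun p)) (extChartAt (𝓡 n) p p)) (e a) (e c)‖ ^ 2 :=
    Finset.sum_nonneg fun _ _ => Finset.sum_nonneg fun _ _ => sq_nonneg _
  linarith

variable {f}

theorem norm_xi (hpos : ∀ p, 0 < scalarCurvature (𝓡 n) f.toFun p) (p : M) :
    ‖xi (𝓡 n) f.toFun p‖ = 1 := by
  rw [xi, norm_smul, norm_inv, norm_norm]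
  exact inv_mul_cancel₀ (norm_ne_zero_iff.2 (meanCurvature_ne_zero f (hpos p)))

theorem tangentImage_inner_xi (p : M) {v : E}
    (hv : v ∈ tangentImage (𝓡 n) f.toFun p) : ⟪v, xi (𝓡 n) f.toFun p⟫ = 0 := by
  rw [xi, inner_smul_right, tangentImage_inner_meanCurvature f p hv, mul_zero]

/-- Positivity of the scalar curvature enters only here: it keeps the mean curvature away from zero,
where the normalization is not smooth. -/
theorem contMDiff_xi (hpos : ∀ p, 0 < scalarCurvature (𝓡 n) f.toFun p) :
    ContMDiff (𝓡 n) 𝓘(ℝ, E) ∞ (xi (𝓡 n) f.toFun) := by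
  intro p
  have h0 := meanCurvature_ne_zero f (hpos p)
  have h1 : ContDiffAt ℝ ∞ (fun v : E => ‖v‖⁻¹ • v) (meanCurvature (𝓡 n) f.toFun p) :=
    ((contDiffAt_norm ℝ h0).inv (norm_ne_zero_iff.2 h0)).smul contDiffAt_id
  exact h1.contMDiffAt.comp p (contMDiff_meanCurvature f p)

end MeanCurvature
end Bending

/-! ### The second fundamental form of a bending at a point -/

namespace Bending

section Jets

variable {X : Type*} [NormedAddCommGroup X] [NormedSpace ℝ X] [FiniteDimensional ℝ X]
  {Y : Type*} [NormedAddCommGroup Y] [NormedSpace ℝ Y] [FiniteDimensional ℝ Y]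
  {E : Type*} [NormedAddCommGroup E] [InnerProductSpace ℝ E] [FiniteDimensional ℝ E]

/-- The 2-jet, at a point of a product `X × Y`, of a submanifold `φ : X → E`, a unit section
`ν : X × Y → E` of its normal bundle whose restriction to each slice parametrizes the unit normal
sphere, and a unit vector field `ξ : X → E` that is orthogonal to `φ` and to these spheres.
Indices denote the order of the derivative. -/
structure NormalJet (X Y E : Type*) [NormedAddCommGroup X] [NormedSpace ℝ X]
    [NormedAddCommGroup Y] [NormedSpace ℝ Y] [NormedAddCommGroup E] [InnerProductSpace ℝ E] where
  φ₁ : X →L[ℝ] E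
  φ₂ : X →L[ℝ] X →L[ℝ] E
  ν : E
  ν₁ : X × Y →L[ℝ] E
  ν₂ : X × Y →L[ℝ] X × Y →L[ℝ] E
  ξ : E
  ξ₁ : X →L[ℝ] E
  ξ₂ : X →L[ℝ] X →L[ℝ] E
  φ₂_symm : ∀ x x', φ₂ x x' = φ₂ x' x
  ν₂_symm : ∀ z z', ν₂ z z' = ν₂ z' z
  ξ₂_symm : ∀ x x', ξ₂ x x' = ξ₂ x' x
  norm_ν : ‖ν‖ = 1
  norm_ξ : ‖ξ‖ = 1
  inner_ν_ξ : ⟪ν, ξ⟫ = 0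
  inner_ν_φ₁ : ∀ x, ⟪ν, φ₁ x⟫ = 0
  inner_ξ_φ₁ : ∀ x, ⟪ξ, φ₁ x⟫ = 0
  inner_ν_ν₁ : ∀ y, ⟪ν, ν₁ (0, y)⟫ = 0
  inner_ξ_ν₁ : ∀ y, ⟪ξ, ν₁ (0, y)⟫ = 0
  inner_ν₁_φ₁ : ∀ y x, ⟪ν₁ (0, y), φ₁ x⟫ = 0
  exists_ν₂ : ∀ y y', ∃ z, ν₂ (0, y) (0, y') = ν₁ (0, z) - ⟪ν₁ (0, y), ν₁ (0, y')⟫ • ν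

/-- Quantitative bounds for a jet: `K` bounds the derivatives, `c` is a lower bound for the
differentials of the immersions involved. -/
structure NormalJet.IsBounded (J : NormalJet X Y E) (K c : ℝ) : Prop where
  c_pos : 0 < c
  K_pos : 0 < K
  le_φ₁ : ∀ x, c * ‖x‖ ≤ ‖J.φ₁ x‖
  le_ν₁ : ∀ y, c * ‖y‖ ≤ ‖J.ν₁ (0, y)‖
  φ₂_le : ‖J.φ₂‖ ≤ K
  ν₁_le : ‖J.ν₁‖ ≤ K
  ν₂_le : ‖J.ν₂‖ ≤ K
  ξ₁_le : ‖J.ξ₁‖ ≤ K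
  ξ₂_le : ‖J.ξ₂‖ ≤ K

/-- `L` and `B` are the first and second derivatives of `φ + a ν + b ξ`, for a unit speed curve
`(a, b)` with velocity `(a₁, b₁)`, curvature `κ` and `σ = b₁ / a`. -/
structure IsBendingJet (J : NormalJet X Y E) (a b a₁ b₁ κ σ : ℝ) (L : (X × Y) × ℝ →L[ℝ] E)
    (B : (X × Y) × ℝ →L[ℝ] (X × Y) × ℝ →L[ℝ] E) : Prop where
  L_apply : ∀ w, L w = J.φ₁ w.1.1 + a • J.ν₁ w.1 + b • J.ξ₁ w.1.1 + w.2 • (a₁ • J.ν + b₁ • J.ξ)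
  B_apply : ∀ v w, B v w = J.φ₂ v.1.1 w.1.1 + a • J.ν₂ v.1 w.1 + b • J.ξ₂ v.1.1 w.1.1
    + v.2 • (a₁ • J.ν₁ w.1 + b₁ • J.ξ₁ w.1.1) + w.2 • (a₁ • J.ν₁ v.1 + b₁ • J.ξ₁ v.1.1)
    + (v.2 * w.2 * κ) • (-b₁ • J.ν + a₁ • J.ξ)
  a_ne_zero : a ≠ 0
  unit_speed : a₁ ^ 2 + b₁ ^ 2 = 1
  b₁_eq : b₁ = σ * a

namespace IsBendingJet

variable {J : NormalJet X Y E} {a b a₁ b₁ κ σ K c ρ : ℝ} {L : (X × Y) × ℝ →L[ℝ] E}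
  {B : (X × Y) × ℝ →L[ℝ] (X × Y) × ℝ →L[ℝ] E}

theorem L_ver (h : IsBendingJet J a b a₁ b₁ κ σ L B) (y : Y) (s : ℝ) :
    L ((0, y), s) = a • J.ν₁ (0, y) + s • (a₁ • J.ν + b₁ • J.ξ) := by
  simp [h.L_apply]

theorem L_hor (h : IsBendingJet J a b a₁ b₁ κ σ L B) (x : X) :
    L ((x, 0), 0) = J.φ₁ x + (a • J.ν₁ (x, 0) + b • J.ξ₁ x) := by
  simp [h.L_apply, add_assoc]

theorem L_eq (L : (X × Y) × ℝ →L[ℝ] E) (w : (X × Y) × ℝ) :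
    L w = L ((w.1.1, 0), 0) + L ((0, w.1.2), w.2) := by
  rw [← map_add]; simp

/-- The block directions of the bending are mutually orthogonal. -/
theorem inner_ver (h : IsBendingJet J a b a₁ b₁ κ σ L B) (y y' : Y) (s s' : ℝ) :
    ⟪L ((0, y), s), L ((0, y'), s')⟫ = a ^ 2 * ⟪J.ν₁ (0, y), J.ν₁ (0, y')⟫ + s * s' := by
  have h1 := J.inner_ν_ν₁ y
  have h2 := J.inner_ν_ν₁ y'
  have h3 := J.inner_ξ_ν₁ y
  have h4 := J.inner_ξ_ν₁ y'
  rw [real_inner_comm] at h1 h3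
  have h5 : ⟪J.ν, J.ν⟫ = 1 := by rw [real_inner_self_eq_norm_sq, J.norm_ν]; norm_num
  have h6 : ⟪J.ξ, J.ξ⟫ = 1 := by rw [real_inner_self_eq_norm_sq, J.norm_ξ]; norm_num
  have h7 := J.inner_ν_ξ
  have h8 := h7
  rw [real_inner_comm] at h8
  rw [h.L_ver, h.L_ver]
  simp only [inner_add_left, inner_add_right, real_inner_smul_left, real_inner_smul_right,
    h1, h2, h3, h4, h5, h6, h7, h8]
  linear_combination (s * s') * h.unit_speed

theorem inner_ver_φ₁ (h : IsBendingJet J a b a₁ b₁ κ σ L B) (y : Y) (s : ℝ) (x : X) :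
    ⟪L ((0, y), s), J.φ₁ x⟫ = 0 := by
  rw [h.L_ver]
  simp [inner_add_left, real_inner_smul_left, J.inner_ν₁_φ₁, J.inner_ν_φ₁, J.inner_ξ_φ₁]

theorem norm_hor_le (hJ : J.IsBounded K c) (ha : |a| ≤ ρ) (hb : |b| ≤ ρ) (x : X) :
    ‖a • J.ν₁ (x, 0) + b • J.ξ₁ x‖ ≤ 2 * K * ρ * ‖x‖ := by
  have h1 : ‖J.ν₁ (x, 0)‖ ≤ K * ‖x‖ := by
    have := J.ν₁.le_of_opNorm_le hJ.ν₁_le (x, 0)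
    simpa [Prod.norm_def] using this
  have h2 : ‖J.ξ₁ x‖ ≤ K * ‖x‖ := J.ξ₁.le_of_opNorm_le hJ.ξ₁_le x
  calc _ ≤ |a| * ‖J.ν₁ (x, 0)‖ + |b| * ‖J.ξ₁ x‖ := by
        refine (norm_add_le _ _).trans ?_
        simp [norm_smul]
    _ ≤ ρ * (K * ‖x‖) + ρ * (K * ‖x‖) := by
        have : 0 ≤ ρ := (abs_nonneg a).trans ha
        gcongr
    _ = _ := by ring

/-- The horizontal directions are almost orthogonal to the block. -/
theorem abs_inner_hor_ver_le (h : IsBendingJet J a b a₁ b₁ κ σ L B) (hJ : J.IsBounded K c)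
    (ha : |a| ≤ ρ) (hb : |b| ≤ ρ) (x : X) (y : Y) (s : ℝ) :
    |⟪L ((x, 0), 0), L ((0, y), s)⟫| ≤ 2 * K * ρ * ‖x‖ * ‖L ((0, y), s)‖ := by
  rw [h.L_hor, inner_add_left, real_inner_comm, h.inner_ver_φ₁, zero_add]
  refine (abs_real_inner_le_norm _ _).trans ?_
  gcongr
  exact norm_hor_le hJ ha hb x

/-- Only the horizontal component enters since the block is orthogonal to `φ₁`. -/
theorem norm_fst_le (h : IsBendingJet J a b a₁ b₁ κ σ L B) (hJ : J.IsBounded K c)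
    (ha : |a| ≤ ρ) (hb : |b| ≤ ρ) (hρ : 8 * K * ρ ≤ c) (w : (X × Y) × ℝ) :
    ‖w.1.1‖ ≤ 2 / c * ‖L w‖ := by
  have hc := hJ.c_pos
  set x := w.1.1 with hx
  have h1 : ⟪L w, J.φ₁ x⟫ = ‖J.φ₁ x‖ ^ 2 + ⟪a • J.ν₁ (x, 0) + b • J.ξ₁ x, J.φ₁ x⟫ := by
    rw [L_eq, inner_add_left, h.inner_ver_φ₁, add_zero, h.L_hor, inner_add_left,
      real_inner_self_eq_norm_sq]
  have h2 := abs_real_inner_le_norm (a • J.ν₁ (x, 0) + b • J.ξ₁ x) (J.φ₁ x)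
  have h3 := real_inner_le_norm (L w) (J.φ₁ x)
  have h4 := norm_hor_le hJ ha hb x
  have h5 := hJ.le_φ₁ x
  have h6 : ‖a • J.ν₁ (x, 0) + b • J.ξ₁ x‖ ≤ c / 2 * ‖x‖ := by
    refine h4.trans ?_
    gcongr
    linarith [hJ.K_pos, (abs_nonneg a).trans ha, mul_nonneg hJ.K_pos.le ((abs_nonneg a).trans ha)]
  have h7 := neg_le_of_abs_le h2
  rw [div_mul_eq_mul_div, le_div_iff₀ hc]
  rcases (norm_nonneg (J.φ₁ x)).eq_or_lt with h0 | h0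
  · rw [← h0] at h5
    linarith [norm_nonneg (L w)]
  · have h8 : ‖J.φ₁ x‖ ≤ ‖L w‖ + ‖a • J.ν₁ (x, 0) + b • J.ξ₁ x‖ := by
      refine le_of_mul_le_mul_right ?_ h0
      nlinarith
    linarith

theorem injective (h : IsBendingJet J a b a₁ b₁ κ σ L B) (hJ : J.IsBounded K c)
    (ha : |a| ≤ ρ) (hb : |b| ≤ ρ) (hρ : 8 * K * ρ ≤ c) : Function.Injective L := by
  rw [injective_iff_map_eq_zero]
  intro w hw
  have h1 := h.norm_fst_le hJ ha hb hρ w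
  rw [hw, norm_zero, mul_zero, norm_le_zero_iff] at h1
  obtain ⟨⟨x, y⟩, s⟩ := w
  dsimp only at h1
  subst h1
  have h2 := h.inner_ver y y s s
  rw [hw, inner_zero_left, real_inner_self_eq_norm_sq] at h2
  have h3 : 0 ≤ a ^ 2 * ‖J.ν₁ (0, y)‖ ^ 2 := by positivity
  have hs : s = 0 := by nlinarith
  have h4 : a ^ 2 * ‖J.ν₁ (0, y)‖ ^ 2 = 0 := by rw [hs] at h2; linarith
  have h5 : ‖J.ν₁ (0, y)‖ = 0 := by simpa [h.a_ne_zero] using h4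
  have h6 := hJ.le_ν₁ y
  rw [h5] at h6
  have h7 : ‖y‖ ≤ 0 := by
    by_contra hy
    nlinarith [hJ.c_pos]
  rw [hs, norm_le_zero_iff.1 h7]
  rfl

/-- On the block the normal form is a multiple of the normal part of the normal vector
`-b₁ ν + a₁ ξ` of the profile curve. -/
theorem normalForm_ver (h : IsBendingJet J a b a₁ b₁ κ σ L B) (y y' : Y) (s s' : ℝ) :
    normalForm L B ((0, y), s) ((0, y'), s') =
      (κ * (s * s') + σ * (a ^ 2 * ⟪J.ν₁ (0, y), J.ν₁ (0, y')⟫)) •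
        (LinearMap.range L.toLinearMap)ᗮ.starProjection (-b₁ • J.ν + a₁ • J.ξ) := by
  obtain ⟨z, hz⟩ := J.exists_ν₂ y y'
  set g := ⟪J.ν₁ (0, y), J.ν₁ (0, y')⟫
  have ha := h.a_ne_zero
  have h1 : B ((0, y), s) ((0, y'), s') =
      L ((0, z + (s * a₁ / a) • y' + (s' * a₁ / a) • y), -(a * g * a₁))
        + (κ * (s * s') + σ * (a ^ 2 * g)) • (-b₁ • J.ν + a₁ • J.ξ) := by
    have e1 : J.ν₁ (0, z + (s * a₁ / a) • y' + (s' * a₁ / a) • y) =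
        J.ν₁ (0, z) + (s * a₁ / a) • J.ν₁ (0, y') + (s' * a₁ / a) • J.ν₁ (0, y) := by
      rw [← map_smul, ← map_smul, ← map_add, ← map_add]
      simp
    rw [h.B_apply, h.L_ver, e1]
    dsimp only
    rw [hz]
    have hb := h.b₁_eq
    have hu := h.unit_speed
    have hν : (a * g) • J.ν = (a * g * a₁) • (a₁ • J.ν + b₁ • J.ξ)
        - (σ * (a ^ 2 * g)) • (-b₁ • J.ν + a₁ • J.ξ) := by
      have e2 : σ * (a ^ 2 * g) = a * g * b₁ := by rw [hb]; ring
      rw [e2]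
      have e3 : a * g = a * g * (a₁ ^ 2 + b₁ ^ 2) := by rw [hu, mul_one]
      conv_lhs => rw [e3]
      module
    simp only [map_zero, smul_zero, add_zero, zero_add, smul_sub,
      smul_add, smul_smul, mul_div_cancel₀ _ ha]
    simp only [smul_add, smul_smul] at hν
    rw [hν]
    module
  rw [normalForm, h1, map_add, map_smul]
  have h0 : (LinearMap.range L.toLinearMap)ᗮ.starProjection
      (L ((0, z + (s * a₁ / a) • y' + (s' * a₁ / a) • y), -(a * g * a₁))) = 0 :=
    (Submodule.starProjection_apply_eq_zero_iff _).2
      (Submodule.le_orthogonal_orthogonal _ ⟨_, rfl⟩)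
  rw [h0, zero_add]

theorem norm_normal (h : IsBendingJet J a b a₁ b₁ κ σ L B) : ‖-b₁ • J.ν + a₁ • J.ξ‖ = 1 := by
  have h1 : ‖-b₁ • J.ν + a₁ • J.ξ‖ ^ 2 = 1 := by
    rw [norm_add_sq_real, norm_smul, norm_smul, J.norm_ν, J.norm_ξ, real_inner_smul_left,
      real_inner_smul_right, J.inner_ν_ξ]
    simp only [Real.norm_eq_abs, abs_neg, mul_one, sq_abs]
    linarith [h.unit_speed]
  nlinarith [norm_nonneg (-b₁ • J.ν + a₁ • J.ξ)]

/-- The normal vector of the profile curve is almost normal to the bending. -/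
theorem norm_starProjection_normal_sq (h : IsBendingJet J a b a₁ b₁ κ σ L B)
    (hJ : J.IsBounded K c) (ha : |a| ≤ ρ) (hb : |b| ≤ ρ) (hρ : 8 * K * ρ ≤ c) :
    3 / 4 ≤ ‖(LinearMap.range L.toLinearMap)ᗮ.starProjection (-b₁ • J.ν + a₁ • J.ξ)‖ ^ 2 := by
  set η := -b₁ • J.ν + a₁ • J.ξ with hη
  set R := LinearMap.range L.toLinearMap
  have hc := hJ.c_pos
  have h1 := h.norm_normal
  have hver : ∀ y s, ⟪L ((0, y), s), η⟫ = 0 := fun y s => by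
    have h2 := J.inner_ν_ν₁ y
    have h4 := J.inner_ξ_ν₁ y
    rw [real_inner_comm] at h2 h4
    have h5 : ⟪J.ν, J.ν⟫ = 1 := by rw [real_inner_self_eq_norm_sq, J.norm_ν]; norm_num
    have h6 : ⟪J.ξ, J.ξ⟫ = 1 := by rw [real_inner_self_eq_norm_sq, J.norm_ξ]; norm_num
    have h7 := J.inner_ν_ξ
    have h8 := h7
    rw [real_inner_comm] at h8
    rw [h.L_ver, hη]
    simp only [inner_add_left, inner_add_right, real_inner_smul_left, real_inner_smul_right,
      h2, h4, h5, h6, h7, h8]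
    ring
  have hφ : ∀ x, ⟪J.φ₁ x, η⟫ = 0 := fun x => by
    rw [real_inner_comm, hη]
    simp [inner_add_left, real_inner_smul_left, J.inner_ν_φ₁, J.inner_ξ_φ₁]
  obtain ⟨w, hw⟩ : ∃ w, L w = R.starProjection η := R.starProjection_apply_mem η
  have h2 : ‖R.starProjection η‖ ^ 2 = ⟪L w, η⟫ := by
    rw [hw, ← real_inner_self_eq_norm_sq, Submodule.inner_starProjection_left_eq_right,
      Submodule.starProjection_eq_self_iff.2 (R.starProjection_apply_mem η), real_inner_comm]
  have h3 : ⟪L w, η⟫ ≤ 2 * K * ρ * ‖w.1.1‖ := by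
    rw [L_eq, inner_add_left, hver, add_zero, h.L_hor, inner_add_left, hφ, zero_add]
    refine (real_inner_le_norm _ _).trans ?_
    rw [h1, mul_one]
    exact norm_hor_le hJ ha hb _
  have h4 := h.norm_fst_le hJ ha hb hρ w
  rw [hw] at h4
  have hρ0 : 0 ≤ ρ := (abs_nonneg a).trans ha
  have hK := hJ.K_pos
  have h5 : 2 * K * ρ * ‖w.1.1‖ ≤ 1 / 2 * ‖R.starProjection η‖ := by
    calc _ ≤ 2 * K * ρ * (2 / c * ‖R.starProjection η‖) := by gcongr
      _ = (4 * K * ρ / c) * ‖R.starProjection η‖ := by ring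
      _ ≤ _ := by
        refine mul_le_mul_of_nonneg_right ?_ (norm_nonneg _)
        rw [div_le_iff₀ hc]
        linarith
  have h6 : ‖R.starProjection η‖ ≤ 1 / 2 := by
    by_contra hcon
    push Not at hcon
    nlinarith
  have h7 := R.norm_sq_eq_add_norm_sq_starProjection η
  rw [h1] at h7
  nlinarith [norm_nonneg (R.starProjection η)]

theorem norm_starProjection_normal_le (h : IsBendingJet J a b a₁ b₁ κ σ L B) :
    ‖(LinearMap.range L.toLinearMap)ᗮ.starProjection (-b₁ • J.ν + a₁ • J.ξ)‖ ≤ 1 :=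
  (Submodule.norm_starProjection_apply_le _ _).trans h.norm_normal.le

theorem norm_normalForm_le (v w : (X × Y) × ℝ) : ‖normalForm L B v w‖ ≤ ‖B v w‖ :=
  Submodule.norm_starProjection_apply_le _ _

theorem normalForm_symm (h : IsBendingJet J a b a₁ b₁ κ σ L B) (v w : (X × Y) × ℝ) :
    normalForm L B v w = normalForm L B w v := by
  have h1 : B v w = B w v := by
    rw [h.B_apply, h.B_apply, J.φ₂_symm, J.ν₂_symm, J.ξ₂_symm, mul_comm v.2 w.2]
    abel
  rw [normalForm, h1, normalForm]

theorem normalForm_add_left (u v w : (X × Y) × ℝ) :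
    normalForm L B (u + v) w = normalForm L B u w + normalForm L B v w :=
  congrArg (fun A => A w) (map_add (normalFormLin L B) u v)

theorem normalForm_add_right (u v w : (X × Y) × ℝ) :
    normalForm L B u (v + w) = normalForm L B u v + normalForm L B u w :=
  map_add (normalFormLin L B u) v w

/-- Between two horizontal directions the second fundamental form is bounded independently of the
profile curve. -/
theorem norm_normalForm_hor_hor_le (h : IsBendingJet J a b a₁ b₁ κ σ L B)
    (hJ : J.IsBounded K c) (ha : |a| ≤ ρ) (hb : |b| ≤ ρ) (hρ : ρ ≤ 1) (x x' : X) :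
    ‖normalForm L B ((x, 0), 0) ((x', 0), 0)‖ ≤ 3 * K * ‖x‖ * ‖x'‖ := by
  refine (norm_normalForm_le _ _).trans ?_
  rw [h.B_apply]
  simp only [zero_smul, add_zero, zero_mul]
  have h1 : ‖J.φ₂ x x'‖ ≤ K * ‖x‖ * ‖x'‖ :=
    (J.φ₂.le_opNorm₂ x x').trans (by gcongr; exact hJ.φ₂_le)
  have h2 : ‖J.ν₂ (x, 0) (x', 0)‖ ≤ K * ‖x‖ * ‖x'‖ := by
    refine (J.ν₂.le_opNorm₂ _ _).trans ?_
    simp only [Prod.norm_mk, norm_zero, norm_nonneg, sup_of_le_left]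
    gcongr
    exact hJ.ν₂_le
  have h3 : ‖J.ξ₂ x x'‖ ≤ K * ‖x‖ * ‖x'‖ :=
    (J.ξ₂.le_opNorm₂ x x').trans (by gcongr; exact hJ.ξ₂_le)
  calc _ ≤ ‖J.φ₂ x x'‖ + |a| * ‖J.ν₂ (x, 0) (x', 0)‖ + |b| * ‖J.ξ₂ x x'‖ := by
        refine (norm_add₃_le).trans ?_
        simp [norm_smul]
    _ ≤ K * ‖x‖ * ‖x'‖ + 1 * (K * ‖x‖ * ‖x'‖) + 1 * (K * ‖x‖ * ‖x'‖) := by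
        gcongr
        · linarith
        · linarith
    _ = _ := by ring

theorem abs_le_one (h : IsBendingJet J a b a₁ b₁ κ σ L B) : |a₁| ≤ 1 ∧ |b₁| ≤ 1 := by
  have := h.unit_speed
  constructor <;> rw [← sq_le_one_iff_abs_le_one] <;> nlinarith [sq_nonneg a₁, sq_nonneg b₁]

theorem abs_mul_le (h : IsBendingJet J a b a₁ b₁ κ σ L B) (y : Y) (s : ℝ) :
    |a| * ‖J.ν₁ (0, y)‖ ≤ ‖L ((0, y), s)‖ ∧ |s| ≤ ‖L ((0, y), s)‖ := by
  have h1 := h.inner_ver y y s s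
  rw [real_inner_self_eq_norm_sq, real_inner_self_eq_norm_sq] at h1
  constructor
  · refine abs_le_of_sq_le_sq' ?_ (norm_nonneg _) |>.2
    rw [mul_pow, sq_abs]
    nlinarith [mul_self_nonneg s]
  · rw [← abs_of_nonneg (norm_nonneg (L ((0, y), s))), ← sq_le_sq]
    nlinarith [mul_nonneg (sq_nonneg a) (sq_nonneg ‖J.ν₁ (0, y)‖)]

/-- Between a horizontal direction and the block there is no term in `σ`: the factor `a` in front of
`ν₂` is compensated by the length of `L ((0, y), s)`, which is at least `c |a| ‖y‖`. -/
theorem norm_normalForm_hor_ver_le (h : IsBendingJet J a b a₁ b₁ κ σ L B)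
    (hJ : J.IsBounded K c) (x : X) (y : Y) (s : ℝ) :
    ‖normalForm L B ((x, 0), 0) ((0, y), s)‖ ≤
      (K / c + 2 * K) * ‖x‖ * ‖L ((0, y), s)‖ := by
  refine (norm_normalForm_le _ _).trans ?_
  have hc := hJ.c_pos
  have hK := hJ.K_pos
  rw [h.B_apply]
  simp only [map_zero, smul_zero, zero_smul, add_zero, zero_mul, zero_add]
  obtain ⟨h1, h2⟩ := h.abs_mul_le y s
  obtain ⟨h3, h4⟩ := h.abs_le_one
  have h5 : ‖J.ν₂ (x, 0) (0, y)‖ ≤ K * ‖x‖ * ‖y‖ := by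
    refine (J.ν₂.le_opNorm₂ _ _).trans ?_
    simp only [Prod.norm_mk, norm_zero, norm_nonneg, sup_of_le_left, sup_of_le_right]
    gcongr
    exact hJ.ν₂_le
  have h6 : ‖J.ν₁ (x, 0)‖ ≤ K * ‖x‖ := by
    have := J.ν₁.le_of_opNorm_le hJ.ν₁_le (x, 0)
    simpa [Prod.norm_def] using this
  have h7 : ‖J.ξ₁ x‖ ≤ K * ‖x‖ := J.ξ₁.le_of_opNorm_le hJ.ξ₁_le x
  have h8 : |a| * ‖y‖ ≤ ‖L ((0, y), s)‖ / c := by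
    rw [le_div_iff₀ hc]
    calc |a| * ‖y‖ * c = |a| * (c * ‖y‖) := by ring
      _ ≤ |a| * ‖J.ν₁ (0, y)‖ := by gcongr; exact hJ.le_ν₁ y
      _ ≤ _ := h1
  calc _ ≤ |a| * ‖J.ν₂ (x, 0) (0, y)‖ + |s| * (|a₁| * ‖J.ν₁ (x, 0)‖ + |b₁| * ‖J.ξ₁ x‖) := by
        refine (norm_add_le _ _).trans ?_
        rw [norm_smul, norm_smul, Real.norm_eq_abs, Real.norm_eq_abs]
        gcongr
        refine (norm_add_le _ _).trans ?_
        simp [norm_smul]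
    _ ≤ |a| * (K * ‖x‖ * ‖y‖) + ‖L ((0, y), s)‖ * (1 * (K * ‖x‖) + 1 * (K * ‖x‖)) := by
        gcongr
    _ = K * ‖x‖ * (|a| * ‖y‖) + 2 * K * ‖x‖ * ‖L ((0, y), s)‖ := by ring
    _ ≤ K * ‖x‖ * (‖L ((0, y), s)‖ / c) + 2 * K * ‖x‖ * ‖L ((0, y), s)‖ := by gcongr
    _ = _ := by ring

theorem norm_normalForm_ver_ver_le (h : IsBendingJet J a b a₁ b₁ κ σ L B) {q : ℝ} (hσ : 0 ≤ σ)
    (hq : 1 ≤ q) (hκ : |κ| ≤ q * σ) (y y' : Y) (s s' : ℝ) :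
    ‖normalForm L B ((0, y), s) ((0, y'), s')‖ ≤
      2 * q * σ * ‖L ((0, y), s)‖ * ‖L ((0, y'), s')‖ := by
  rw [h.normalForm_ver, norm_smul]
  obtain ⟨h1, h2⟩ := h.abs_mul_le y s
  obtain ⟨h3, h4⟩ := h.abs_mul_le y' s'
  have h5 := abs_real_inner_le_norm (J.ν₁ (0, y)) (J.ν₁ (0, y'))
  have hσq : σ ≤ q * σ := by nlinarith
  have h6 : |κ * (s * s') + σ * (a ^ 2 * ⟪J.ν₁ (0, y), J.ν₁ (0, y')⟫)| ≤
      2 * q * σ * ‖L ((0, y), s)‖ * ‖L ((0, y'), s')‖ := by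
    calc _ ≤ |κ| * (|s| * |s'|) + σ * (|a| ^ 2 * |⟪J.ν₁ (0, y), J.ν₁ (0, y')⟫|) := by
          refine (abs_add_le _ _).trans ?_
          simp only [abs_mul, abs_pow, abs_of_nonneg hσ, le_refl]
      _ ≤ |κ| * (|s| * |s'|) + σ * (|a| ^ 2 * (‖J.ν₁ (0, y)‖ * ‖J.ν₁ (0, y')‖)) := by gcongr
      _ = |κ| * (|s| * |s'|) + σ * ((|a| * ‖J.ν₁ (0, y)‖) * (|a| * ‖J.ν₁ (0, y')‖)) := by ring
      _ ≤ q * σ * (‖L ((0, y), s)‖ * ‖L ((0, y'), s')‖)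
          + q * σ * (‖L ((0, y), s)‖ * ‖L ((0, y'), s')‖) := by gcongr
      _ = _ := by ring
  calc _ ≤ 2 * q * σ * ‖L ((0, y), s)‖ * ‖L ((0, y'), s')‖ * 1 := by
        gcongr
        · exact h6
        · exact h.norm_starProjection_normal_le
    _ = _ := mul_one _

end IsBendingJet
end Jets
end Bending

/-! ### The curvature estimate at a point -/

namespace Bending

section TraceEstimate

variable {E : Type*} [NormedAddCommGroup E] [InnerProductSpace ℝ E]

/-- A lower bound for the contracted Gauss equation when the second fundamental form `h` is
`diag(κ, σ, …, σ) ζ` on a block and at most `t` elsewhere. -/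
theorem trace_estimate {m d : ℕ} {h : (Unit ⊕ Fin m) ⊕ Fin d → (Unit ⊕ Fin m) ⊕ Fin d → E}
    {ζ : E} {κ σ t : ℝ} (hσ : 0 ≤ σ) (hκσ : κ ≤ σ) (hκ : -((m - 1) / 4 * σ) ≤ κ) (hm : 1 ≤ m)
    (h00 : h (.inl (.inl ())) (.inl (.inl ())) = κ • ζ)
    (h0i : ∀ i, h (.inl (.inl ())) (.inl (.inr i)) = 0)
    (hi0 : ∀ i, h (.inl (.inr i)) (.inl (.inl ())) = 0)
    (hij : ∀ i j, h (.inl (.inr i)) (.inl (.inr j)) = (if i = j then σ else 0) • ζ)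
    (hbx : ∀ i x, ‖h (.inl i) (.inr x)‖ ≤ t) (hxb : ∀ x i, ‖h (.inr x) (.inl i)‖ ≤ t)
    (hxx : ∀ x y, ‖h (.inr x) (.inr y)‖ ≤ t) (hζ : 3 / 4 ≤ ‖ζ‖ ^ 2) (hζ1 : ‖ζ‖ ≤ 1) :
    3 / 8 * (m * (m - 1)) * σ ^ 2 - 2 * (m + 1) * d * (σ * t)
        - (2 * (m + 1) * d + d ^ 2) * t ^ 2 ≤
      ‖∑ a, h a a‖ ^ 2 - ∑ a, ∑ c, ‖h a c‖ ^ 2 := by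
  have hm1 : (1 : ℝ) ≤ m := by exact_mod_cast hm
  set R := ∑ x, h (.inr x) (.inr x) with hR
  have hRt : ‖R‖ ≤ d * t := by
    refine (norm_sum_le _ _).trans ((Finset.sum_le_sum fun x _ => hxx x x).trans ?_)
    simp
  have htr : ∑ a, h a a = (κ + m * σ) • ζ + R := by
    simp only [Fintype.sum_sum_type, Finset.univ_unique, Finset.sum_singleton, h00, hij]
    simp [add_smul, hR, ← Nat.cast_smul_eq_nsmul ℝ, smul_smul]
  have hsq : ∀ {v : E}, ‖v‖ ≤ t → ‖v‖ ^ 2 ≤ t ^ 2 := fun hv =>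
    pow_le_pow_left₀ (norm_nonneg _) hv 2
  have hblock : ∑ i : Unit ⊕ Fin m, ∑ j : Unit ⊕ Fin m, ‖h (.inl i) (.inl j)‖ ^ 2 =
      (κ ^ 2 + m * σ ^ 2) * ‖ζ‖ ^ 2 := by
    have e : ∀ i j : Fin m, ‖h (.inl (.inr i)) (.inl (.inr j))‖ ^ 2 =
        if i = j then σ ^ 2 * ‖ζ‖ ^ 2 else 0 := fun i j => by
      rw [hij]; split_ifs <;> simp [norm_smul, mul_pow]
    simp only [Fintype.sum_sum_type, Finset.univ_unique, Finset.sum_singleton, PUnit.default_eq_unit,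
      h00, h0i, hi0, e]
    simp [norm_smul, mul_pow]
    ring
  have hbx' : ∑ i : Unit ⊕ Fin m, ∑ x : Fin d, ‖h (.inl i) (.inr x)‖ ^ 2 ≤
      (m + 1) * d * t ^ 2 := by
    refine (Finset.sum_le_sum fun i _ => Finset.sum_le_sum fun x _ => hsq (hbx i x)).trans ?_
    simp
    apply le_of_eq; ring
  have hxb' : ∑ x : Fin d, ∑ i : Unit ⊕ Fin m, ‖h (.inr x) (.inl i)‖ ^ 2 ≤
      (m + 1) * d * t ^ 2 := by
    refine (Finset.sum_le_sum fun i _ => Finset.sum_le_sum fun x _ => hsq (hxb i x)).trans ?_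
    simp
    apply le_of_eq; ring
  have hxx' : ∑ x : Fin d, ∑ y : Fin d, ‖h (.inr x) (.inr y)‖ ^ 2 ≤ d ^ 2 * t ^ 2 := by
    refine (Finset.sum_le_sum fun i _ => Finset.sum_le_sum fun x _ => hsq (hxx i x)).trans ?_
    simp
    apply le_of_eq; ring
  have hall : ∑ a, ∑ c, ‖h a c‖ ^ 2 ≤
      (κ ^ 2 + m * σ ^ 2) * ‖ζ‖ ^ 2 + (2 * (m + 1) * d + d ^ 2) * t ^ 2 := by
    have e : ∑ a, ∑ c, ‖h a c‖ ^ 2 =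
        (∑ i : Unit ⊕ Fin m, ∑ j : Unit ⊕ Fin m, ‖h (.inl i) (.inl j)‖ ^ 2
          + ∑ i : Unit ⊕ Fin m, ∑ x : Fin d, ‖h (.inl i) (.inr x)‖ ^ 2)
        + (∑ x : Fin d, ∑ i : Unit ⊕ Fin m, ‖h (.inr x) (.inl i)‖ ^ 2
          + ∑ x : Fin d, ∑ y : Fin d, ‖h (.inr x) (.inr y)‖ ^ 2) := by
      rw [Fintype.sum_sum_type, ← Finset.sum_add_distrib, ← Finset.sum_add_distrib]
      congr 1 <;> exact Finset.sum_congr rfl fun a _ => Fintype.sum_sum_type _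
    rw [e, hblock]
    linarith
  have hs0 : 0 ≤ κ + m * σ := by nlinarith
  have hs1 : κ + m * σ ≤ (m + 1) * σ := by linarith
  have hcross : -((m + 1) * d * (σ * t)) ≤ ⟪(κ + m * σ) • ζ, R⟫ := by
    have h1 := neg_le_of_abs_le (abs_real_inner_le_norm ((κ + m * σ) • ζ) R)
    have h2 : ‖(κ + m * σ) • ζ‖ * ‖R‖ ≤ ((m + 1) * σ) * (d * t) := by
      refine mul_le_mul ?_ hRt (norm_nonneg _) (by positivity)
      rw [norm_smul, Real.norm_of_nonneg hs0]
      calc _ ≤ (κ + m * σ) * 1 := by gcongr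
        _ ≤ _ := by linarith
    nlinarith
  have htr2 : (κ + m * σ) ^ 2 * ‖ζ‖ ^ 2 - 2 * ((m + 1) * d * (σ * t)) ≤ ‖∑ a, h a a‖ ^ 2 := by
    rw [htr, norm_add_sq_real, norm_smul, mul_pow, Real.norm_eq_abs, sq_abs]
    nlinarith [sq_nonneg ‖R‖]
  -- The contribution of the block is `2 m κ σ + m (m - 1) σ²`; the lower bound for `κ` keeps half
  -- of the second term.
  have hmain : (m * (m - 1)) / 2 * σ ^ 2 ≤ 2 * m * κ * σ + m * (m - 1) * σ ^ 2 := by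
    have h1 : 0 ≤ (m : ℝ) * σ * (κ + (m - 1) / 4 * σ) :=
      mul_nonneg (by positivity) (by linarith)
    linarith
  have hmain0 : 0 ≤ (m * (m - 1)) / 2 * σ ^ 2 :=
    mul_nonneg (div_nonneg (mul_nonneg (by linarith) (by linarith)) zero_le_two) (sq_nonneg σ)
  have hmain2 : 3 / 8 * (m * (m - 1)) * σ ^ 2 ≤
      (2 * m * κ * σ + m * (m - 1) * σ ^ 2) * ‖ζ‖ ^ 2 := by
    have h1 := mul_le_mul hmain hζ (by norm_num) (hmain0.trans hmain)
    linarith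
  linarith

end TraceEstimate

namespace IsBendingJet

variable {X : Type*} [NormedAddCommGroup X] [NormedSpace ℝ X] [FiniteDimensional ℝ X]
  {Y : Type*} [NormedAddCommGroup Y] [NormedSpace ℝ Y] [FiniteDimensional ℝ Y]
  {E : Type*} [NormedAddCommGroup E] [InnerProductSpace ℝ E] [FiniteDimensional ℝ E]
  {J : NormalJet X Y E} {a b a₁ b₁ κ σ K c ρ : ℝ} {L : (X × Y) × ℝ →L[ℝ] E}
  {B : (X × Y) × ℝ →L[ℝ] (X × Y) × ℝ →L[ℝ] E}

/-- An orthonormal family of the block, consisting of the velocity of the profile curve and of an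
orthonormal family tangent to the unit normal sphere. -/
theorem exists_block (h : IsBendingJet J a b a₁ b₁ κ σ L B) (hJ : J.IsBounded K c) {m : ℕ}
    (hm : Module.finrank ℝ Y = m) :
    ∃ e : Fin m → Y, (∀ i j, a ^ 2 * ⟪J.ν₁ (0, e i), J.ν₁ (0, e j)⟫ = if i = j then 1 else 0) ∧
      Submodule.span ℝ (Set.range e) = ⊤ := by
  subst hm
  set Ω : Y →L[ℝ] E := a • J.ν₁.comp (ContinuousLinearMap.inr ℝ X Y) with hΩ
  have hΩ' : ∀ y, Ω y = a • J.ν₁ (0, y) := fun y => rfl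
  have hinj : Function.Injective Ω := by
    rw [injective_iff_map_eq_zero]
    intro y hy
    rw [hΩ', smul_eq_zero_iff_right h.a_ne_zero] at hy
    have h1 := hJ.le_ν₁ y
    rw [hy, norm_zero] at h1
    have h2 : ‖y‖ ≤ 0 := by
      by_contra hy
      nlinarith [hJ.c_pos]
    exact norm_le_zero_iff.1 h2
  obtain ⟨e, he⟩ := exists_orthonormal hinj
  refine ⟨e, fun i j => ?_, ?_⟩
  · rw [← orthonormal_iff_ite.1 he i j, hΩ', hΩ', real_inner_smul_left, real_inner_smul_right]
    ring
  · have hli : LinearIndependent ℝ e :=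
      LinearIndependent.of_comp Ω.toLinearMap he.linearIndependent
    exact hli.span_eq_top_of_card_eq_finrank' (by simp)

variable {w w' : (X × Y) × ℝ}

/-- The block component of a vector orthogonal to the block is small. -/
theorem norm_ver_le (h : IsBendingJet J a b a₁ b₁ κ σ L B) (hJ : J.IsBounded K c)
    (ha : |a| ≤ ρ) (hb : |b| ≤ ρ) (hw : ∀ y s, ⟪L w, L ((0, y), s)⟫ = 0) :
    ‖L ((0, w.1.2), w.2)‖ ≤ 2 * K * ρ * ‖w.1.1‖ := by
  have h1 := hw w.1.2 w.2
  rw [L_eq, inner_add_left, real_inner_self_eq_norm_sq] at h1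
  have h2 := neg_le_of_abs_le (h.abs_inner_hor_ver_le hJ ha hb w.1.1 w.1.2 w.2)
  have h3 : 0 ≤ 2 * K * ρ * ‖w.1.1‖ :=
    mul_nonneg (mul_nonneg (by linarith [hJ.K_pos]) ((abs_nonneg a).trans ha)) (norm_nonneg _)
  by_contra hcon
  push Not at hcon
  nlinarith

/-- A unit vector orthogonal to the block is horizontal up to an error of size `O(ρ)`, hence the
second fundamental form between it and the block is `O(1) + O(ρ σ)`. -/
theorem norm_normalForm_orth_ver_le (h : IsBendingJet J a b a₁ b₁ κ σ L B)
    (hJ : J.IsBounded K c) (ha : |a| ≤ ρ) (hb : |b| ≤ ρ) (hρ : 8 * K * ρ ≤ c)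
    {q : ℝ} (hσ : 0 ≤ σ) (hq : 1 ≤ q) (hκ : |κ| ≤ q * σ)
    (hw : ∀ y s, ⟪L w, L ((0, y), s)⟫ = 0) (hw1 : ‖L w‖ = 1) {y : Y} {s : ℝ}
    (hu : ‖L ((0, y), s)‖ = 1) :
    ‖normalForm L B w ((0, y), s)‖ ≤
      (K / c + 2 * K) * (2 / c) + 2 * q * σ * (4 * K * ρ / c) := by
  have hc := hJ.c_pos
  have hK := hJ.K_pos
  have hρ0 : 0 ≤ ρ := (abs_nonneg a).trans ha
  have h1 := h.norm_fst_le hJ ha hb hρ w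
  rw [hw1, mul_one] at h1
  have h2 : ‖L ((0, w.1.2), w.2)‖ ≤ 4 * K * ρ / c := by
    refine (h.norm_ver_le hJ ha hb hw).trans ?_
    calc _ ≤ 2 * K * ρ * (2 / c) := by gcongr
      _ = _ := by ring
  have e : w = ((w.1.1, 0), 0) + ((0, w.1.2), w.2) := by simp
  rw [e, normalForm_add_left]
  refine (norm_add_le _ _).trans (add_le_add ?_ ?_)
  · refine (h.norm_normalForm_hor_ver_le hJ _ _ _).trans ?_
    rw [hu, mul_one]
    gcongr
  · refine (h.norm_normalForm_ver_ver_le hσ hq hκ _ _ _ _).trans ?_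
    rw [hu, mul_one]
    gcongr

theorem norm_normalForm_orth_orth_le (h : IsBendingJet J a b a₁ b₁ κ σ L B)
    (hJ : J.IsBounded K c) (ha : |a| ≤ ρ) (hb : |b| ≤ ρ) (hρ : 8 * K * ρ ≤ c) (hρ1 : ρ ≤ 1)
    {q : ℝ} (hσ : 0 ≤ σ) (hq : 1 ≤ q) (hκ : |κ| ≤ q * σ)
    (hw : ∀ y s, ⟪L w, L ((0, y), s)⟫ = 0) (hw1 : ‖L w‖ = 1)
    (hw' : ∀ y s, ⟪L w', L ((0, y), s)⟫ = 0) (hw1' : ‖L w'‖ = 1) :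
    ‖normalForm L B w w'‖ ≤ 3 * K * (2 / c) * (2 / c)
      + 2 * ((K / c + 2 * K) * (2 / c) * (4 * K * ρ / c))
      + 2 * q * σ * (4 * K * ρ / c) * (4 * K * ρ / c) := by
  have hc := hJ.c_pos
  have hK := hJ.K_pos
  have hρ0 : 0 ≤ ρ := (abs_nonneg a).trans ha
  have hx : ∀ {w}, ‖L w‖ = 1 → ‖w.1.1‖ ≤ 2 / c := fun {w} hw1 => by
    have h1 := h.norm_fst_le hJ ha hb hρ w
    rwa [hw1, mul_one] at h1
  have hv : ∀ {w}, ‖L w‖ = 1 → (∀ y s, ⟪L w, L ((0, y), s)⟫ = 0) →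
      ‖L ((0, w.1.2), w.2)‖ ≤ 4 * K * ρ / c := fun {w} hw1 hw => by
    refine (h.norm_ver_le hJ ha hb hw).trans ?_
    calc _ ≤ 2 * K * ρ * (2 / c) := by gcongr; exact hx hw1
      _ = _ := by ring
  have e : ∀ w : (X × Y) × ℝ, w = ((w.1.1, 0), 0) + ((0, w.1.2), w.2) := fun w => by simp
  have h1 : ‖normalForm L B ((w.1.1, 0), 0) ((w'.1.1, 0), 0)‖ ≤ 3 * K * (2 / c) * (2 / c) := by
    refine (h.norm_normalForm_hor_hor_le hJ ha hb hρ1 _ _).trans ?_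
    gcongr
    exacts [hx hw1, hx hw1']
  have h2 : ‖normalForm L B ((w.1.1, 0), 0) ((0, w'.1.2), w'.2)‖ ≤
      (K / c + 2 * K) * (2 / c) * (4 * K * ρ / c) := by
    refine (h.norm_normalForm_hor_ver_le hJ _ _ _).trans ?_
    gcongr
    exacts [hx hw1, hv hw1' hw']
  have h3 : ‖normalForm L B ((0, w.1.2), w.2) ((w'.1.1, 0), 0)‖ ≤
      (K / c + 2 * K) * (2 / c) * (4 * K * ρ / c) := by
    rw [h.normalForm_symm]
    refine (h.norm_normalForm_hor_ver_le hJ _ _ _).trans ?_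
    gcongr
    exacts [hx hw1', hv hw1 hw]
  have h4 : ‖normalForm L B ((0, w.1.2), w.2) ((0, w'.1.2), w'.2)‖ ≤
      2 * q * σ * (4 * K * ρ / c) * (4 * K * ρ / c) := by
    refine (h.norm_normalForm_ver_ver_le hσ hq hκ _ _ _ _).trans ?_
    gcongr
    exacts [hv hw1 hw, hv hw1' hw']
  rw [e w, e w', normalForm_add_left, normalForm_add_right, normalForm_add_right]
  have h5 := norm_add_le (normalForm L B ((w.1.1, 0), 0) ((w'.1.1, 0), 0)
      + normalForm L B ((w.1.1, 0), 0) ((0, w'.1.2), w'.2))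
    (normalForm L B ((0, w.1.2), w.2) ((w'.1.1, 0), 0)
      + normalForm L B ((0, w.1.2), w.2) ((0, w'.1.2), w'.2))
  have h6 := norm_add_le (normalForm L B ((w.1.1, 0), 0) ((w'.1.1, 0), 0))
    (normalForm L B ((w.1.1, 0), 0) ((0, w'.1.2), w'.2))
  have h7 := norm_add_le (normalForm L B ((0, w.1.2), w.2) ((w'.1.1, 0), 0))
    (normalForm L B ((0, w.1.2), w.2) ((0, w'.1.2), w'.2))
  linarith

/-- The constant in the bounds for the second fundamental form off the block. -/
noncomputable def offBlockConst (K c : ℝ) (m : ℕ) : ℝ :=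
  3 * K * (2 / c) * (2 / c) + 2 * ((K / c + 2 * K) * (2 / c) * (4 * K / c))
    + (K / c + 2 * K) * (2 / c) + 2 * m * (4 * K / c) + 2 * m * (4 * K / c) * (4 * K / c)

theorem le_offBlockConst_orth_ver {m : ℕ} (hc : 0 < c) (hK : 0 < K) (hρ0 : 0 ≤ ρ) (hσ : 0 ≤ σ) :
    (K / c + 2 * K) * (2 / c) + 2 * m * σ * (4 * K * ρ / c) ≤
      offBlockConst K c m * (1 + ρ * σ) := by
  have e1 : 2 * m * σ * (4 * K * ρ / c) = 2 * m * (4 * K / c) * (ρ * σ) := by ring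
  have h1 : (K / c + 2 * K) * (2 / c) ≤ offBlockConst K c m := by
    rw [offBlockConst]
    have : 0 ≤ 3 * K * (2 / c) * (2 / c) + 2 * ((K / c + 2 * K) * (2 / c) * (4 * K / c))
      + 2 * m * (4 * K / c) + 2 * m * (4 * K / c) * (4 * K / c) := by positivity
    linarith
  have h2 : 2 * m * (4 * K / c) ≤ offBlockConst K c m := by
    rw [offBlockConst]
    have : 0 ≤ 3 * K * (2 / c) * (2 / c) + 2 * ((K / c + 2 * K) * (2 / c) * (4 * K / c))
      + (K / c + 2 * K) * (2 / c) + 2 * m * (4 * K / c) * (4 * K / c) := by positivity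
    linarith
  have h3 := mul_le_mul_of_nonneg_right h2 (mul_nonneg hρ0 hσ)
  rw [e1]
  linarith

theorem le_offBlockConst_orth_orth {m : ℕ} (hc : 0 < c) (hK : 0 < K) (hρ0 : 0 ≤ ρ)
    (hρ1 : ρ ≤ 1) (hσ : 0 ≤ σ) :
    3 * K * (2 / c) * (2 / c)
    + 2 * ((K / c + 2 * K) * (2 / c) * (4 * K * ρ / c))
    + 2 * m * σ * (4 * K * ρ / c) * (4 * K * ρ / c) ≤ offBlockConst K c m * (1 + ρ * σ) := by
  have e1 : 2 * m * σ * (4 * K * ρ / c) * (4 * K * ρ / c) =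
    2 * m * (4 * K / c) * (4 * K / c) * (ρ * (ρ * σ)) := by ring
  have e2 : 2 * ((K / c + 2 * K) * (2 / c) * (4 * K * ρ / c)) =
    2 * ((K / c + 2 * K) * (2 / c) * (4 * K / c)) * ρ := by ring
  have h0 : ρ * (ρ * σ) ≤ 1 * (ρ * σ) :=
    mul_le_mul_of_nonneg_right hρ1 (mul_nonneg hρ0 hσ)
  have h1 : 3 * K * (2 / c) * (2 / c) + 2 * ((K / c + 2 * K) * (2 / c) * (4 * K / c)) ≤
      offBlockConst K c m := by
    rw [offBlockConst]
    have : 0 ≤ (K / c + 2 * K) * (2 / c) + 2 * m * (4 * K / c)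
      + 2 * m * (4 * K / c) * (4 * K / c) := by positivity
    linarith
  have h2 : 2 * m * (4 * K / c) * (4 * K / c) ≤ offBlockConst K c m := by
    rw [offBlockConst]
    have : 0 ≤ 3 * K * (2 / c) * (2 / c) + 2 * ((K / c + 2 * K) * (2 / c) * (4 * K / c))
      + (K / c + 2 * K) * (2 / c) + 2 * m * (4 * K / c) := by positivity
    linarith
  have h3 : 2 * m * (4 * K / c) * (4 * K / c) * (ρ * (ρ * σ)) ≤
      offBlockConst K c m * (1 * (ρ * σ)) :=
    mul_le_mul h2 h0 (by positivity) (le_trans (by positivity) h2)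
  have h4 : 2 * ((K / c + 2 * K) * (2 / c) * (4 * K / c)) * ρ ≤
      2 * ((K / c + 2 * K) * (2 / c) * (4 * K / c)) * 1 :=
    mul_le_mul_of_nonneg_left hρ1 (by positivity)
  rw [e1, e2]
  linarith

/-- The curvature estimate at a point, before the errors are absorbed. -/
theorem le_gaussScal {ι : Type*} [Fintype ι] [DecidableEq ι]
    (bas : Module.Basis ι ℝ ((X × Y) × ℝ)) {m : ℕ} (hm : Module.finrank ℝ Y = m) (hm2 : 2 ≤ m)
    (h : IsBendingJet J a b a₁ b₁ κ σ L B) (hJ : J.IsBounded K c)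
    (ha : |a| ≤ ρ) (hb : |b| ≤ ρ) (hρ : 8 * K * ρ ≤ c) (hρ1 : ρ ≤ 1)
    (hκ : -((m - 1) / 4 * σ) ≤ κ) (hκσ : κ ≤ σ) (hσ : 0 ≤ σ) :
    3 / 8 * (m * (m - 1)) * σ ^ 2
        - 2 * (m + 1) * Module.finrank ℝ X * (σ * (offBlockConst K c m * (1 + ρ * σ)))
        - (2 * (m + 1) * Module.finrank ℝ X + (Module.finrank ℝ X : ℝ) ^ 2)
          * (offBlockConst K c m * (1 + ρ * σ)) ^ 2 ≤
      gaussScal bas L B := by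
  have hc := hJ.c_pos
  have hK := hJ.K_pos
  have hρ0 : 0 ≤ ρ := (abs_nonneg a).trans ha
  have hm2' : (2 : ℝ) ≤ m := by exact_mod_cast hm2
  have hq : |κ| ≤ m * σ := by
    rw [abs_le]
    constructor <;> nlinarith
  obtain ⟨e, he, hspan⟩ := h.exists_block hJ hm
  set u : Unit ⊕ Fin m → (X × Y) × ℝ := Sum.elim (fun _ => ((0, 0), 1)) fun i => ((0, e i), 0)
    with hu
  have hu1 : Orthonormal ℝ fun i => L (u i) := by
    rw [orthonormal_iff_ite]
    have h0 : J.ν₁ (0, 0) = 0 := map_zero _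
    rintro (i | i) (j | j) <;>
      simp only [hu, Sum.elim_inl, Sum.elim_inr, h.inner_ver, he, h0, inner_zero_left,
        inner_zero_right] <;> simp
  have hinj := h.injective hJ ha hb hρ
  obtain ⟨d, x, hd, hx⟩ := exists_orthonormal_extension hinj hu1
  have hd' : d = Module.finrank ℝ X := by
    simp only [Fintype.card_sum, Fintype.card_unit, Fintype.card_fin, Module.finrank_prod,
      Module.finrank_self] at hd
    omega
  subst hd'
  have hxorth : ∀ i y s, ⟪L (x i), L ((0, y), s)⟫ = 0 := fun i y s => by
    have h0 : ∀ j, ⟪L (x i), L (u j)⟫ = 0 := fun j => by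
      simpa using orthonormal_iff_ite.1 hx (Sum.inr i) (Sum.inl j)
    have h1 : ∀ y : Y, ⟪L (x i), L ((0, y), 0)⟫ = 0 := fun y => by
      have hy : y ∈ Submodule.span ℝ (Set.range e) := hspan ▸ Submodule.mem_top
      induction hy using Submodule.span_induction with
      | zero =>
        have e2 : (((0 : X), (0 : Y)), (0 : ℝ)) = 0 := rfl
        rw [e2, map_zero, inner_zero_right]
      | mem y hy => obtain ⟨j, rfl⟩ := hy; exact h0 (Sum.inr j)
      | add y y' _ _ h1 h2 =>
        have e2 : (((0 : X), y + y'), (0 : ℝ)) = ((0, y), 0) + ((0, y'), 0) := by simp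
        rw [e2, map_add, inner_add_right, h1, h2, add_zero]
      | smul r y _ h1 =>
        have e2 : (((0 : X), r • y), (0 : ℝ)) = r • ((0, y), 0) := by simp
        rw [e2, map_smul, inner_smul_right, h1, mul_zero]
    have e3 : (((0 : X), y), s) = ((0, y), 0) + s • ((0, 0), 1) := by simp
    rw [e3, map_add, map_smul, inner_add_right, inner_smul_right, h1]
    have := h0 (Sum.inl ())
    simp only [hu, Sum.elim_inl] at this
    rw [this]; simp
  have hx1 : ∀ i, ‖L (x i)‖ = 1 := fun i => hx.1 (Sum.inr i)
  have hT1 := le_offBlockConst_orth_ver (m := m) hc hK hρ0 hσ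
  have hT2 := le_offBlockConst_orth_orth (m := m) hc hK hρ0 hρ1 hσ
  have hbound : ∀ i j, ‖normalForm L B (x i) (u j)‖ ≤ offBlockConst K c m * (1 + ρ * σ) := by
    rintro i (j | j)
    · exact (h.norm_normalForm_orth_ver_le hJ ha hb hρ hσ (by linarith) hq (hxorth i) (hx1 i)
        (hu1.1 (Sum.inl j))).trans hT1
    · exact (h.norm_normalForm_orth_ver_le hJ ha hb hρ hσ (by linarith) hq (hxorth i) (hx1 i)
        (hu1.1 (Sum.inr j))).trans hT1
  rw [gaussScal_eq_sum bas B hx (by simpa using hd)]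
  have h00 : J.ν₁ (0, 0) = 0 := map_zero _
  refine trace_estimate (h := fun i j => normalForm L B (Sum.elim u x i) (Sum.elim u x j))
    (ζ := (LinearMap.range L.toLinearMap)ᗮ.starProjection (-b₁ • J.ν + a₁ • J.ξ)) hσ hκσ hκ
    (by omega) ?_ ?_ ?_ ?_ ?_ ?_ ?_ (h.norm_starProjection_normal_sq hJ ha hb hρ)
    h.norm_starProjection_normal_le
  · simp [hu, h.normalForm_ver, h00]
  · intro i
    simp [hu, h.normalForm_ver, h00]
  · intro i
    simp [hu, h.normalForm_ver, h00]
  · intro i j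
    simp [hu, h.normalForm_ver, he]
  · intro i j
    rw [h.normalForm_symm]
    exact hbound j i
  · exact hbound
  · exact fun i j => (h.norm_normalForm_orth_orth_le hJ ha hb hρ hρ1 hσ (by linarith) hq
      (hxorth i) (hx1 i) (hxorth j) (hx1 j)).trans hT2

end IsBendingJet

/-- The curvature estimate at a point: the errors that are quadratic in `σ` are absorbed by taking
the extent small. -/
theorem exists_const_le_gaussScal {X : Type*} [NormedAddCommGroup X] [NormedSpace ℝ X]
    [FiniteDimensional ℝ X] {Y : Type*} [NormedAddCommGroup Y] [NormedSpace ℝ Y]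
    [FiniteDimensional ℝ Y] {E : Type*} [NormedAddCommGroup E] [InnerProductSpace ℝ E]
    [FiniteDimensional ℝ E] {ι : Type*} [Fintype ι] [DecidableEq ι]
    (bas : Module.Basis ι ℝ ((X × Y) × ℝ)) {m : ℕ} (hm : Module.finrank ℝ Y = m) (hm2 : 2 ≤ m)
    {K c : ℝ} (hK : 0 < K) (hc : 0 < c) :
    ∃ C ρ : ℝ, 0 ≤ C ∧ 0 < ρ ∧ ∀ (J : NormalJet X Y E), J.IsBounded K c →
      ∀ (a b a₁ b₁ κ σ : ℝ) (L : (X × Y) × ℝ →L[ℝ] E)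
        (B : (X × Y) × ℝ →L[ℝ] (X × Y) × ℝ →L[ℝ] E), IsBendingJet J a b a₁ b₁ κ σ L B →
      |a| ≤ ρ → |b| ≤ ρ → -((m - 1) / 4 * σ) ≤ κ → κ ≤ σ → 0 ≤ σ →
      Function.Injective L ∧
        m * (m - 1) / 16 * σ ^ 2 - C * σ - C ≤ gaussScal bas L B := by
  have hm2' : (2 : ℝ) ≤ m := by exact_mod_cast hm2
  set T := IsBendingJet.offBlockConst K c m with hT
  have hT0 : 0 ≤ T := by rw [hT, IsBendingJet.offBlockConst]; positivity
  set A : ℝ := 2 * (m + 1) * Module.finrank ℝ X with hA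
  set D : ℝ := 2 * (m + 1) * Module.finrank ℝ X + (Module.finrank ℝ X : ℝ) ^ 2 with hD
  have hA0 : 0 ≤ A := by positivity
  have hD0 : 0 ≤ D := by positivity
  set C := A * T + 2 * D * T ^ 2 with hC
  have hC0 : 0 ≤ C := by positivity
  set ρ := min 1 (min (c / (8 * K)) (1 / (2 * (C + 1)))) with hρdef
  have hρ0 : 0 < ρ := by positivity
  have hρ1 : ρ ≤ 1 := min_le_left _ _
  have hρ2 : 8 * K * ρ ≤ c := by
    have h1 : ρ ≤ c / (8 * K) := (min_le_right _ _).trans (min_le_left _ _)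
    rw [le_div_iff₀ (by positivity)] at h1
    linarith
  have hρ3 : C * ρ ≤ 1 / 2 := by
    have h1 : ρ ≤ 1 / (2 * (C + 1)) := (min_le_right _ _).trans (min_le_right _ _)
    rw [le_div_iff₀ (by positivity)] at h1
    linarith
  refine ⟨C, ρ, hC0, hρ0, fun J hJ a b a₁ b₁ κ σ L B h ha hb hκ hκσ hσ =>
    ⟨h.injective hJ ha hb hρ2, ?_⟩⟩
  refine le_trans ?_ (h.le_gaussScal bas hm hm2 hJ ha hb hρ2 hρ1 hκ hκσ hσ)
  have hMM : (2 : ℝ) ≤ m * (m - 1) := by nlinarith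
  have h1 : (T * (1 + ρ * σ)) ^ 2 ≤ 2 * T ^ 2 + 2 * T ^ 2 * (ρ * σ ^ 2) := by
    have e1 : ρ * ρ ≤ ρ := by nlinarith
    have e2 : T ^ 2 * ((ρ * ρ) * σ ^ 2) ≤ T ^ 2 * (ρ * σ ^ 2) := by gcongr
    nlinarith [mul_nonneg (sq_nonneg T) (sq_nonneg (1 - ρ * σ))]
  have h2 : D * (T * (1 + ρ * σ)) ^ 2 ≤ D * (2 * T ^ 2 + 2 * T ^ 2 * (ρ * σ ^ 2)) := by gcongr
  have h3 : C * ρ * σ ^ 2 ≤ 1 / 2 * σ ^ 2 := by gcongr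
  have h4 : 2 * σ ^ 2 ≤ m * (m - 1) * σ ^ 2 := by gcongr
  have h5 : A * (σ * (T * (1 + ρ * σ))) = A * T * σ + A * T * ρ * σ ^ 2 := by ring
  have h6 : C * ρ * σ ^ 2 = A * T * ρ * σ ^ 2 + 2 * D * T ^ 2 * ρ * σ ^ 2 := by rw [hC]; ring
  have h7 : 0 ≤ D * T ^ 2 * σ := by positivity
  have h8 : 0 ≤ A * T := by positivity
  have h9 : C * σ = A * T * σ + 2 * D * T ^ 2 * σ := by rw [hC]; ring
  change _ ≤ 3 / 8 * (m * (m - 1)) * σ ^ 2 - A * (σ * (T * (1 + ρ * σ)))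
    - D * (T * (1 + ρ * σ)) ^ 2
  rw [h5]
  linarith [sq_nonneg σ]

end Bending

/-! ### The jet of a bending in a chart of the unit normal bundle -/

namespace Bending

section Derivatives

variable {X : Type*} [NormedAddCommGroup X] [NormedSpace ℝ X] [FiniteDimensional ℝ X]
  {Y : Type*} [NormedAddCommGroup Y] [NormedSpace ℝ Y] [FiniteDimensional ℝ Y]
  {E : Type*} [NormedAddCommGroup E] [InnerProductSpace ℝ E] [FiniteDimensional ℝ E]
  {φ ξ : X → E} {ν : X × Y → E} {a b : ℝ → ℝ} {w : (X × Y) × ℝ}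

theorem hasFDerivAt_fderiv_apply {V F : Type*} [NormedAddCommGroup V] [NormedSpace ℝ V]
    [NormedAddCommGroup F] [NormedSpace ℝ F] {g : V → F} {x : V} (hg : ContDiffAt ℝ ∞ g x)
    (u : V) :
    HasFDerivAt (fun y => fderiv ℝ g y u) ((fderiv ℝ (fderiv ℝ g) x).flip u) x := by
  have h := ((hg.fderiv_right (m := ∞) (by simp)).differentiableAt (by simp)).hasFDerivAt
  refine (h.clm_apply (hasFDerivAt_const u x)).congr_fderiv ?_
  ext v
  simp

theorem eventually_differentiableAt {V F : Type*} [NormedAddCommGroup V] [NormedSpace ℝ V]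
    [NormedAddCommGroup F] [NormedSpace ℝ F] {g : V → F} {x : V} (hg : ContDiffAt ℝ ∞ g x) :
    ∀ᶠ y in 𝓝 x, DifferentiableAt ℝ g y := by
  filter_upwards [(hg.of_le (m := 1) ENat.LEInfty.out).eventually (by simp)] with y hy
  exact hy.differentiableAt (by simp)

theorem hasFDerivAt_bending (hφ : DifferentiableAt ℝ φ w.1.1) (hν : DifferentiableAt ℝ ν w.1)
    (hξ : DifferentiableAt ℝ ξ w.1.1) (ha : DifferentiableAt ℝ a w.2)
    (hb : DifferentiableAt ℝ b w.2) :
    HasFDerivAt (fun w : (X × Y) × ℝ => φ w.1.1 + a w.2 • ν w.1 + b w.2 • ξ w.1.1)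
      ((fderiv ℝ φ w.1.1 + b w.2 • fderiv ℝ ξ w.1.1).comp
          ((ContinuousLinearMap.fst ℝ X Y).comp (ContinuousLinearMap.fst ℝ (X × Y) ℝ))
        + (a w.2 • fderiv ℝ ν w.1).comp (ContinuousLinearMap.fst ℝ (X × Y) ℝ)
        + (ContinuousLinearMap.snd ℝ (X × Y) ℝ).smulRight
          (deriv a w.2 • ν w.1 + deriv b w.2 • ξ w.1.1)) w := by
  have h1 : HasFDerivAt (fun w : (X × Y) × ℝ => w.1.1)
      ((ContinuousLinearMap.fst ℝ X Y).comp (ContinuousLinearMap.fst ℝ (X × Y) ℝ)) w :=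
    ((ContinuousLinearMap.fst ℝ X Y).comp (ContinuousLinearMap.fst ℝ (X × Y) ℝ)).hasFDerivAt
  have h2 : HasFDerivAt (fun w : (X × Y) × ℝ => w.1) (ContinuousLinearMap.fst ℝ (X × Y) ℝ) w :=
    hasFDerivAt_fst
  have h3 : HasFDerivAt (fun w : (X × Y) × ℝ => w.2) (ContinuousLinearMap.snd ℝ (X × Y) ℝ) w :=
    hasFDerivAt_snd
  have hφ' := hφ.hasFDerivAt.comp w h1
  have hν' := hν.hasFDerivAt.comp w h2
  have hξ' := hξ.hasFDerivAt.comp w h1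
  have ha' := ha.hasDerivAt.hasFDerivAt.comp w h3
  have hb' := hb.hasDerivAt.hasFDerivAt.comp w h3
  refine ((hφ'.add (ha'.smul hν')).add (hb'.smul hξ')).congr_fderiv ?_
  ext v <;> simp
  module

theorem fderiv_bending (hφ : DifferentiableAt ℝ φ w.1.1) (hν : DifferentiableAt ℝ ν w.1)
    (hξ : DifferentiableAt ℝ ξ w.1.1) (ha : DifferentiableAt ℝ a w.2)
    (hb : DifferentiableAt ℝ b w.2) (v : (X × Y) × ℝ) :
    fderiv ℝ (fun w : (X × Y) × ℝ => φ w.1.1 + a w.2 • ν w.1 + b w.2 • ξ w.1.1) w v =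
      fderiv ℝ φ w.1.1 v.1.1 + a w.2 • fderiv ℝ ν w.1 v.1 + b w.2 • fderiv ℝ ξ w.1.1 v.1.1
        + v.2 • (deriv a w.2 • ν w.1 + deriv b w.2 • ξ w.1.1) := by
  rw [(hasFDerivAt_bending hφ hν hξ ha hb).fderiv]
  simp
  abel

theorem fderiv_fderiv_bending (hφ : ContDiffAt ℝ ∞ φ w.1.1) (hν : ContDiffAt ℝ ∞ ν w.1)
    (hξ : ContDiffAt ℝ ∞ ξ w.1.1) (ha : ContDiffAt ℝ ∞ a w.2) (hb : ContDiffAt ℝ ∞ b w.2)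
    (v v' : (X × Y) × ℝ) :
    fderiv ℝ (fderiv ℝ fun w : (X × Y) × ℝ => φ w.1.1 + a w.2 • ν w.1 + b w.2 • ξ w.1.1) w v v' =
      fderiv ℝ (fderiv ℝ φ) w.1.1 v.1.1 v'.1.1 + a w.2 • fderiv ℝ (fderiv ℝ ν) w.1 v.1 v'.1
        + b w.2 • fderiv ℝ (fderiv ℝ ξ) w.1.1 v.1.1 v'.1.1
        + v.2 • (deriv a w.2 • fderiv ℝ ν w.1 v'.1 + deriv b w.2 • fderiv ℝ ξ w.1.1 v'.1.1)
        + v'.2 • (deriv a w.2 • fderiv ℝ ν w.1 v.1 + deriv b w.2 • fderiv ℝ ξ w.1.1 v.1.1)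
        + (v.2 * v'.2) • (deriv (deriv a) w.2 • ν w.1 + deriv (deriv b) w.2 • ξ w.1.1) := by
  set G : (X × Y) × ℝ → E := fun w => φ w.1.1 + a w.2 • ν w.1 + b w.2 • ξ w.1.1 with hG
  have c1 : Filter.Tendsto (fun w : (X × Y) × ℝ => w.1.1) (𝓝 w) (𝓝 w.1.1) :=
    (continuous_fst.fst).continuousAt
  have c2 : Filter.Tendsto (fun w : (X × Y) × ℝ => w.1) (𝓝 w) (𝓝 w.1) :=
    continuous_fst.continuousAt
  have c3 : Filter.Tendsto (fun w : (X × Y) × ℝ => w.2) (𝓝 w) (𝓝 w.2) :=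
    continuous_snd.continuousAt
  -- The first derivative, evaluated at a fixed vector, is a sum of two expressions of the form
  -- that has just been differentiated.
  have hev : (fun w => fderiv ℝ G w v') =ᶠ[𝓝 w] fun w =>
      (fderiv ℝ φ w.1.1 v'.1.1 + a w.2 • fderiv ℝ ν w.1 v'.1 + b w.2 • fderiv ℝ ξ w.1.1 v'.1.1)
        + v'.2 • (0 + deriv a w.2 • ν w.1 + deriv b w.2 • ξ w.1.1) := by
    filter_upwards [c1.eventually (eventually_differentiableAt hφ),
      c2.eventually (eventually_differentiableAt hν),
      c1.eventually (eventually_differentiableAt hξ),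
      c3.eventually (eventually_differentiableAt ha),
      c3.eventually (eventually_differentiableAt hb)] with w h1 h2 h3 h4 h5
    rw [fderiv_bending h1 h2 h3 h4 h5, zero_add]
  have hGd : ContDiffAt ℝ ∞ G w := by
    refine (ContDiffAt.add ?_ (ContDiffAt.smul ?_ ?_)).add (ContDiffAt.smul ?_ ?_)
    · exact hφ.comp w (contDiff_fst.fst).contDiffAt
    · exact ha.comp w contDiff_snd.contDiffAt
    · exact hν.comp w contDiff_fst.contDiffAt
    · exact hb.comp w contDiff_snd.contDiffAt
    · exact hξ.comp w (contDiff_fst.fst).contDiffAt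
  have hφd := hasFDerivAt_fderiv_apply hφ v'.1.1
  have hνd := hasFDerivAt_fderiv_apply hν v'.1
  have hξd := hasFDerivAt_fderiv_apply hξ v'.1.1
  have had := (hasFDerivAt_fderiv_apply ha 1).differentiableAt
  have hbd := (hasFDerivAt_fderiv_apply hb 1).differentiableAt
  simp only [fderiv_apply_one_eq_deriv] at had hbd
  have h1 := hasFDerivAt_bending hφd.differentiableAt hνd.differentiableAt hξd.differentiableAt
    (ha.differentiableAt (by simp)) (hb.differentiableAt (by simp))
  have h2 := hasFDerivAt_bending (φ := fun _ => (0 : E)) (differentiableAt_const _)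
    (hν.differentiableAt (by simp)) (hξ.differentiableAt (by simp)) had hbd
  have h3 := ((h1.add (h2.const_smul v'.2)).congr_of_eventuallyEq hev).unique
    (hasFDerivAt_fderiv_apply hGd v')
  have h4 := DFunLike.congr_fun h3 v
  rw [ContinuousLinearMap.flip_apply] at h4
  rw [← h4]
  simp [hφd.fderiv, hνd.fderiv, hξd.fderiv]
  module

theorem fderiv_mem_of_eventually_mem {V : Type*} [NormedAddCommGroup V] [NormedSpace ℝ V]
    {g : V → E} {x : V} {U : Submodule ℝ E} (hg : DifferentiableAt ℝ g x)
    (h : ∀ᶠ y in 𝓝 x, g y ∈ U) (v : V) : fderiv ℝ g x v ∈ U := by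
  have h1 : (fun y => U.starProjection (g y)) =ᶠ[𝓝 x] g := by
    filter_upwards [h] with y hy using Submodule.starProjection_eq_self_iff.2 hy
  have h2 := (U.starProjection.hasFDerivAt.comp x hg.hasFDerivAt).congr_of_eventuallyEq h1.symm
  rw [h2.fderiv]
  exact U.starProjection_apply_mem _

/-- A family of linear maps that is continuous at a point where it is injective is bounded below
near that point, uniformly. -/
theorem eventually_bounded_below {V W : Type*} [TopologicalSpace V] [NormedAddCommGroup W]
    [NormedSpace ℝ W] [FiniteDimensional ℝ W] {A : V → W →L[ℝ] E} {x : V}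
    (hA : ContinuousAt A x) (hinj : Function.Injective (A x)) :
    ∃ c > 0, ∀ᶠ y in 𝓝 x, ∀ w, c * ‖w‖ ≤ ‖A y w‖ := by
  obtain ⟨K, hK, hanti⟩ := (A x).toLinearMap.exists_antilipschitzWith
    (LinearMap.ker_eq_bot.2 hinj)
  have hK' : (0 : ℝ) < K := hK
  refine ⟨1 / (2 * K), by positivity, ?_⟩
  have h1 : ∀ᶠ y in 𝓝 x, ‖A y - A x‖ < 1 / (2 * K) := by
    have h2 : ContinuousAt (fun y => ‖A y - A x‖) x := (hA.sub continuousAt_const).norm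
    exact h2.eventually_lt_const (by simpa using hK')
  filter_upwards [h1] with y hy w
  have h2 : ‖w‖ ≤ K * ‖A x w‖ := by simpa using hanti.le_mul_norm_sub w 0
  have h3 : ‖(A y - A x) w‖ ≤ 1 / (2 * K) * ‖w‖ := (A y - A x).le_of_opNorm_le hy.le w
  have h4 : ‖A x w‖ ≤ ‖A y w‖ + ‖(A y - A x) w‖ := by
    have := norm_sub_le (A y w) ((A y - A x) w)
    simpa using this
  have h5 : 1 / K * ‖w‖ ≤ ‖A x w‖ := by
    rw [div_mul_eq_mul_div, div_le_iff₀ hK']; linarith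
  have h6 : 1 / K * ‖w‖ = 2 * (1 / (2 * K) * ‖w‖) := by field_simp
  linarith

end Derivatives

section BendingJet

variable {n d : ℕ}
  {M : Type*} [TopologicalSpace M] [ChartedSpace (EuclideanSpace ℝ (Fin n)) M]
  {S : Type*} [TopologicalSpace S] [ChartedSpace (EuclideanSpace ℝ (Fin d)) S]
  {E : Type*} [NormedAddCommGroup E] [InnerProductSpace ℝ E] [FiniteDimensional ℝ E]
  {f : Immersion (𝓡 n) 𝓘(ℝ, E) M E} {ι : Embedding (𝓡 d) (𝓡 n) S M}

namespace UnitNormal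

/-- The submanifold, in the chart at the foot point of `p`. -/
noncomputable def footLoc (p : UnitNormal f ι) : EuclideanSpace ℝ (Fin d) → E :=
  localRep (𝓡 d) (f.toFun ∘ ι.toFun) p.base

/-- The unit normal vector, in the chart of the unit normal bundle at `p`. -/
noncomputable def vecLoc (p : UnitNormal f ι)
    (z : EuclideanSpace ℝ (Fin d) × EuclideanSpace ℝ (Fin (n - d - 1))) : E :=
  (p.chartInv z).vec

/-- The field `ξ` along the submanifold, in the chart at the foot point of `p`. -/
noncomputable def xiLoc (p : UnitNormal f ι) (x : EuclideanSpace ℝ (Fin d)) : E :=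
  xi (𝓡 n) f.toFun (ι.toFun ((extChartAt (𝓡 d) p.base).symm x))

variable (p : UnitNormal f ι)
  {z : EuclideanSpace ℝ (Fin d) × EuclideanSpace ℝ (Fin (n - d - 1))}

theorem norm_vecLoc (z) : ‖p.vecLoc z‖ = 1 := (p.chartInv z).norm_vec

variable [IsManifold (𝓡 n) ∞ M] [IsManifold (𝓡 d) ∞ S]

theorem vecLoc_mem (hz : z ∈ p.chartTarget) :
    p.vecLoc z ∈ normalSpace f ι ((extChartAt (𝓡 d) p.base).symm z.1) := by
  rw [← p.base_chartInv hz.2]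
  exact (p.chartInv z).vec_mem

theorem inner_vec_vecLoc_pos (hz : z ∈ p.chartTarget) : 0 < ⟪p.vec, p.vecLoc z⟫ := by
  rw [vecLoc, p.vec_chartInv hz.2, inner_smul_right, p.inner_vec_lift hz.2, mul_one]
  exact inv_pos.2 (p.norm_lift_pos hz.2 _)

theorem chartTarget_mem_nhds (hz : z ∈ p.chartTarget) : p.chartTarget ∈ 𝓝 z :=
  p.isOpen_chartTarget.mem_nhds hz

theorem slice_mem_chartTarget (hz : z ∈ p.chartTarget) (y) :
    (z.1, y) ∈ p.chartTarget := hz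

theorem contDiffAt_footLoc (hz : z ∈ p.chartTarget) : ContDiffAt ℝ ∞ p.footLoc z.1 :=
  contMDiffAt_iff_contDiffAt.1 (((f.restrict ι).contMDiff.comp_contMDiffOn
    (contMDiffOn_extChartAt_symm (I := 𝓡 d) (n := ∞) p.base)).contMDiffAt
      ((isOpen_extChartAt_target (I := 𝓡 d) p.base).mem_nhds hz.1))

theorem contDiffAt_vecLoc (hz : z ∈ p.chartTarget) : ContDiffAt ℝ ∞ p.vecLoc z :=
  p.contDiffOn_vec_chartInv.contDiffAt (p.chartTarget_mem_nhds hz)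

theorem contDiffAt_xiLoc (hpos : ∀ p, 0 < scalarCurvature (𝓡 n) f.toFun p)
    (hz : z ∈ p.chartTarget) : ContDiffAt ℝ ∞ p.xiLoc z.1 :=
  contMDiffAt_iff_contDiffAt.1 (((contMDiff_xi hpos).comp ι.contMDiff).comp_contMDiffOn
    (contMDiffOn_extChartAt_symm (I := 𝓡 d) (n := ∞) p.base) |>.contMDiffAt
      ((isOpen_extChartAt_target (I := 𝓡 d) p.base).mem_nhds hz.1))

theorem fderiv_footLoc_mem (hz : z ∈ p.chartTarget) (x) :
    fderiv ℝ p.footLoc z.1 x ∈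
      tangentImage (𝓡 d) (f.toFun ∘ ι.toFun) ((extChartAt (𝓡 d) p.base).symm z.1) := by
  have h := (tangentImage_eq (f.restrict ι) p.base hz.1).1
  change tangentImage (𝓡 d) (f.toFun ∘ ι.toFun) _ = _ at h
  rw [h]
  exact ⟨x, rfl⟩

theorem injective_fderiv_footLoc (hz : z ∈ p.chartTarget) :
    Function.Injective (fderiv ℝ p.footLoc z.1) :=
  (tangentImage_eq (f.restrict ι) p.base hz.1).2

theorem fderiv_vecLoc_slice (hz : z ∈ p.chartTarget) (y y') :
    fderiv ℝ (fun y => p.vecLoc (z.1, y)) y y' = fderiv ℝ p.vecLoc (z.1, y) (0, y') := by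
  have h1 : HasFDerivAt (fun y : EuclideanSpace ℝ (Fin (n - d - 1)) => (z.1, y))
      (ContinuousLinearMap.inr ℝ (EuclideanSpace ℝ (Fin d)) _) y := hasFDerivAt_prodMk_right z.1 y
  have h2 := (((p.contDiffAt_vecLoc (p.slice_mem_chartTarget hz y)).differentiableAt
    (by simp)).hasFDerivAt).comp y h1
  refine (DFunLike.congr_fun h2.fderiv y').trans ?_
  simp

theorem fderiv_vecLoc_mem (hz : z ∈ p.chartTarget) (y') :
    fderiv ℝ p.vecLoc z (0, y') ∈
      normalSpace f ι ((extChartAt (𝓡 d) p.base).symm z.1) := by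
  have h0 : HasFDerivAt p.vecLoc (fderiv ℝ p.vecLoc z) (z.1, z.2) :=
    ((p.contDiffAt_vecLoc hz).differentiableAt (by simp)).hasFDerivAt
  have h1 : DifferentiableAt ℝ (fun y => p.vecLoc (z.1, y)) z.2 :=
    (h0.comp z.2 (hasFDerivAt_prodMk_right z.1 z.2)).differentiableAt
  rw [← Prod.mk.eta (p := z), ← p.fderiv_vecLoc_slice hz]
  exact fderiv_mem_of_eventually_mem h1 (Filter.Eventually.of_forall fun y =>
    p.vecLoc_mem (p.slice_mem_chartTarget hz y)) y'

theorem hasFDerivAt_fderiv_vecLoc (hz : z ∈ p.chartTarget) :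
    HasFDerivAt (fderiv ℝ p.vecLoc) (fderiv ℝ (fderiv ℝ p.vecLoc) z) z :=
  (((p.contDiffAt_vecLoc hz).fderiv_right (m := ∞) (by simp)).differentiableAt
    (by simp)).hasFDerivAt

theorem fderiv_fderiv_vecLoc_mem (hz : z ∈ p.chartTarget) (y y') :
    fderiv ℝ (fderiv ℝ p.vecLoc) z (0, y) (0, y') ∈
      normalSpace f ι ((extChartAt (𝓡 d) p.base).symm z.1) := by
  have h0 : HasFDerivAt (fderiv ℝ p.vecLoc) (fderiv ℝ (fderiv ℝ p.vecLoc) z) (z.1, z.2) :=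
    p.hasFDerivAt_fderiv_vecLoc hz
  have h1 := (h0.comp z.2 (hasFDerivAt_prodMk_right z.1 z.2)).clm_apply
    (hasFDerivAt_const ((0 : EuclideanSpace ℝ (Fin d)), y') z.2)
  have h2 := fderiv_mem_of_eventually_mem
    (U := normalSpace f ι ((extChartAt (𝓡 d) p.base).symm z.1)) h1.differentiableAt
    (Filter.Eventually.of_forall fun y =>
      p.fderiv_vecLoc_mem (p.slice_mem_chartTarget hz y) y') y
  rw [h1.fderiv] at h2
  simpa using h2

theorem inner_vecLoc_fderiv (hz : z ∈ p.chartTarget) (v) :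
    ⟪p.vecLoc z, fderiv ℝ p.vecLoc z v⟫ = 0 := by
  have h1 := ((p.contDiffAt_vecLoc hz).differentiableAt (by simp)).hasFDerivAt
  have h2 := h1.inner ℝ h1
  have h3 : (fun z => ⟪p.vecLoc z, p.vecLoc z⟫) = fun _ => (1 : ℝ) := by
    funext z
    rw [real_inner_self_eq_norm_sq, norm_vecLoc]; norm_num
  rw [h3] at h2
  have h4 := DFunLike.congr_fun (h2.unique (hasFDerivAt_const (1 : ℝ) z)) v
  simp [real_inner_comm] at h4
  linarith

theorem inner_vecLoc_fderiv_fderiv (hz : z ∈ p.chartTarget) (v v') :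
    ⟪p.vecLoc z, fderiv ℝ (fderiv ℝ p.vecLoc) z v v'⟫ =
      -⟪fderiv ℝ p.vecLoc z v, fderiv ℝ p.vecLoc z v'⟫ := by
  have h1 := ((p.contDiffAt_vecLoc hz).differentiableAt (by simp)).hasFDerivAt
  have h2 := h1.inner ℝ ((p.hasFDerivAt_fderiv_vecLoc hz).clm_apply (hasFDerivAt_const v' z))
  have h3 : (fun z => ⟪p.vecLoc z, fderiv ℝ p.vecLoc z v'⟫) =ᶠ[𝓝 z] fun _ => (0 : ℝ) := by
    filter_upwards [p.chartTarget_mem_nhds hz] with y hy using p.inner_vecLoc_fderiv hy v'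
  have h4 := DFunLike.congr_fun
    ((h2.congr_of_eventuallyEq h3.symm).unique (hasFDerivAt_const (0 : ℝ) z)) v
  simp at h4
  linarith

/-- The second component of the chart recovers the coordinate `y` from the unit normal vector. -/
theorem fderiv_vecLoc_injective (hz : z ∈ p.chartTarget) {y}
    (hy : fderiv ℝ p.vecLoc z (0, y) = 0) : y = 0 := by
  have hpos := p.inner_vec_vecLoc_pos hz
  have h1 : DifferentiableAt ℝ (fun v : E => ⟪p.vec, v⟫⁻¹ • p.coframe v) (p.vecLoc z) := by
    have h2 : DifferentiableAt ℝ (fun v : E => ⟪p.vec, v⟫) (p.vecLoc z) :=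
      (differentiableAt_const _).inner ℝ differentiableAt_id
    exact (h2.inv hpos.ne').smul p.coframe.differentiableAt
  have h2 := h1.hasFDerivAt.comp z
    ((p.contDiffAt_vecLoc hz).differentiableAt (by simp)).hasFDerivAt
  have h3 : ((fun v : E => ⟪p.vec, v⟫⁻¹ • p.coframe v) ∘ p.vecLoc) =ᶠ[𝓝 z] Prod.snd := by
    filter_upwards [p.chartTarget_mem_nhds hz] with z hz
    exact congrArg Prod.snd (p.chartFun_chartInv hz)
  have h4 := DFunLike.congr_fun ((h2.congr_of_eventuallyEq h3.symm).unique hasFDerivAt_snd) (0, y)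
  rw [ContinuousLinearMap.comp_apply, hy, map_zero] at h4
  exact h4.symm

/-- The second derivative of the normal vector along the unit normal sphere is, up to a tangential
term, the one of the unit sphere of the normal space. -/
theorem exists_fderiv_fderiv_vecLoc (hz : z ∈ p.chartTarget) (y y') :
    ∃ y'', fderiv ℝ (fderiv ℝ p.vecLoc) z (0, y) (0, y') = fderiv ℝ p.vecLoc z (0, y'')
      - ⟪fderiv ℝ p.vecLoc z (0, y), fderiv ℝ p.vecLoc z (0, y')⟫ • p.vecLoc z := by
  set p' := p.chartInv z with hp'
  have hbase : p'.base = (extChartAt (𝓡 d) p.base).symm z.1 := p.base_chartInv hz.2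
  have hvec : p'.vec = p.vecLoc z := rfl
  set A : EuclideanSpace ℝ (Fin (n - d - 1)) →ₗ[ℝ] E :=
    (fderiv ℝ p.vecLoc z).toLinearMap ∘ₗ LinearMap.inr ℝ _ _ with hA
  have hA' : ∀ y, A y = fderiv ℝ p.vecLoc z (0, y) := fun y => rfl
  have hinj : Function.Injective A := by
    rw [injective_iff_map_eq_zero]
    exact fun y hy => p.fderiv_vecLoc_injective hz hy
  have hle : LinearMap.range A ≤ p'.perp := by
    rintro _ ⟨y, rfl⟩
    refine ⟨Submodule.mem_orthogonal_singleton_iff_inner_right.2 ?_, ?_⟩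
    · rw [hvec, hA', p.inner_vecLoc_fderiv hz]
    · rw [hbase]
      exact p.fderiv_vecLoc_mem hz y
  have heq : LinearMap.range A = p'.perp := by
    refine Submodule.eq_of_le_of_finrank_eq hle ?_
    rw [LinearMap.finrank_range_of_inj hinj, p'.finrank_perp]
    simp
  have hmem : fderiv ℝ (fderiv ℝ p.vecLoc) z (0, y) (0, y')
      + ⟪fderiv ℝ p.vecLoc z (0, y), fderiv ℝ p.vecLoc z (0, y')⟫ • p.vecLoc z ∈ p'.perp := by
    refine ⟨Submodule.mem_orthogonal_singleton_iff_inner_right.2 ?_, ?_⟩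
    · rw [hvec, inner_add_right, p.inner_vecLoc_fderiv_fderiv hz, inner_smul_right,
        real_inner_self_eq_norm_sq, norm_vecLoc]
      ring
    · rw [hbase]
      exact Submodule.add_mem _ (p.fderiv_fderiv_vecLoc_mem hz y y')
        (Submodule.smul_mem _ _ (p.vecLoc_mem hz))
  rw [← heq] at hmem
  obtain ⟨y'', hy''⟩ := hmem
  exact ⟨y'', by rw [← hA', hy'', add_sub_cancel_right]⟩

/-- The jet of the chart at `p` at the point with coordinates `z`. -/
noncomputable def jet (hpos : ∀ p, 0 < scalarCurvature (𝓡 n) f.toFun p) (hz : z ∈ p.chartTarget) :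
    NormalJet (EuclideanSpace ℝ (Fin d)) (EuclideanSpace ℝ (Fin (n - d - 1))) E where
  φ₁ := fderiv ℝ p.footLoc z.1
  φ₂ := fderiv ℝ (fderiv ℝ p.footLoc) z.1
  ν := p.vecLoc z
  ν₁ := fderiv ℝ p.vecLoc z
  ν₂ := fderiv ℝ (fderiv ℝ p.vecLoc) z
  ξ := p.xiLoc z.1
  ξ₁ := fderiv ℝ p.xiLoc z.1
  ξ₂ := fderiv ℝ (fderiv ℝ p.xiLoc) z.1
  φ₂_symm := sndFDeriv_symm ((p.contDiffAt_footLoc hz).of_le ENat.LEInfty.out)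
  ν₂_symm := sndFDeriv_symm ((p.contDiffAt_vecLoc hz).of_le ENat.LEInfty.out)
  ξ₂_symm := sndFDeriv_symm ((p.contDiffAt_xiLoc hpos hz).of_le ENat.LEInfty.out)
  norm_ν := p.norm_vecLoc z
  norm_ξ := norm_xi hpos _
  inner_ν_ξ := tangentImage_inner_xi _ (p.vecLoc_mem hz).1
  inner_ν_φ₁ x := by
    rw [real_inner_comm]
    exact (p.vecLoc_mem hz).2 _ (p.fderiv_footLoc_mem hz x)
  inner_ξ_φ₁ x := by
    rw [real_inner_comm]
    exact tangentImage_inner_xi _ (tangentImage_restrict_le f ι _ (p.fderiv_footLoc_mem hz x))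
  inner_ν_ν₁ y := p.inner_vecLoc_fderiv hz _
  inner_ξ_ν₁ y := by
    rw [real_inner_comm]
    exact tangentImage_inner_xi _ (p.fderiv_vecLoc_mem hz y).1
  inner_ν₁_φ₁ y x := by
    rw [real_inner_comm]
    exact (p.fderiv_vecLoc_mem hz y).2 _ (p.fderiv_footLoc_mem hz x)
  exists_ν₂ := p.exists_fderiv_fderiv_vecLoc hz

end UnitNormal
end BendingJet
end Bending

/-! ### Controlled curves and uniform estimates -/

namespace Bending

namespace Controlled

variable {k : ℕ} {γ : ℝ → EuclideanSpace ℝ (Fin 2)} {s₀ s₁ s : ℝ}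

theorem contDiffAt_curveA (h : Controlled k γ s₀ s₁) (hs : s ∈ Set.Icc s₀ s₁) :
    ContDiffAt ℝ ∞ (curveA γ) s :=
  (contDiffAt_piLp 2).1 (h.smooth s hs) 0

theorem contDiffAt_curveB (h : Controlled k γ s₀ s₁) (hs : s ∈ Set.Icc s₀ s₁) :
    ContDiffAt ℝ ∞ (curveB γ) s :=
  (contDiffAt_piLp 2).1 (h.smooth s hs) 1

theorem deriv_sq_add_deriv_sq (h : Controlled k γ s₀ s₁) (hs : s ∈ Set.Icc s₀ s₁) :
    deriv (curveA γ) s ^ 2 + deriv (curveB γ) s ^ 2 = 1 := by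
  have h1 : DifferentiableAt ℝ γ s := (h.smooth s hs).differentiableAt (by simp)
  have h2 : ∀ i, HasDerivAt (fun t => γ t i) (deriv γ s i) s := fun i =>
    (EuclideanSpace.proj (𝕜 := ℝ) i).hasFDerivAt.comp_hasDerivAt s h1.hasDerivAt
  have h3 := h.unit_speed s hs
  have hA : deriv (curveA γ) s = deriv γ s 0 := (h2 0).deriv
  have hB : deriv (curveB γ) s = deriv γ s 1 := (h2 1).deriv
  rw [EuclideanSpace.norm_eq, Real.sqrt_eq_one] at h3
  simpa [Fin.sum_univ_two, ← hA, ← hB] using h3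

/-- The acceleration of a unit speed curve is normal to it. At the end points of the interval this
follows from the one-sided derivatives. -/
theorem deriv_deriv_eq (h : Controlled k γ s₀ s₁) (hs₀₁ : s₀ < s₁) (hs : s ∈ Set.Icc s₀ s₁) :
    deriv (deriv (curveA γ)) s = -(curveKappa γ s * deriv (curveB γ) s) ∧
      deriv (deriv (curveB γ)) s = curveKappa γ s * deriv (curveA γ) s := by
  have had := (hasFDerivAt_fderiv_apply (h.contDiffAt_curveA hs) 1).differentiableAt
  have hbd := (hasFDerivAt_fderiv_apply (h.contDiffAt_curveB hs) 1).differentiableAt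
  simp only [fderiv_apply_one_eq_deriv] at had hbd
  have h1 := (had.hasDerivAt.pow 2).add (hbd.hasDerivAt.pow 2)
  have h2 : Set.EqOn (deriv (curveA γ) ^ 2 + deriv (curveB γ) ^ 2) (fun _ => 1)
      (Set.Icc s₀ s₁) := fun t ht => h.deriv_sq_add_deriv_sq ht
  have h3 := (uniqueDiffOn_Icc hs₀₁ s hs).eq_deriv _ h1.hasDerivWithinAt
    ((hasDerivWithinAt_const s _ (1 : ℝ)).congr h2 (h2 hs))
  have h4 := h.deriv_sq_add_deriv_sq hs
  simp at h3
  rw [curveKappa]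
  constructor
  · linear_combination (-deriv (deriv (curveA γ)) s) * h4 + (deriv (curveA γ) s / 2) * h3
  · linear_combination (-deriv (deriv (curveB γ)) s) * h4 + (deriv (curveB γ) s / 2) * h3

theorem deriv_curveB (h : Controlled k γ s₀ s₁) (hs : s ∈ Set.Icc s₀ s₁) :
    deriv (curveB γ) s = curveSigma γ s * curveA γ s := by
  rw [curveSigma, div_mul_cancel₀ _ (h.a_ne_zero s hs)]

/-- The two bounds for the curvature are compatible only if `σ` is nonnegative. -/
theorem curveSigma_nonneg (h : Controlled k γ s₀ s₁) (hs : s ∈ Set.Icc s₀ s₁) :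
    0 ≤ curveSigma γ s := by
  have h1 := (h.le_kappa s hs).trans (h.kappa_le s hs)
  have h2 : (0 : ℝ) ≤ k := Nat.cast_nonneg k
  by_contra hneg
  push Not at hneg
  nlinarith

end Controlled

theorem HasExtent.abs_le {ρ : ℝ} {γ : ℝ → EuclideanSpace ℝ (Fin 2)} {s₀ s₁ s : ℝ}
    (h : HasExtent ρ γ s₀ s₁) (hs : s ∈ Set.Icc s₀ s₁) :
    |curveA γ s| ≤ ρ ∧ |curveB γ s| ≤ ρ :=
  ⟨(PiLp.norm_apply_le (γ s) 0).trans (h s hs).le, (PiLp.norm_apply_le (γ s) 1).trans (h s hs).le⟩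

section Bound

variable {n d : ℕ}
  {M : Type*} [TopologicalSpace M] [ChartedSpace (EuclideanSpace ℝ (Fin n)) M]
  {S : Type*} [TopologicalSpace S] [ChartedSpace (EuclideanSpace ℝ (Fin d)) S]
  {E : Type*} [NormedAddCommGroup E] [InnerProductSpace ℝ E] [FiniteDimensional ℝ E]
  {f : Immersion (𝓡 n) 𝓘(ℝ, E) M E} {ι : Embedding (𝓡 d) (𝓡 n) S M}
  [IsManifold (𝓡 n) ∞ M] [IsManifold (𝓡 d) ∞ S]

namespace UnitNormal

variable (p : UnitNormal f ι)

theorem mem_chartSource_self : p ∈ p.chartSource := by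
  refine ⟨mem_extChartAt_source p.base, ?_, ?_⟩
  · rw [p.transport_self]; exact isUnit_one
  · rw [real_inner_self_eq_norm_sq, p.norm_vec]; norm_num

/-- The inverse of the chart of `UnitNormal f ι × ℝ` given by the chart at `p`. -/
noncomputable def param
    (w : (EuclideanSpace ℝ (Fin d) × EuclideanSpace ℝ (Fin (n - d - 1))) × ℝ) :
    UnitNormal f ι × ℝ := (p.chartInv w.1, w.2)

variable {w : (EuclideanSpace ℝ (Fin d) × EuclideanSpace ℝ (Fin (n - d - 1))) × ℝ}

theorem bending_comp_param (γ : ℝ → EuclideanSpace ℝ (Fin 2)) (hw : w.1 ∈ p.chartTarget) :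
    bending f ι γ ∘ p.param =ᶠ[𝓝 w] fun w => p.footLoc w.1.1 + curveA γ w.2 • p.vecLoc w.1
      + curveB γ w.2 • p.xiLoc w.1.1 := by
  filter_upwards [continuous_fst.continuousAt.eventually (p.chartTarget_mem_nhds hw)] with w hw
  simp only [bending, param, Function.comp_apply, footLoc, vecLoc, xiLoc, localRep]
  rw [p.base_chartInv hw.2]

theorem contMDiffAt_param (hw : w.1 ∈ p.chartTarget) :
    ContMDiffAt 𝓘(ℝ, (EuclideanSpace ℝ (Fin d) × EuclideanSpace ℝ (Fin (n - d - 1))) × ℝ)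
      (sigmaModel n d) ∞ p.param w := by
  have h1 : ContMDiffAt 𝓘(ℝ, EuclideanSpace ℝ (Fin d) × EuclideanSpace ℝ (Fin (n - d - 1)))
      𝓘(ℝ, EuclideanSpace ℝ (Fin d) × EuclideanSpace ℝ (Fin (n - d - 1))) ∞ p.chartInv w.1 :=
    (contMDiffOn_chart_symm (x := p)).contMDiffAt (p.chartTarget_mem_nhds hw)
  exact (h1.comp w contDiff_fst.contMDiff.contMDiffAt).prodMk
    contDiff_snd.contMDiff.contMDiffAt

variable {k : ℕ} {γ : ℝ → EuclideanSpace ℝ (Fin 2)} {s₀ s₁ : ℝ}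

theorem contDiffAt_bending_comp_param (hpos : ∀ p, 0 < scalarCurvature (𝓡 n) f.toFun p)
    (hγ : Controlled k γ s₀ s₁) (hw : w.1 ∈ p.chartTarget) (hs : w.2 ∈ Set.Icc s₀ s₁) :
    ContDiffAt ℝ ∞ (bending f ι γ ∘ p.param) w := by
  refine ContDiffAt.congr_of_eventuallyEq ?_ (p.bending_comp_param γ hw)
  refine (ContDiffAt.add ?_ (ContDiffAt.smul ?_ ?_)).add (ContDiffAt.smul ?_ ?_)
  · exact ContDiffAt.comp (g := p.footLoc) w (p.contDiffAt_footLoc hw)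
      (contDiff_fst.fst).contDiffAt
  · exact (hγ.contDiffAt_curveA hs).comp w contDiff_snd.contDiffAt
  · exact (p.contDiffAt_vecLoc hw).comp w contDiff_fst.contDiffAt
  · exact (hγ.contDiffAt_curveB hs).comp w contDiff_snd.contDiffAt
  · exact ContDiffAt.comp (g := p.xiLoc) w (p.contDiffAt_xiLoc hpos hw)
      (contDiff_fst.fst).contDiffAt

theorem contMDiffAt_bending (hpos : ∀ p, 0 < scalarCurvature (𝓡 n) f.toFun p)
    (hγ : Controlled k γ s₀ s₁) {s : ℝ} (hs : s ∈ Set.Icc s₀ s₁) :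
    ContMDiffAt (sigmaModel n d) 𝓘(ℝ, E) ∞ (bending f ι γ) (p, s) := by
  have hp : p ∈ p.chartSource := p.mem_chartSource_self
  have hchart : ContMDiffAt
      𝓘(ℝ, EuclideanSpace ℝ (Fin d) × EuclideanSpace ℝ (Fin (n - d - 1)))
      𝓘(ℝ, EuclideanSpace ℝ (Fin d) × EuclideanSpace ℝ (Fin (n - d - 1))) ∞ p.chartFun p :=
    (contMDiffOn_chart (x := p)).contMDiffAt (p.isOpen_chartSource.mem_nhds hp)
  have h1 : ContMDiffAt (sigmaModel n d)
      𝓘(ℝ, (EuclideanSpace ℝ (Fin d) × EuclideanSpace ℝ (Fin (n - d - 1))) × ℝ) ∞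
      (fun q : UnitNormal f ι × ℝ => (p.chartFun q.1, q.2)) (p, s) :=
    (ContMDiffAt.comp (p, s) hchart contMDiffAt_fst).prodMk_space contMDiffAt_snd
  have h2 := (p.contDiffAt_bending_comp_param (w := (p.chartFun p, s)) hpos hγ
    (p.chartFun_mem hp) hs).contMDiffAt
  refine (h2.comp (p, s) h1).congr_of_eventuallyEq ?_
  filter_upwards [continuous_fst.continuousAt.eventually (p.isOpen_chartSource.mem_nhds hp)]
    with q hq
  simp only [Function.comp_apply, param]
  rw [p.chartInv_chartFun hq]

theorem isBendingJet (hpos : ∀ p, 0 < scalarCurvature (𝓡 n) f.toFun p)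
    (hs₀₁ : s₀ < s₁) (hγ : Controlled k γ s₀ s₁) (hw : w.1 ∈ p.chartTarget)
    (hs : w.2 ∈ Set.Icc s₀ s₁) :
    IsBendingJet (p.jet hpos hw) (curveA γ w.2) (curveB γ w.2) (deriv (curveA γ) w.2)
      (deriv (curveB γ) w.2) (curveKappa γ w.2) (curveSigma γ w.2)
      (fderiv ℝ (bending f ι γ ∘ p.param) w)
      (fderiv ℝ (fderiv ℝ (bending f ι γ ∘ p.param)) w) where
  L_apply v := by
    rw [(p.bending_comp_param γ hw).fderiv_eq]
    exact fderiv_bending ((p.contDiffAt_footLoc hw).differentiableAt (by simp))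
      ((p.contDiffAt_vecLoc hw).differentiableAt (by simp))
      ((p.contDiffAt_xiLoc hpos hw).differentiableAt (by simp))
      ((hγ.contDiffAt_curveA hs).differentiableAt (by simp))
      ((hγ.contDiffAt_curveB hs).differentiableAt (by simp)) v
  B_apply v v' := by
    rw [(p.bending_comp_param γ hw).fderiv.fderiv_eq]
    refine (fderiv_fderiv_bending (p.contDiffAt_footLoc hw) (p.contDiffAt_vecLoc hw)
      (p.contDiffAt_xiLoc hpos hw) (hγ.contDiffAt_curveA hs) (hγ.contDiffAt_curveB hs)
      v v').trans ?_
    rw [(hγ.deriv_deriv_eq hs₀₁ hs).1, (hγ.deriv_deriv_eq hs₀₁ hs).2]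
    simp only [jet]
    module
  a_ne_zero := hγ.a_ne_zero _ hs
  unit_speed := hγ.deriv_sq_add_deriv_sq hs
  b₁_eq := hγ.deriv_curveB hs

theorem eventually_opNorm_le {Z F : Type*} [TopologicalSpace Z] [NormedAddCommGroup F]
    {g : Z → F} {z : Z} (hg : ContinuousAt g z) : ∀ᶠ y in 𝓝 z, ‖g y‖ ≤ ‖g z‖ + 1 :=
  (hg.norm.eventually_lt_const (lt_add_one _)).mono fun _ h => h.le

/-- The jets at nearby points satisfy uniform bounds. -/
theorem eventually_isBounded_jet (hpos : ∀ p, 0 < scalarCurvature (𝓡 n) f.toFun p) :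
    ∃ K c : ℝ, 0 < K ∧ 0 < c ∧ ∀ᶠ z in 𝓝 (p.chartFun p), ∀ hz : z ∈ p.chartTarget,
      (p.jet hpos hz).IsBounded K c := by
  have hz₀ : p.chartFun p ∈ p.chartTarget := p.chartFun_mem (p.mem_chartSource_self)
  set z₀ := p.chartFun p
  have hφ : ContDiffAt ℝ ∞ (fun z : EuclideanSpace ℝ (Fin d) × EuclideanSpace ℝ (Fin (n - d - 1))
      => fderiv ℝ p.footLoc z.1) z₀ :=
    ContDiffAt.comp z₀ ((p.contDiffAt_footLoc hz₀).fderiv_right (m := ∞) (by simp)) contDiffAt_fst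
  have hφ2 : ContDiffAt ℝ ∞ (fun z : EuclideanSpace ℝ (Fin d) × EuclideanSpace ℝ (Fin (n - d - 1))
      => fderiv ℝ (fderiv ℝ p.footLoc) z.1) z₀ :=
    ContDiffAt.comp z₀ (((p.contDiffAt_footLoc hz₀).fderiv_right (m := ∞) (by simp)).fderiv_right
      (m := ∞) (by simp)) contDiffAt_fst
  have hν : ContDiffAt ℝ ∞ (fderiv ℝ p.vecLoc) z₀ :=
    (p.contDiffAt_vecLoc hz₀).fderiv_right (m := ∞) (by simp)
  have hν2 : ContDiffAt ℝ ∞ (fderiv ℝ (fderiv ℝ p.vecLoc)) z₀ :=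
    hν.fderiv_right (m := ∞) (by simp)
  have hξ : ContDiffAt ℝ ∞ (fun z : EuclideanSpace ℝ (Fin d) × EuclideanSpace ℝ (Fin (n - d - 1))
      => fderiv ℝ p.xiLoc z.1) z₀ :=
    ContDiffAt.comp z₀ ((p.contDiffAt_xiLoc hpos hz₀).fderiv_right (m := ∞) (by simp))
      contDiffAt_fst
  have hξ2 : ContDiffAt ℝ ∞ (fun z : EuclideanSpace ℝ (Fin d) × EuclideanSpace ℝ (Fin (n - d - 1))
      => fderiv ℝ (fderiv ℝ p.xiLoc) z.1) z₀ :=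
    ContDiffAt.comp z₀ (((p.contDiffAt_xiLoc hpos hz₀).fderiv_right (m := ∞)
      (by simp)).fderiv_right (m := ∞) (by simp)) contDiffAt_fst
  obtain ⟨c₁, hc₁, h₁⟩ := eventually_bounded_below hφ.continuousAt (p.injective_fderiv_footLoc hz₀)
  have hνY : ContinuousAt (fun z => (fderiv ℝ p.vecLoc z).comp
      (ContinuousLinearMap.inr ℝ (EuclideanSpace ℝ (Fin d)) (EuclideanSpace ℝ (Fin (n - d - 1)))))
      z₀ := (hν.clm_comp contDiffAt_const).continuousAt
  obtain ⟨c₂, hc₂, h₂⟩ := eventually_bounded_below hνY (by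
    rw [injective_iff_map_eq_zero]
    exact fun y hy => p.fderiv_vecLoc_injective hz₀ hy)
  set K₁ := ‖fderiv ℝ (fderiv ℝ p.footLoc) z₀.1‖
  set K₂ := ‖fderiv ℝ p.vecLoc z₀‖
  set K₃ := ‖fderiv ℝ (fderiv ℝ p.vecLoc) z₀‖
  set K₄ := ‖fderiv ℝ p.xiLoc z₀.1‖
  set K₅ := ‖fderiv ℝ (fderiv ℝ p.xiLoc) z₀.1‖
  have k₁ : 0 ≤ K₁ := norm_nonneg (fderiv ℝ (fderiv ℝ p.footLoc) z₀.1)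
  have k₂ : 0 ≤ K₂ := norm_nonneg _
  have k₃ : 0 ≤ K₃ := norm_nonneg (fderiv ℝ (fderiv ℝ p.vecLoc) z₀)
  have k₄ : 0 ≤ K₄ := norm_nonneg _
  have k₅ : 0 ≤ K₅ := norm_nonneg (fderiv ℝ (fderiv ℝ p.xiLoc) z₀.1)
  refine ⟨K₁ + K₂ + K₃ + K₄ + K₅ + 1, min c₁ c₂, by linarith, lt_min hc₁ hc₂, ?_⟩
  filter_upwards [h₁, h₂, eventually_opNorm_le hφ2.continuousAt,
    eventually_opNorm_le hν.continuousAt, eventually_opNorm_le hν2.continuousAt,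
    eventually_opNorm_le hξ.continuousAt, eventually_opNorm_le hξ2.continuousAt]
    with z e₁ e₂ e₃ e₄ e₅ e₆ e₇ hz
  exact
    { c_pos := lt_min hc₁ hc₂
      K_pos := by linarith
      le_φ₁ := fun x => (mul_le_mul_of_nonneg_right (min_le_left _ _) (norm_nonneg _)).trans (e₁ x)
      le_ν₁ := fun y =>
        (mul_le_mul_of_nonneg_right (min_le_right _ _) (norm_nonneg _)).trans (e₂ y)
      φ₂_le := e₃.trans (by linarith)
      ν₁_le := e₄.trans (by linarith)
      ν₂_le := e₅.trans (by linarith)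
      ξ₁_le := e₆.trans (by linarith)
      ξ₂_le := e₇.trans (by linarith) }

end UnitNormal

/-- The curvature estimate with constants `C` and `ρ` at the unit normal vector `p`. -/
def CurvatureBound (k : ℕ) (f : Immersion (𝓡 n) 𝓘(ℝ, E) M E) (ι : Embedding (𝓡 d) (𝓡 n) S M)
    (C ρ : ℝ) (p : UnitNormal f ι) : Prop :=
  ∀ (s₀ s₁ : ℝ) (γ : ℝ → EuclideanSpace ℝ (Fin 2)), s₀ < s₁ → Controlled k γ s₀ s₁ →
    HasExtent ρ γ s₀ s₁ → ∀ s ∈ Set.Icc s₀ s₁,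
      IsImmersionAt (sigmaModel n d) 𝓘(ℝ, E) (bending f ι γ) (p, s) ∧
      ((k : ℝ) - 1) * ((k : ℝ) - 2) / 16 * curveSigma γ s ^ 2 - C * curveSigma γ s - C
        ≤ scalarCurvature (sigmaModel n d) (bending f ι γ) (p, s)

theorem CurvatureBound.mono {k : ℕ} {C C' ρ ρ' : ℝ} {p : UnitNormal f ι}
    (h : CurvatureBound k f ι C ρ p) (hC : C ≤ C') (hρ : ρ' ≤ ρ) :
    CurvatureBound k f ι C' ρ' p := by
  intro s₀ s₁ γ hs₀₁ hγ hext s hs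
  obtain ⟨h1, h2⟩ := h s₀ s₁ γ hs₀₁ hγ (fun t ht => (hext t ht).trans_le hρ) s hs
  refine ⟨h1, le_trans ?_ h2⟩
  have := mul_le_mul_of_nonneg_right hC (hγ.curveSigma_nonneg hs)
  linarith

set_option synthInstance.maxHeartbeats 200000 in
/-- Locally on the unit normal bundle the constants depend only on bounds for the jets. -/
theorem eventually_curvatureBound {k : ℕ} (hk : 3 ≤ k) (hn : n = d + k)
    (hpos : ∀ p, 0 < scalarCurvature (𝓡 n) f.toFun p) (p₀ : UnitNormal f ι) :
    ∃ C ρ : ℝ, 0 ≤ C ∧ 0 < ρ ∧ ∀ᶠ p in 𝓝 p₀, CurvatureBound k f ι C ρ p := by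
  obtain ⟨K, c, hK, hc, hbd⟩ := p₀.eventually_isBounded_jet hpos
  have hm : Module.finrank ℝ (EuclideanSpace ℝ (Fin (n - d - 1))) = k - 1 := by
    rw [finrank_euclideanSpace_fin]; omega
  have β := Module.finBasis ℝ
      ((EuclideanSpace ℝ (Fin d) × EuclideanSpace ℝ (Fin (n - d - 1))) × ℝ)
  obtain ⟨C, ρ, hC, hρ, hmain⟩ := exists_const_le_gaussScal
    (X := EuclideanSpace ℝ (Fin d)) (Y := EuclideanSpace ℝ (Fin (n - d - 1))) (E := E)
    β hm (by omega) hK hc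
  have hcast : ((k - 1 : ℕ) : ℝ) = k - 1 := by
    rw [Nat.cast_sub (by omega)]; simp
  have hp₀ : p₀ ∈ p₀.chartSource := p₀.mem_chartSource_self
  have hnhds : p₀.chartSource ∈ 𝓝 p₀ := p₀.isOpen_chartSource.mem_nhds hp₀
  refine ⟨C, ρ, hC, hρ, ?_⟩
  filter_upwards [hnhds, (p₀.continuousOn_chartFun.continuousAt hnhds).eventually hbd]
    with p hp hpb s₀ s₁ γ hs₀₁ hγ hext s hs
  have hz := p₀.chartFun_mem hp
  have hjet := p₀.isBendingJet (w := (p₀.chartFun p, s)) hpos hs₀₁ hγ hz hs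
  have hparam : p₀.param (p₀.chartFun p, s) = (p, s) := by
    rw [UnitNormal.param, p₀.chartInv_chartFun hp]
  have hκ := hγ.le_kappa s hs
  obtain ⟨hinj, hle⟩ := hmain _ (hpb hz) _ _ _ _ _ _ _ _ hjet (hext.abs_le hs).1
    (hext.abs_le hs).2 (by rw [hcast]; linarith) (hγ.kappa_le s hs) (hγ.curveSigma_nonneg hs)
  have hF : ContMDiffAt (sigmaModel n d) 𝓘(ℝ, E) ∞ (bending f ι γ)
      (p₀.param (p₀.chartFun p, s)) := by
    rw [hparam]; exact p.contMDiffAt_bending hpos hγ hs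
  have hψ := p₀.contMDiffAt_param (w := (p₀.chartFun p, s)) hz
  have h1 := isImmersionAt_of_comp hF hψ hinj
  have h2 := scalarCurvature_eq_gaussScal β hF hψ hinj
  rw [hparam] at h1 h2
  refine ⟨h1, ?_⟩
  rw [h2]
  rw [hcast] at hle
  have e : ((k : ℝ) - 1) * (k - 1 - 1) = (k - 1) * (k - 2) := by ring
  rwa [e] at hle

theorem compactSpace_unitNormal [CompactSpace S] : CompactSpace (UnitNormal f ι) := by
  have : ProperSpace E := FiniteDimensional.proper ℝ E
  have hclosed : IsClosed {q : S × E | q.2 ∈ normalSpace f ι q.1 ∧ ‖q.2‖ = 1} := by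
    have h1 : {q : S × E | q.2 ∈ normalSpace f ι q.1 ∧ ‖q.2‖ = 1} =
        {q : S × E | (normalSpace f ι q.1).starProjection q.2 = q.2} ∩ {q | ‖q.2‖ = 1} := by
      ext q
      simp [Submodule.starProjection_eq_self_iff]
    rw [h1]
    refine (isClosed_eq ?_ continuous_snd).inter
      (isClosed_eq continuous_snd.norm continuous_const)
    exact ((contMDiff_starProjection_normalSpace f ι).continuous.comp continuous_fst).clm_apply
      continuous_snd
  refine isCompact_iff_compactSpace.1 (IsCompact.of_isClosed_subset
    (isCompact_univ.prod (isCompact_sphere (0 : E) 1)) hclosed ?_)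
  rintro ⟨q, v⟩ ⟨-, hv⟩
  simpa using hv

theorem exists_curvatureBound [CompactSpace S] {k : ℕ} (hk : 3 ≤ k) (hn : n = d + k)
    (hpos : ∀ p, 0 < scalarCurvature (𝓡 n) f.toFun p) :
    ∃ C ρ : ℝ, 0 ≤ C ∧ 0 < ρ ∧ ∀ p, CurvatureBound k f ι C ρ p := by
  have := compactSpace_unitNormal (f := f) (ι := ι)
  have h := (isCompact_univ (X := UnitNormal f ι)).induction_on
    (p := fun A => ∃ C ρ : ℝ, 0 ≤ C ∧ 0 < ρ ∧ ∀ p ∈ A, CurvatureBound k f ι C ρ p)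
    ⟨0, 1, le_rfl, one_pos, fun p hp => hp.elim⟩
    (fun A A' hAA' ⟨C, ρ, hC, hρ, h⟩ => ⟨C, ρ, hC, hρ, fun p hp => h p (hAA' hp)⟩)
    (fun A A' ⟨C, ρ, hC, hρ, h⟩ ⟨C', ρ', hC', hρ', h'⟩ =>
      ⟨max C C', min ρ ρ', hC.trans (le_max_left _ _), lt_min hρ hρ', fun p hp => hp.elim
        (fun hp => (h p hp).mono (le_max_left _ _) (min_le_left _ _))
        (fun hp => (h' p hp).mono (le_max_right _ _) (min_le_right _ _))⟩)
    (fun p₀ _ => by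
      obtain ⟨C, ρ, hC, hρ, h⟩ := eventually_curvatureBound hk hn hpos p₀
      exact ⟨_, mem_nhdsWithin_of_mem_nhds h, C, ρ, hC, hρ, fun p hp => hp⟩)
  obtain ⟨C, ρ, hC, hρ, h⟩ := h
  exact ⟨C, ρ, hC, hρ, fun p => h p trivial⟩

end Bound
end Bending

theorem mainTheorem9 {n d k N : ℕ} (hk : 3 ≤ k) (hn : n = d + k)
    {M : Type*} [TopologicalSpace M] [T2Space M] [SecondCountableTopology M]
    [ChartedSpace (EuclideanSpace ℝ (Fin n)) M] [IsManifold (𝓡 n) ∞ M]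
    {S : Type*} [TopologicalSpace S] [CompactSpace S]
    [ChartedSpace (EuclideanSpace ℝ (Fin d)) S] [IsManifold (𝓡 d) ∞ S]
    (f : Bending.Immersion (𝓡 n) 𝓘(ℝ, EuclideanSpace ℝ (Fin N)) M (EuclideanSpace ℝ (Fin N)))
    (hf : Bending.IsScalarPositiveOn (𝓡 n) f.toFun Set.univ)
    (ι : Bending.Embedding (𝓡 d) (𝓡 n) S M)
    (ρ₀ : ℝ) (hρ₀ : 0 < ρ₀) :
    ∃ C ρ : ℝ, 0 ≤ C ∧ 0 < ρ ∧ ρ ≤ ρ₀ ∧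
      (∀ (s₀ s₁ : ℝ) (γ : ℝ → EuclideanSpace ℝ (Fin 2)), s₀ < s₁ →
        Bending.Controlled k γ s₀ s₁ → Bending.HasExtent ρ γ s₀ s₁ →
        ∀ (p : Bending.UnitNormal f ι), ∀ s ∈ Set.Icc s₀ s₁,
          Bending.IsImmersionAt (Bending.sigmaModel n d) 𝓘(ℝ, EuclideanSpace ℝ (Fin N))
            (Bending.bending f ι γ) (p, s) ∧
          ((k : ℝ) - 1) * ((k : ℝ) - 2) / 16 * Bending.curveSigma γ s ^ 2
              - C * Bending.curveSigma γ s - C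
            ≤ Bending.scalarCurvature (Bending.sigmaModel n d) (Bending.bending f ι γ) (p, s)) ∧
      ∃ σ₀ : ℝ, 0 < σ₀ ∧
        ∀ (s₀ s₁ : ℝ) (γ : ℝ → EuclideanSpace ℝ (Fin 2)), s₀ < s₁ →
          Bending.Controlled k γ s₀ s₁ → Bending.HasExtent ρ γ s₀ s₁ →
          (∀ s ∈ Set.Icc s₀ s₁, σ₀ ≤ Bending.curveSigma γ s) →
          Bending.IsScalarPositiveOn (Bending.sigmaModel n d) (Bending.bending f ι γ)
            (Set.univ ×ˢ Set.Icc s₀ s₁) := by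
  obtain ⟨C, ρ, hC, hρ, h⟩ :=
    Bending.exists_curvatureBound (f := f) (ι := ι) hk hn fun p => (hf p trivial).2
  have hk' : (3 : ℝ) ≤ k := by exact_mod_cast hk
  have hρ' : ∀ p, Bending.CurvatureBound k f ι C (min ρ ρ₀) p := fun p =>
    (h p).mono le_rfl (min_le_left _ _)
  refine ⟨C, min ρ ρ₀, hC, lt_min hρ hρ₀, min_le_right _ _,
    fun s₀ s₁ γ hs₀₁ hγ hext p s hs => hρ' p s₀ s₁ γ hs₀₁ hγ hext s hs,
    16 * C + 1, by linarith, ?_⟩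
  rintro s₀ s₁ γ hs₀₁ hγ hext hσ ⟨p, s⟩ ⟨-, hs⟩
  obtain ⟨h1, h2⟩ := hρ' p s₀ s₁ γ hs₀₁ hγ hext s hs
  refine ⟨h1, lt_of_lt_of_le ?_ h2⟩
  have hσs := hσ s hs
  set σ := Bending.curveSigma γ s
  have h3 : (1 : ℝ) / 8 ≤ ((k : ℝ) - 1) * ((k : ℝ) - 2) / 16 := by nlinarith
  have h4 : 1 / 8 * σ ^ 2 ≤ ((k : ℝ) - 1) * ((k : ℝ) - 2) / 16 * σ ^ 2 := by gcongr
  -- Here `σ ≥ 16 C + 1 ≥ 1`, hence `σ² / 8 ≥ (2 C + 1 / 8) σ > C σ + C`.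
  have h5 : (16 * C + 1) * σ ≤ σ ^ 2 := by nlinarith
  nlinarith
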